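/- **Setting.** Let $\gamma_1,\gamma_2,\gamma_3>-1$, let $(c_k)$ be a sequence of real numbers bounded above (for the affine $\mathbf B_2^{(1)}$ Toda system itself, $c_k=0$ for all $k$), and for each $k$ let $\mathbf u^k=(u_1^k,u_2^k,u_3^k)$ be a solution of $$\Delta u_i^k+\sum_{j=1}^3a_{ij}e^{u_j^k}=4\pi\gamma_i\delta_0\ \text{ in } B_1(0)\subset\mathbb R^2\ (i=1,2,3),\qquad u_1^k+u_2^k+2u_3^k=c_k\ \text{ in }B_1(0),\qquad (a_{ij})=\begin{pmatrix}1&0&-1\\0&1&-1\\-\frac12&-\frac12&1\end{pmatrix},$$ where the equations hold in the sense of distributions, $u_i^k\in C^2(B_1(0)\setminus\{0\})$, and the regular part $u_i^k-2\gamma_i\log|x|$ is continuous on $\overline{B_1(0)}$ (when maxima or rescalings below involve $u_i^k(0)$, this means the value at $0$ of the regular part). Assume that * $\max_i\sup_{B_1(0)}\big(u_i^k(x)-2\gamma_i\log|x|\big)\to+\infty$, while for every compact $K\subset B_1(0)\setminus\{0\}$ there is $C(K)$ with $u_i^k\le C(K)$ on $K$ for all $i,k$; * $|u_i^k(x)-u_i^k(y)|\le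 C$ for all $x,y\in\partial B_1(0)$ and all $i,k$; * $\int_{B_1(0)}e^{u_i^k}\,dx\le C$ for all $i,k$. **Blow-up set.** Let $\Sigma_k=\{0,x_1^k,\dots,x_m^k\}\subset B_1(0)$ consist of $0$ and $m$ distinct non-zero points, with $m\ge 0$ independent of $k$ (if $\gamma_1=\gamma_2=\gamma_3=0$, also $\Sigma_k=\{x^k_1,\dots,x^k_m\}$ with distinct points is allowed), and let $l_1^k,\dots,l_m^k>0$ be such that, for every $j$: 1. $x_j^k\to0$, $l_j^k\to0$, $l_j^k\le\frac12\operatorname{dist}(x_j^k,\Sigma_k\setminus\{x_j^k\})$, and the discs $B(x_j^k,l_j^k)$ are pairwise disjoint; 2. $\max_iu_i^k(x_j^k)=\max_i\max_{B(x_j^k,l_j^k)}u_i^k\to+\infty$, and $l_j^k/\varepsilon_j^k\to+\infty$, where $\varepsilon_j^k=e^{-\frac12\max_iu_i^k(x_j^k)}$; 3. for $v_i^k(y)=u_i^k(x_j^k+\varepsilon_j^ky)+2\log\varepsilon_j^k$ one of the following holds: (a) $v_1^k,v_3^k$ (or $v_2^k,v_3^k$) converge in $C^2_{\rm loc}(\mathbb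 R^2)$ to a solution $(v,w)$ of $-\Delta v=e^v-e^w$, $-\Delta w=-\frac12e^v+e^w$ in $\mathbb R^2$, and $v_2^k$ (or $v_1^k$) tends to $-\infty$ in $L^\infty_{\rm loc}(\mathbb R^2)$; (b) $v_1^k$ and $v_2^k$ converge in $C^2_{\rm loc}(\mathbb R^2)$ to solutions of $\Delta v+e^v=0$ in $\mathbb R^2$, and $v_3^k\to-\infty$ in $L^\infty_{\rm loc}(\mathbb R^2)$; (c) one component converges in $C^2_{\rm loc}(\mathbb R^2)$ to a solution of $\Delta v+e^v=0$ in $\mathbb R^2$ and the other two tend to $-\infty$ in $L^\infty_{\rm loc}(\mathbb R^2)$; and such that $\max_i u_i^k(x)+2\log\operatorname{dist}(x,\Sigma_k)\le C$ for all $x\in B_1(0)\setminus\Sigma_k$, with $C$ independent of $k$. **Proposition 2.5.** Let $\Sigma_k'\subseteq\Sigma_k$ with $0\in\Sigma_k'\subseteq B(x_k,r_k)\subseteq B_1(0)$ and $$\operatorname{dist}(\Sigma_k',\partial B(x_k,r_k))=o(1)\operatorname{dist}(\Sigma_k\setminus\Sigma_k',\partial B(x_k,r_k))$$ (the distance to the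 empty set being $+\infty$); if the $c_k$ are not all $0$, assume moreover that $r_k=o(1)\operatorname{dist}(\Sigma_k\setminus\Sigma_k',\partial B(x_k,r_k))$. Suppose that $u_1^k,u_2^k,u_3^k$ have fast decay on $\partial B(x_k,r_k)$, i.e. for each $i$ there are $N_k\to+\infty$ with $u_i^k(x)+2\log|x-x_k|\le-N_k$ for all $x\in\partial B(x_k,r_k)$. Put $\sigma_i^k=\frac1{2\pi}\int_{B(x_k,r_k)}e^{u_i^k}\,dx$. Then, as $k\to\infty$, $$(\sigma_1^k-\sigma_3^k-2\gamma_1)^2+(\sigma_2^k-\sigma_3^k-2\gamma_2)^2=4(\sigma_1^k+\sigma_2^k+2\sigma_3^k)+4(\gamma_1^2+\gamma_2^2)+o(1).$$ Furthermore, with $\mu_i=1+\gamma_i$ one has $\mu_1+\mu_2+2\mu_3=4$, and if $\sigma_i=\lim_{k\to\infty}\sigma_i^k$ for $i=1,2,3$ (possibly along a subsequence), then $$(\sigma_1-\sigma_3)^2+(\sigma_2-\sigma_3)^2=4(\mu_1\sigma_1+\mu_2\sigma_2+2\mu_3\sigma_3).$$ -/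

import Mathlib

open MeasureTheory Filter Topology Metric
open scoped ContDiff ENNReal

noncomputable section

namespace AffineToda

/-- The Euclidean plane `ℝ²`. -/
abbrev Plane : Type := EuclideanSpace ℝ (Fin 2)

/-- The coefficient matrix `A = (a_ij)`. The components `1, 2, 3` are indexed by `0, 1, 2`. -/
def A : Matrix (Fin 3) (Fin 3) ℝ :=
  !![1, 0, -1;
     0, 1, -1;
     -1 / 2, -1 / 2, 1]

/-- The regular part `u_i(x) - 2 γ_i log |x|` of the `i`-th component. Since `Real.log 0 = 0`, its
value at the origin is `u_i(0)`: the number `u_i(0)` stands for the value at `0` of the regular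
part (which is the value of `u_i` itself when `γ_i = 0`). -/
def regularPart (γ : Fin 3 → ℝ) (u : Fin 3 → Plane → ℝ) (i : Fin 3) (x : Plane) : ℝ :=
  u i x - 2 * γ i * Real.log ‖x‖

/-- `u = (u_1, u_2, u_3)` solves
`Δ u_i + ∑_j a_ij e^{u_j} = 4 π γ_i δ_0` in `B_1(0)` in the sense of distributions, together with
`u_1 + u_2 + 2 u_3 = c` in `B_1(0)`; it is `C²` away from the origin, and `u_i - 2 γ_i log |x|` is
continuous on the closed disc. The system itself has `c = 0`. -/
structure IsSolution (γ : Fin 3 → ℝ) (c : ℝ) (u : Fin 3 → Plane → ℝ) : Prop where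
  continuous_regularPart : ∀ i, ContinuousOn (regularPart γ u i) (closedBall 0 1)
  contDiffOn : ∀ i, ContDiffOn ℝ 2 (u i) (ball 0 1 \ {0})
  equation : ∀ i, ∀ φ : Plane → ℝ, ContDiff ℝ ∞ φ → HasCompactSupport φ →
    tsupport φ ⊆ ball 0 1 →
      (∫ x, u i x * Laplacian.laplacian φ x) + ∑ j, A i j * ∫ x, Real.exp (u j x) * φ x
        = 4 * Real.pi * γ i * φ 0
  constraint : ∀ x ∈ ball (0 : Plane) 1 \ {0}, u 0 x + u 1 x + 2 * u 2 x = c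

/-- The standing conditions on a blow-up sequence `u^k = u k`. -/
structure IsBlowupSequence (γ : Fin 3 → ℝ) (u : ℕ → Fin 3 → Plane → ℝ) : Prop where
  /-- `max_i sup_{B_1(0)} (u_i^k - 2 γ_i log |x|) → +∞`. -/
  blowup : ∀ M : ℝ, ∀ᶠ k in atTop, ∃ i, ∃ x ∈ ball (0 : Plane) 1, M < regularPart γ (u k) i x
  /-- No blow-up away from the origin. -/
  bounded_away : ∀ K : Set Plane, IsCompact K → K ⊆ ball 0 1 \ {0} →
    ∃ C : ℝ, ∀ k i, ∀ x ∈ K, u k i x ≤ C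
  /-- Bounded oscillation on the unit circle. -/
  bounded_osc : ∃ C : ℝ, ∀ k i, ∀ x ∈ sphere (0 : Plane) 1, ∀ y ∈ sphere (0 : Plane) 1,
    |u k i x - u k i y| ≤ C
  /-- Bounded energy. -/
  bounded_energy : ∃ C : ℝ, ∀ k i,
    IntegrableOn (fun x => Real.exp (u k i x)) (ball 0 1) ∧
      ∫ x in ball (0 : Plane) 1, Real.exp (u k i x) ≤ C

/-- `max_{i = 1,2,3} u_i(x)`. -/
def maxComp (u : Fin 3 → Plane → ℝ) (x : Plane) : ℝ :=
  max (u 0 x) (max (u 1 x) (u 2 x))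

/-- The bubbling scale `ε = exp(- max_i u_i(p) / 2)` at the point `p`. -/
def bubbleScale (u : Fin 3 → Plane → ℝ) (p : Plane) : ℝ :=
  Real.exp (-(maxComp u p) / 2)

/-- The rescaled functions `v_i(y) = u_i(p + ε y) + 2 log ε`, with `ε = bubbleScale u p`. -/
def rescaled (u : Fin 3 → Plane → ℝ) (p : Plane) (i : Fin 3) (y : Plane) : ℝ :=
  u i (p + bubbleScale u p • y) + 2 * Real.log (bubbleScale u p)

/-- Convergence in `C²_loc(ℝ²)`: derivatives of order at most `2` converge uniformly on every
disc. -/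
def TendstoC2Loc (v : ℕ → Plane → ℝ) (V : Plane → ℝ) : Prop :=
  ∀ n : ℕ, n ≤ 2 → ∀ R : ℝ,
    TendstoUniformlyOn (fun k => iteratedFDeriv ℝ n (v k)) (iteratedFDeriv ℝ n V) atTop
      (closedBall 0 R)

/-- Convergence to `-∞` in `L^∞_loc(ℝ²)`. -/
def TendstoNegInftyLoc (v : ℕ → Plane → ℝ) : Prop :=
  ∀ R M : ℝ, ∀ᶠ k in atTop, ∀ y ∈ closedBall (0 : Plane) R, v k y ≤ M

/-- `V` is an entire solution of the Liouville equation `Δ V + e^V = 0`. -/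
def IsLiouville (V : Plane → ℝ) : Prop :=
  ContDiff ℝ 2 V ∧ ∀ y, -Laplacian.laplacian V y = Real.exp (V y)

/-- `(V, W)` is an entire solution of the rank two Toda system
`-Δ V = e^V - e^W`, `-Δ W = - e^V / 2 + e^W`. -/
def IsToda (V W : Plane → ℝ) : Prop :=
  ContDiff ℝ 2 V ∧ ContDiff ℝ 2 W ∧
    (∀ y, -Laplacian.laplacian V y = Real.exp (V y) - Real.exp (W y)) ∧
    (∀ y, -Laplacian.laplacian W y = -(1 / 2) * Real.exp (V y) + Real.exp (W y))

/-- The three possible limiting profiles of a sequence `v^k = (v_1^k, v_2^k, v_3^k)` of rescaled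
functions. -/
def HasBubbleProfile (v : ℕ → Fin 3 → Plane → ℝ) : Prop :=
  -- `v_1, v_3` (or `v_2, v_3`) converge to a Toda system, the other component to `-∞`
  (∃ a b : Fin 3, ((a = 0 ∧ b = 1) ∨ (a = 1 ∧ b = 0)) ∧
    ∃ V W, IsToda V W ∧ TendstoC2Loc (fun k => v k a) V ∧ TendstoC2Loc (fun k => v k 2) W ∧
      TendstoNegInftyLoc (fun k => v k b)) ∨
  -- `v_1` and `v_2` converge to Liouville equations, `v_3` to `-∞`
  (∃ V W, IsLiouville V ∧ IsLiouville W ∧ TendstoC2Loc (fun k => v k 0) V ∧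
    TendstoC2Loc (fun k => v k 1) W ∧ TendstoNegInftyLoc (fun k => v k 2)) ∨
  -- one component converges to a Liouville equation, the two others to `-∞`
  (∃ a : Fin 3, ∃ V, IsLiouville V ∧ TendstoC2Loc (fun k => v k a) V ∧
    ∀ b, b ≠ a → TendstoNegInftyLoc (fun k => v k b))

/-- `S k = Σ_k = {0, x_1^k, …, x_m^k}` (where `0` may be deleted if it is not a singular point) is
a blow-up set of the sequence `u`, with radii `l_1^k, …, l_m^k`, as produced by the selection
process for bubbling discs. -/
structure IsBlowupSet (γ : Fin 3 → ℝ) (u : ℕ → Fin 3 → Plane → ℝ) {m : ℕ}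
    (p : ℕ → Fin m → Plane) (l : ℕ → Fin m → ℝ) (S : ℕ → Set Plane) : Prop where
  injective : ∀ k, Function.Injective (p k)
  set_eq : (∀ k, S k = insert 0 (Set.range (p k)) ∧ ∀ j, p k j ≠ 0) ∨
    (γ = 0 ∧ ∀ k, S k = Set.range (p k))
  mem_ball : ∀ k j, p k j ∈ ball (0 : Plane) 1
  tendsto_point : ∀ j, Tendsto (fun k => p k j) atTop (𝓝 0)
  radius_pos : ∀ k j, 0 < l k j
  tendsto_radius : ∀ j, Tendsto (fun k => l k j) atTop (𝓝 0)
  /-- `l_j^k ≤ dist(x_j^k, Σ_k \ {x_j^k}) / 2`. -/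
  radius_le : ∀ k j, ∀ q ∈ S k, q ≠ p k j → l k j ≤ dist (p k j) q / 2
  disjoint : ∀ k i j, i ≠ j → Disjoint (ball (p k i) (l k i)) (ball (p k j) (l k j))
  is_max : ∀ k j, ∀ y ∈ ball (p k j) (l k j), maxComp (u k) y ≤ maxComp (u k) (p k j)
  tendsto_max : ∀ j, Tendsto (fun k => maxComp (u k) (p k j)) atTop atTop
  tendsto_ratio : ∀ j, Tendsto (fun k => l k j / bubbleScale (u k) (p k j)) atTop atTop
  profile : ∀ j, HasBubbleProfile (fun k => rescaled (u k) (p k j))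
  /-- The Harnack-type inequality `u_i^k(x) + 2 log dist(x, Σ_k) ≤ C` in `B_1(0)`. -/
  harnack : ∃ C : ℝ, ∀ k i, ∀ x ∈ ball (0 : Plane) 1, x ∉ S k →
    u k i x + 2 * Real.log (infDist x (S k)) ≤ C

/-- The sequence `v k` has fast decay on the circles `∂B(x_k, r_k)`. -/
def FastDecay (v : ℕ → Plane → ℝ) (x : ℕ → Plane) (r : ℕ → ℝ) : Prop :=
  ∃ N : ℕ → ℝ, Tendsto N atTop atTop ∧
    ∀ k, ∀ y ∈ sphere (x k) (r k), v k y + 2 * Real.log ‖y - x k‖ ≤ -N k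

/-- The mass `(1 / 2π) ∫_{B(x, r)} e^v`. -/
def mass (v : Plane → ℝ) (x : Plane) (r : ℝ) : ℝ :=
  1 / (2 * Real.pi) * ∫ y in ball x r, Real.exp (v y)

/-- The distance between two sets, equal to `∞` if one of them is empty. -/
def setDist (s t : Set Plane) : ℝ≥0∞ :=
  ⨅ x ∈ s, ⨅ y ∈ t, edist x y

/-- `a_k = o(1) b_k` for extended non-negative sequences. -/
def LittleO (a b : ℕ → ℝ≥0∞) : Prop :=
  ∀ ε : ℝ, 0 < ε → ∀ᶠ k in atTop, a k ≤ ENNReal.ofReal ε * b k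

end AffineToda

end

noncomputable section

namespace AffineToda

/-! The claim is a Pohozaev identity for local masses. It is obtained here without boundary
integrals, by a virial argument on a potential representation.

Let m_i be the measure e^{u_i} dx on the unit disc. Then u_i = h_i + 2γ_i log|x| - (1/2π) ∑_j a_ij
(log|·| * m_j), where h_i is weakly harmonic and continuous up to the boundary. On the unit circle
the oscillation of h_i is bounded uniformly in k, so by the maximum principle it is bounded on the
disc, and an interior estimate bounds ∇h_i near 0.

Testing e^{u_i} with the vector field η(x)x, where η is a cutoff at scale ρ, produces the terms (2 +
2γ_i)m_i, an error O(ρ) from ∇h_i, and double integrals of η(x)⟨x - z, x⟩/|x - z|² against m_i ⊗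
m_j. With the weights w = (1, 1, 2) the matrix w_i a_ij is symmetric, so in the weighted sum over i
the kernel can be replaced by half of ⟨η(x)x - η(z)z, x - z⟩/|x - z|². This symmetrised kernel is
bounded independently of ρ, equals 1 off the diagonal where η = 1 at both points, and is O(t/ρ)
between points with |x| ≤ t and |z| ≥ 4ρ. Hence, for M inside the disc |x| ≤ t, ∑ w_i (2 + 2γ_i)
m_i(M) - ½ ∑ w_i a_ij m_i(M) m_j(M) / 2π = O(τ + ρ + t/ρ), where τ bounds the masses of B(0, 4ρ) \ M
(`exists_virial_bound`). Continuity of the regular parts at 0 and the constraint force γ_1 + γ_2 +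
2γ_3 = 0, and then the left side is -π times the difference of the two sides of the claim
(`pohozaev_eq_virialForm`).

It remains to make the error small for M = B(x_k, r_k). If the rest of Σ_k is at distance much
larger than r_k from the circle, each component oscillates by O(1) between points of the neck B(0, R
r_k) \ B(x_k, r_k) and suitable points of the circle, so fast decay leaves no mass in the neck. When
r_k is small, take ρ = R r_k / 4 with R large. When r_k stays away from 0, fast decay removes all
mass away from the origin, and a fixed small ρ works (`tendsto_virialForm_of_separated`).

If all c_k vanish, the local masses themselves tend to 0 (`tendsto_massVector_zero`). On |x| = 1/2
the upper bounds and u_1 + u_2 + 2u_3 = 0 give lower bounds, so h_i is bounded below. Finite energy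
on small annuli then makes the limiting concentrated masses subcritical, and together with the
virial identity this forces them to be zero. Fast decay makes r_k tend to 0, and the form vanishes
at zero mass. -/

/-! ### Radial integrals in the plane and the regularised logarithm. -/

theorem finrank_plane : Module.finrank ℝ Plane = 2 := by simp

theorem volume_real_ball (x : Plane) {r : ℝ} (hr : 0 ≤ r) :
    volume.real (ball x r) = Real.pi * r ^ 2 := by
  have := EuclideanSpace.volume_ball (Fin 2) x r
  rw [Measure.real, this]
  simp [Real.sq_sqrt Real.pi_pos.le, ENNReal.toReal_ofReal hr]
  rw [show (1 : ℝ) + 1 = 2 by norm_num, Real.Gamma_two, ENNReal.toReal_ofReal (by positivity)]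
  ring

theorem integrableOn_norm_rpow_ball {s : ℝ} (hs : s < 2) (R : ℝ) :
    IntegrableOn (fun z : Plane => ‖z‖ ^ (-s)) (ball 0 R) := by
  rw [integrableOn_fun_norm_addHaar (μ := (volume : Measure Plane)) (f := fun y : ℝ => y ^ (-s))]
  have h : IntegrableOn (fun y : ℝ => y ^ (1 - s)) (Set.Ioo 0 R) := by
    rcases le_or_gt R 0 with h | h
    · simp [Set.Ioo_eq_empty_of_le h]
    · exact (intervalIntegral.integrableOn_Ioo_rpow_iff h).2 (by linarith)
  refine h.congr_fun ?_ measurableSet_Ioo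
  intro y hy
  have hy0 : 0 < y := hy.1
  simp only [finrank_plane, smul_eq_mul]
  rw [show (2 - 1 : ℕ) = 1 from rfl, pow_one, Real.rpow_sub hy0, Real.rpow_one, Real.rpow_neg hy0.le]
  rfl

theorem integrableOn_norm_sub_rpow_ball {s : ℝ} (hs : s < 2) (x : Plane) (R : ℝ) :
    IntegrableOn (fun z : Plane => ‖x - z‖ ^ (-s)) (ball x R) := by
  have h := (measurePreserving_sub_right (volume : Measure Plane) x).integrableOn_comp_preimage
    (Homeomorph.subRight x).measurableEmbedding (f := fun z : Plane => ‖z‖ ^ (-s)) (s := ball 0 R)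
  have h1 : (fun z => z - x) ⁻¹' (ball (0 : Plane) R) = ball x R := by
    ext z; simp [dist_eq_norm]
  rw [h1] at h
  refine (h.2 (integrableOn_norm_rpow_ball hs R)).congr_fun ?_ measurableSet_ball
  intro z _
  simp [norm_sub_rev]

theorem setIntegral_norm_sub_ball (f : ℝ → ℝ) (x : Plane) (R : ℝ) :
    ∫ z in ball x R, f ‖x - z‖ = ∫ z in ball (0 : Plane) R, f ‖z‖ := by
  have h := (measurePreserving_sub_right (volume : Measure Plane) x).setIntegral_preimage_emb
    (Homeomorph.subRight x).measurableEmbedding (fun z : Plane => f ‖z‖) (ball 0 R)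
  have h1 : (fun z => z - x) ⁻¹' (ball (0 : Plane) R) = ball x R := by
    ext z; simp [dist_eq_norm]
  rw [h1] at h
  rw [← h]
  simp [norm_sub_rev]

theorem setIntegral_norm_inv_ball {R : ℝ} (hR : 0 ≤ R) :
    ∫ z in ball (0 : Plane) R, ‖z‖⁻¹ = 2 * Real.pi * R := by
  have h1 : ∫ z in ball (0 : Plane) R, ‖z‖⁻¹
      = ∫ z : Plane, (Set.Iio R).indicator (fun y : ℝ => y⁻¹) ‖z‖ := by
    rw [← integral_indicator measurableSet_ball]
    congr 1
    ext z
    simp [Set.indicator]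
  rw [h1, integral_fun_norm_addHaar, finrank_plane, volume_real_ball _ zero_le_one]
  have h2 : ∫ y in Set.Ioi (0 : ℝ), y ^ (2 - 1) • (Set.Iio R).indicator (fun y : ℝ => y⁻¹) y
      = ∫ y in Set.Ioi (0 : ℝ), (Set.Iio R).indicator (fun _ : ℝ => (1 : ℝ)) y := by
    refine setIntegral_congr_fun measurableSet_Ioi ?_
    intro y (hy : 0 < y)
    by_cases h : y < R <;> simp [h, hy.ne']
  rw [h2, setIntegral_indicator measurableSet_Iio]
  simp [Set.Ioi_inter_Iio, Measure.real, ENNReal.toReal_ofReal hR]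
  ring

theorem abs_log_le_rpow {q t : ℝ} (hq : 0 < q) (ht : 0 ≤ t) : |Real.log t| ≤ t + t ^ (-q) / q := by
  rcases ht.eq_or_lt with rfl | ht
  · rw [Real.log_zero, abs_zero, Real.zero_rpow (by linarith)]; simp
  have h1 : Real.log t ≤ t := (Real.log_le_sub_one_of_pos ht).trans (by linarith)
  have h2 : -Real.log t ≤ t ^ (-q) / q := by
    have := Real.log_le_rpow_div (x := t⁻¹) (by positivity) hq
    rwa [Real.log_inv, Real.inv_rpow ht.le, ← Real.rpow_neg ht.le] at this
  have : 0 ≤ t ^ (-q) / q := by positivity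
  rw [abs_le]; constructor <;> linarith

/-- The smooth regularisation `½ log (|y|² + ε²)` of `log |y|`. -/
def logReg (ε : ℝ) (y : Plane) : ℝ := Real.log (‖y‖ ^ 2 + ε ^ 2) / 2

/-- The difference is ½ log(1 + s²) with s = ε/|y|, at most log(1 + s), which is at most s^q/q
because (1 + s)^q ≤ 1 + s^q for q ≤ 1. The free exponent q matters: integrating the bound against a
measure gives ε^q times a Riesz potential of order q, which stays bounded for singular densities if
q is small. -/
theorem abs_logReg_sub_log_le {q ε : ℝ} (hq : 0 < q) (hq1 : q ≤ 1) (hε : 0 < ε) {y : Plane}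
    (hy : y ≠ 0) : |logReg ε y - Real.log ‖y‖| ≤ ε ^ q / q * ‖y‖ ^ (-q) := by
  have hy0 : 0 < ‖y‖ := norm_pos_iff.2 hy
  have h1 : logReg ε y - Real.log ‖y‖ = Real.log (1 + (ε / ‖y‖) ^ 2) / 2 := by
    have : ‖y‖ ^ 2 + ε ^ 2 = ‖y‖ ^ 2 * (1 + (ε / ‖y‖) ^ 2) := by field_simp
    rw [logReg, this, Real.log_mul (by positivity) (by positivity), Real.log_pow]
    push_cast; ring
  set s := ε / ‖y‖ with hs
  have hs0 : 0 < s := by positivity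
  have h2 : 0 ≤ Real.log (1 + s ^ 2) := Real.log_nonneg (by nlinarith)
  rw [h1, abs_of_nonneg (by linarith)]
  have h3 : Real.log (1 + s ^ 2) ≤ 2 * Real.log (1 + s) := by
    rw [← Real.log_rpow (by positivity)]
    apply Real.log_le_log (by positivity)
    norm_num; nlinarith
  have h4 : Real.log (1 + s) ≤ s ^ q / q := by
    have h5 : (1 + s) ^ q ≤ 1 + s ^ q := by
      simpa using Real.rpow_add_le_add_rpow (p := q) zero_le_one hs0.le hq.le hq1
    have h6 : q * Real.log (1 + s) ≤ s ^ q := by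
      rw [← Real.log_rpow (by positivity)]
      refine (Real.log_le_log (by positivity) h5).trans ?_
      have := Real.log_le_sub_one_of_pos (x := 1 + s ^ q) (by positivity)
      linarith
    rw [le_div_iff₀ hq]; linarith
  have h5 : s ^ q / q = ε ^ q / q * ‖y‖ ^ (-q) := by
    rw [hs, Real.div_rpow hε.le hy0.le, Real.rpow_neg hy0.le]; ring
  linarith

theorem abs_logReg_le {q ε : ℝ} (hq : 0 < q) (hq1 : q ≤ 1) (hε : 0 < ε) (hε1 : ε ≤ 1) {y : Plane}
    (hy : y ≠ 0) : |logReg ε y| ≤ ‖y‖ + 2 / q * ‖y‖ ^ (-q) := by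
  have h1 := abs_logReg_sub_log_le hq hq1 hε hy
  have h2 := abs_log_le_rpow hq (norm_nonneg y)
  have h3 : ε ^ q / q * ‖y‖ ^ (-q) ≤ 1 / q * ‖y‖ ^ (-q) := by
    gcongr
    exact Real.rpow_le_one hε.le hε1 hq.le
  have h4 : logReg ε y = (logReg ε y - Real.log ‖y‖) + Real.log ‖y‖ := by ring
  have h6 : 2 / q * ‖y‖ ^ (-q) = 1 / q * ‖y‖ ^ (-q) + ‖y‖ ^ (-q) / q := by ring
  rw [h4]
  refine (abs_add_le _ _).trans ?_
  linarith

theorem logReg_contDiff {ε : ℝ} (hε : 0 < ε) : ContDiff ℝ ∞ (logReg ε) := by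
  unfold logReg
  refine (ContDiff.log ((contDiff_norm_sq ℝ).add contDiff_const) ?_).div_const 2
  intro x; positivity

theorem hasFDerivAt_logReg {ε : ℝ} (hε : 0 < ε) (y : Plane) :
    HasFDerivAt (logReg ε) ((‖y‖ ^ 2 + ε ^ 2)⁻¹ • innerSL ℝ y) y := by
  have h := (((hasStrictFDerivAt_norm_sq y).hasFDerivAt.add_const (ε ^ 2)).log
    (by positivity)).const_mul (1 / 2)
  have h1 : logReg ε = fun y => 1 / 2 * Real.log (‖y‖ ^ 2 + ε ^ 2) := by
    ext y; unfold logReg; ring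
  rw [h1]
  refine h.congr_fderiv ?_
  ext v
  rw [two_smul]
  simp only [_root_.smul_apply, _root_.add_apply, smul_eq_mul]
  ring

theorem norm_fderiv_logReg_le {ε : ℝ} (hε : 0 < ε) (y : Plane) :
    ‖(‖y‖ ^ 2 + ε ^ 2)⁻¹ • innerSL ℝ y‖ ≤ ε⁻¹ := by
  rw [norm_smul, innerSL_apply_norm, Real.norm_of_nonneg (by positivity),
    inv_mul_le_iff₀ (by positivity), le_mul_inv_iff₀ hε]
  nlinarith [sq_nonneg (‖y‖ - ε), norm_nonneg y]

/-! ### Logarithmic potentials of tame measures. -/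

section

/-- An absolutely continuous measure on the unit disc with a bounded Riesz potential of some
positive order, and with a Newtonian field of size `O(1 / |x|)`. -/
structure Tame (ν : Measure Plane) (q C : ℝ) : Prop where
  q_pos : 0 < q
  q_le : q ≤ 1
  ac : ν ≪ volume
  supp : ∀ᵐ z ∂ν, z ∈ ball (0 : Plane) 1
  riesz_int : ∀ x ∈ closedBall (0 : Plane) 1, Integrable (fun z => ‖x - z‖ ^ (-q)) ν
  riesz_le : ∀ x ∈ closedBall (0 : Plane) 1, ∫ z, ‖x - z‖ ^ (-q) ∂ν ≤ C
  newton_int : ∀ x ∈ ball (0 : Plane) 1, x ≠ 0 → Integrable (fun z => ‖x - z‖⁻¹) ν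
  newton_le : ∀ x ∈ ball (0 : Plane) 1, x ≠ 0 → ‖x‖ * ∫ z, ‖x - z‖⁻¹ ∂ν ≤ C

/-- The logarithmic potential of a measure. -/
def pot (ν : Measure Plane) (x : Plane) : ℝ := ∫ z, Real.log ‖x - z‖ ∂ν

/-- The regularised logarithmic potential of a measure. -/
def potReg (ν : Measure Plane) (ε : ℝ) (x : Plane) : ℝ := ∫ z, logReg ε (x - z) ∂ν

/-- The radial derivative of the regularised logarithmic potential. -/
def radialPot (ν : Measure Plane) (ε : ℝ) (x : Plane) : ℝ :=
  ∫ z, inner ℝ (x - z) x / (‖x - z‖ ^ 2 + ε ^ 2) ∂ν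

variable {ν : Measure Plane} {q C : ℝ}

theorem Tame.sub_ne_zero (h : Tame ν q C) (x : Plane) : ∀ᵐ z ∂ν, x - z ≠ 0 := by
  have : ∀ᵐ z ∂(volume : Measure Plane), x - z ≠ 0 := by
    have h1 : ∀ᵐ z ∂(volume : Measure Plane), z ≠ x := by
      rw [ae_iff]; simp
    filter_upwards [h1] with z hz h2
    exact hz (sub_eq_zero.1 h2).symm
  exact h.ac.ae_le this

theorem Tame.norm_sub_le (h : Tame ν q C) {x : Plane} (hx : x ∈ closedBall (0 : Plane) 1) :
    ∀ᵐ z ∂ν, ‖x - z‖ ≤ 2 := by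
  filter_upwards [h.supp] with z hz
  rw [mem_closedBall_zero_iff] at hx
  rw [mem_ball_zero_iff] at hz
  linarith [_root_.norm_sub_le x z]

theorem continuous_fderiv_logReg {ε : ℝ} (hε : 0 < ε) :
    Continuous (fun y : Plane => (‖y‖ ^ 2 + ε ^ 2)⁻¹ • innerSL ℝ y) := by
  have h : Continuous fun y : Plane => (‖y‖ ^ 2 + ε ^ 2)⁻¹ :=
    Continuous.inv₀ (by fun_prop) fun y => by positivity
  exact h.smul (innerSL ℝ).continuous

/-- The majorant does not depend on ε and the case ε = 0 is included, so it serves both as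
domination for ε → 0 and as a bound for the limit. At x = z both sides are 0. -/
theorem abs_radial_kernel_le (ε : ℝ) (x z : Plane) :
    |inner ℝ (x - z) x / (‖x - z‖ ^ 2 + ε ^ 2)| ≤ ‖x‖ * ‖x - z‖⁻¹ := by
  rcases eq_or_ne (x - z) 0 with h | h
  · simp [h]
  have h0 : 0 < ‖x - z‖ := norm_pos_iff.2 h
  rw [abs_div, abs_of_nonneg (by positivity : 0 ≤ ‖x - z‖ ^ 2 + ε ^ 2), div_le_iff₀ (by positivity)]
  refine (abs_real_inner_le_norm _ _).trans ?_
  have : ‖x‖ * ‖x - z‖⁻¹ * (‖x - z‖ ^ 2 + ε ^ 2)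
      = ‖x - z‖ * ‖x‖ + ‖x‖ * ‖x - z‖⁻¹ * ε ^ 2 := by field_simp
  rw [this]
  have : 0 ≤ ‖x‖ * ‖x - z‖⁻¹ * ε ^ 2 := by positivity
  linarith

theorem Tame.abs_radialPot_le (h : Tame ν q C) (ε : ℝ) {x : Plane}
    (hx : x ∈ ball (0 : Plane) 1) (hx0 : x ≠ 0) : |radialPot ν ε x| ≤ C := by
  refine (abs_integral_le_integral_abs).trans ?_
  refine le_trans ?_ (h.newton_le x hx hx0)
  rw [← integral_const_mul]
  refine integral_mono_of_nonneg (Eventually.of_forall fun _ => abs_nonneg _)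
    ((h.newton_int x hx hx0).const_mul _) (Eventually.of_forall fun z => ?_)
  exact abs_radial_kernel_le ε x z

theorem Tame.tendsto_radialPot (h : Tame ν q C) {ε : ℕ → ℝ}
    (hε0 : Tendsto ε atTop (𝓝 0)) {x : Plane}
    (hx : x ∈ ball (0 : Plane) 1) (hx0 : x ≠ 0) :
    Tendsto (fun n => radialPot ν (ε n) x) atTop (𝓝 (radialPot ν 0 x)) := by
  refine tendsto_integral_of_dominated_convergence (fun z => ‖x‖ * ‖x - z‖⁻¹) ?_
    ((h.newton_int x hx hx0).const_mul _) ?_ ?_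
  · intro n
    have h1 : Measurable fun z : Plane => inner ℝ (x - z) x := by fun_prop
    have h2 : Measurable fun z : Plane => ‖x - z‖ ^ 2 + ε n ^ 2 := by fun_prop
    exact (h1.div h2).aestronglyMeasurable
  · exact fun n => Eventually.of_forall fun z => abs_radial_kernel_le _ x z
  · filter_upwards [h.sub_ne_zero x] with z hz
    have h0 : 0 < ‖x - z‖ := norm_pos_iff.2 hz
    refine Tendsto.div tendsto_const_nhds (tendsto_const_nhds.add (hε0.pow 2)) ?_
    positivity

variable [IsFiniteMeasure ν]

theorem Tame.integrable_log (h : Tame ν q C) {x : Plane} (hx : x ∈ closedBall (0 : Plane) 1) :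
    Integrable (fun z => Real.log ‖x - z‖) ν := by
  refine Integrable.mono' ((integrable_const (2 : ℝ)).add ((h.riesz_int x hx).div_const q))
    (Real.measurable_log.comp (by fun_prop)).aestronglyMeasurable ?_
  filter_upwards [h.norm_sub_le hx] with z hz
  have := abs_log_le_rpow h.q_pos (norm_nonneg (x - z))
  simp only [Real.norm_eq_abs, Pi.add_apply]
  linarith

theorem integrable_logReg (hs : ∀ᵐ z ∂ν, z ∈ ball (0 : Plane) 1) {ε : ℝ} (hε : 0 < ε)
    (x : Plane) : Integrable (fun z => logReg ε (x - z)) ν := by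
  refine Integrable.mono' (integrable_const ((‖x‖ + 1) ^ 2 + ε ^ 2 + (ε ^ 2)⁻¹))
    ((logReg_contDiff hε).continuous.comp (continuous_const.sub continuous_id)
      |>.aestronglyMeasurable) ?_
  filter_upwards [hs] with z hz
  rw [mem_ball_zero_iff] at hz
  have h1 := abs_log_le_rpow one_pos (t := ‖x - z‖ ^ 2 + ε ^ 2) (by positivity)
  rw [Real.rpow_neg_one, div_one] at h1
  have h2 : (‖x - z‖ ^ 2 + ε ^ 2)⁻¹ ≤ (ε ^ 2)⁻¹ := by
    gcongr
    nlinarith [sq_nonneg ‖x - z‖]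
  have h3 : ‖x - z‖ ^ 2 ≤ (‖x‖ + 1) ^ 2 := by
    gcongr
    linarith [norm_sub_le x z]
  rw [logReg, Real.norm_eq_abs, abs_div, abs_two]
  have := abs_nonneg (Real.log (‖x - z‖ ^ 2 + ε ^ 2))
  linarith

theorem Tame.abs_potReg_sub_pot_le (h : Tame ν q C) {ε : ℝ} (hε : 0 < ε) {x : Plane}
    (hx : x ∈ closedBall (0 : Plane) 1) : |potReg ν ε x - pot ν x| ≤ ε ^ q / q * C := by
  have h0 : 0 ≤ ε ^ q / q := div_nonneg (Real.rpow_nonneg hε.le _) h.q_pos.le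
  rw [potReg, pot, ← integral_sub (integrable_logReg h.supp hε x) (h.integrable_log hx)]
  refine (abs_integral_le_integral_abs).trans ?_
  refine (integral_mono_ae ?_ ((h.riesz_int x hx).const_mul (ε ^ q / q)) ?_).trans ?_
  · exact ((integrable_logReg h.supp hε x).sub (h.integrable_log hx)).abs
  · filter_upwards [h.sub_ne_zero x] with z hz
    exact abs_logReg_sub_log_le h.q_pos h.q_le hε hz
  · rw [integral_const_mul]
    exact mul_le_mul_of_nonneg_left (h.riesz_le x hx) h0

theorem Tame.integral_abs_log_le (h : Tame ν q C) {x : Plane}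
    (hx : x ∈ closedBall (0 : Plane) 1) :
    ∫ z, |Real.log ‖x - z‖| ∂ν ≤ 2 * ν.real Set.univ + C / q := by
  refine (integral_mono_ae (h.integrable_log hx).abs
    ((integrable_const (2 : ℝ)).add ((h.riesz_int x hx).div_const q)) ?_).trans ?_
  · filter_upwards [h.norm_sub_le hx] with z hz
    have := abs_log_le_rpow h.q_pos (norm_nonneg (x - z))
    simp only [Pi.add_apply]
    linarith
  · simp only [Pi.add_apply]
    rw [integral_add (integrable_const _) ((h.riesz_int x hx).div_const q), integral_div,
      integral_const, smul_eq_mul, mul_comm]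
    have := h.q_pos
    gcongr
    exact h.riesz_le x hx

theorem Tame.abs_pot_le (h : Tame ν q C) {x : Plane} (hx : x ∈ closedBall (0 : Plane) 1) :
    |pot ν x| ≤ 2 * ν.real Set.univ + C / q :=
  abs_integral_le_integral_abs.trans (h.integral_abs_log_le hx)

theorem Tame.abs_potReg_le (h : Tame ν q C) {ε : ℝ} (hε : 0 < ε) (hε1 : ε ≤ 1) {x : Plane}
    (hx : x ∈ closedBall (0 : Plane) 1) :
    |potReg ν ε x| ≤ 2 * ν.real Set.univ + 2 * C / q := by
  have h1 := h.abs_potReg_sub_pot_le hε hx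
  have h2 := h.abs_pot_le hx
  have hC : 0 ≤ C := le_trans (integral_nonneg fun z => by positivity) (h.riesz_le x hx)
  have h3 : ε ^ q / q * C ≤ C / q := by
    rw [div_mul_eq_mul_div]
    have := h.q_pos
    gcongr
    exact mul_le_of_le_one_left hC (Real.rpow_le_one hε.le hε1 h.q_pos.le)
  rw [abs_le] at *
  have : 2 * C / q = C / q + C / q := by ring
  constructor <;> linarith

theorem hasFDerivAt_potReg (hs : ∀ᵐ z ∂ν, z ∈ ball (0 : Plane) 1) {ε : ℝ} (hε : 0 < ε)
    (x : Plane) : HasFDerivAt (potReg ν ε)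
      (∫ z, (‖x - z‖ ^ 2 + ε ^ 2)⁻¹ • innerSL ℝ (x - z) ∂ν) x := by
  refine hasFDerivAt_integral_of_dominated_of_fderiv_le (s := Set.univ)
    (F := fun x z => logReg ε (x - z))
    (F' := fun x z => (‖x - z‖ ^ 2 + ε ^ 2)⁻¹ • innerSL ℝ (x - z))
    (bound := fun _ => ε⁻¹) univ_mem ?_ (integrable_logReg hs hε x) ?_ ?_ (integrable_const _) ?_
  · exact Eventually.of_forall fun x => (integrable_logReg hs hε x).aestronglyMeasurable
  · exact ((continuous_fderiv_logReg hε).comp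
      (continuous_const.sub continuous_id)).aestronglyMeasurable
  · exact Eventually.of_forall fun z x _ => norm_fderiv_logReg_le hε (x - z)
  · refine Eventually.of_forall fun z x _ => ?_
    exact (hasFDerivAt_comp_sub z).2 (hasFDerivAt_logReg hε (x - z))

theorem contDiff_potReg (hs : ∀ᵐ z ∂ν, z ∈ ball (0 : Plane) 1) {ε : ℝ} (hε : 0 < ε) :
    ContDiff ℝ 1 (potReg ν ε) := by
  rw [contDiff_one_iff_fderiv]
  refine ⟨fun x => (hasFDerivAt_potReg hs hε x).differentiableAt, ?_⟩
  have : fderiv ℝ (potReg ν ε) =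
      fun x => ∫ z, (‖x - z‖ ^ 2 + ε ^ 2)⁻¹ • innerSL ℝ (x - z) ∂ν := by
    ext1 x
    exact (hasFDerivAt_potReg hs hε x).fderiv
  rw [this]
  refine continuous_of_dominated (bound := fun _ => ε⁻¹) ?_ ?_ (integrable_const _) ?_
  · intro x
    exact ((continuous_fderiv_logReg hε).comp
      (continuous_const.sub continuous_id)).aestronglyMeasurable
  · exact fun x => Eventually.of_forall fun z => norm_fderiv_logReg_le hε (x - z)
  · refine Eventually.of_forall fun z => ?_
    exact (continuous_fderiv_logReg hε).comp (continuous_id.sub continuous_const)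

theorem fderiv_potReg_self (hs : ∀ᵐ z ∂ν, z ∈ ball (0 : Plane) 1) {ε : ℝ} (hε : 0 < ε)
    (x : Plane) : fderiv ℝ (potReg ν ε) x x = radialPot ν ε x := by
  rw [(hasFDerivAt_potReg hs hε x).fderiv, ContinuousLinearMap.integral_apply]
  · refine integral_congr_ae (Eventually.of_forall fun z => ?_)
    simp only [_root_.smul_apply, innerSL_apply_apply, smul_eq_mul, div_eq_inv_mul]
  · refine Integrable.mono' (integrable_const ε⁻¹) ?_
      (Eventually.of_forall fun z => norm_fderiv_logReg_le hε (x - z))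
    exact ((continuous_fderiv_logReg hε).comp
      (continuous_const.sub continuous_id)).aestronglyMeasurable

/-- The regularised potentials are C¹ and converge uniformly on the closed disc, at the rate ε^q
C/q. Continuity up to the boundary is needed for the maximum principle applied to the harmonic
parts. -/
theorem Tame.continuousOn_pot (h : Tame ν q C) :
    ContinuousOn (pot ν) (closedBall (0 : Plane) 1) := by
  have h1 : TendstoUniformlyOn (fun n : ℕ => potReg ν (1 / ((n : ℝ) + 1))) (pot ν) atTop
      (closedBall (0 : Plane) 1) := by
    rw [Metric.tendstoUniformlyOn_iff]
    intro e he
    have h2 : Tendsto (fun n : ℕ => (1 / ((n : ℝ) + 1)) ^ q / q * C) atTop (𝓝 0) := by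
      have := (tendsto_one_div_add_atTop_nhds_zero_nat (𝕜 := ℝ)).rpow_const
        (p := q) (Or.inr h.q_pos.le)
      rw [Real.zero_rpow h.q_pos.ne'] at this
      simpa using (this.div_const q).mul_const C
    filter_upwards [h2.eventually (gt_mem_nhds he)] with n hn x hx
    rw [dist_comm, Real.dist_eq]
    exact (h.abs_potReg_sub_pot_le (by positivity) hx).trans_lt hn
  refine h1.continuousOn (Frequently.of_forall fun n => ?_)
  exact (contDiff_potReg h.supp (by positivity)).continuous.continuousOn

end

/-! ### Green's identity and the fundamental solution of the Laplacian. -/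

theorem two_le_infty : (2 : WithTop ℕ∞) ≤ ((⊤ : ℕ∞) : WithTop ℕ∞) := by
  exact WithTop.coe_le_coe.2 (le_top : (2 : ℕ∞) ≤ ⊤)

/-- The standard basis vectors of the plane. -/
def basisVec (i : Fin 2) : Plane := EuclideanSpace.basisFun (Fin 2) ℝ i

theorem inner_basisVec (i : Fin 2) (y : Plane) : inner ℝ y (basisVec i) = y i := by
  simp [basisVec, EuclideanSpace.inner_single_right]

theorem sum_sq_coord (y : Plane) : ∑ i, (y i) ^ 2 = ‖y‖ ^ 2 := by
  rw [EuclideanSpace.real_norm_sq_eq]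

/-- The form as an iterated first derivative lets integration by parts and convolution act one
coordinate at a time. -/
theorem laplacian_eq_sum {f : Plane → ℝ} {x : Plane} (hf : ContDiffAt ℝ 2 f x) :
    Laplacian.laplacian f x
      = ∑ i, fderiv ℝ (fun y => fderiv ℝ f y (basisVec i)) x (basisVec i) := by
  rw [InnerProductSpace.laplacian_eq_iteratedFDeriv_orthonormalBasis f
    (EuclideanSpace.basisFun (Fin 2) ℝ)]
  refine Finset.sum_congr rfl fun i _ => ?_
  rw [iteratedFDeriv_two_apply]
  have h : DifferentiableAt ℝ (fderiv ℝ f) x :=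
    (hf.fderiv_right (m := 1) (by norm_num)).differentiableAt (by norm_num)
  have h2 := (h.hasFDerivAt.clm_apply (hasFDerivAt_const (basisVec i) x)).fderiv
  rw [h2]
  simp [basisVec]

theorem contDiff_fderiv_apply {f : Plane → ℝ} {n : ℕ∞} (hf : ContDiff ℝ (n + 1) f) (v : Plane) :
    ContDiff ℝ n (fun y => fderiv ℝ f y v) :=
  (hf.fderiv_right le_rfl).clm_apply contDiff_const

theorem continuous_laplacian {f : Plane → ℝ} (hf : ContDiff ℝ 2 f) :
    Continuous (Laplacian.laplacian f) := by
  have : Laplacian.laplacian f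
      = fun x => ∑ i, fderiv ℝ (fun y => fderiv ℝ f y (basisVec i)) x (basisVec i) := by
    ext1 x; exact laplacian_eq_sum hf.contDiffAt
  rw [this]
  refine continuous_finsetSum _ fun i _ => ?_
  exact (contDiff_fderiv_apply (n := 0) (contDiff_fderiv_apply (n := 1) (by exact_mod_cast hf) _)
    _).continuous

theorem tsupport_laplacian_subset {f : Plane → ℝ} : 
    tsupport (Laplacian.laplacian f) ⊆ tsupport f := by
  refine closure_minimal ?_ (isClosed_tsupport f)
  intro x hx
  by_contra h
  apply hx
  have h1 : f =ᶠ[𝓝 x] fun _ => 0 := notMem_tsupport_iff_eventuallyEq.1 h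
  rw [(InnerProductSpace.laplacian_congr_nhds h1).eq_of_nhds]
  simp

theorem integral_mul_fderiv_fderiv {f φ : Plane → ℝ} (hf : ContDiff ℝ 1 f) (hφ : ContDiff ℝ 1 φ)
    (hc : HasCompactSupport φ) (v : Plane) :
    ∫ x, f x * fderiv ℝ φ x v = - ∫ x, fderiv ℝ f x v * φ x := by
  have h1 : Continuous fun x => fderiv ℝ f x v := by
    exact ((hf.continuous_fderiv one_ne_zero).clm_apply continuous_const)
  have h2 : Continuous fun x => fderiv ℝ φ x v := by
    exact ((hφ.continuous_fderiv one_ne_zero).clm_apply continuous_const)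
  have hc' : HasCompactSupport fun x => fderiv ℝ φ x v := hc.fderiv_apply ℝ v
  refine integral_mul_fderiv_eq_neg_fderiv_mul_of_integrable ?_ ?_ ?_ ?_ ?_
  · exact (h1.mul hφ.continuous).integrable_of_hasCompactSupport hc.mul_left
  · exact (hf.continuous.mul h2).integrable_of_hasCompactSupport hc'.mul_left
  · exact (hf.continuous.mul hφ.continuous).integrable_of_hasCompactSupport hc.mul_left
  · exact fun x _ => (hf.differentiable one_ne_zero) x
  · exact fun x _ => (hφ.differentiable one_ne_zero) x

theorem integral_mul_laplacian {f φ : Plane → ℝ} (hf : ContDiff ℝ 2 f) (hφ : ContDiff ℝ 2 φ)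
    (hc : HasCompactSupport φ) :
    ∫ x, f x * Laplacian.laplacian φ x = ∫ x, Laplacian.laplacian f x * φ x := by
  have hf1 : ∀ i, ContDiff ℝ 1 fun y => fderiv ℝ f y (basisVec i) :=
    fun i => contDiff_fderiv_apply (n := 1) (by exact_mod_cast hf) _
  have hφ1 : ∀ i, ContDiff ℝ 1 fun y => fderiv ℝ φ y (basisVec i) :=
    fun i => contDiff_fderiv_apply (n := 1) (by exact_mod_cast hφ) _
  have hc1 : ∀ i, HasCompactSupport fun y => fderiv ℝ φ y (basisVec i) :=
    fun i => hc.fderiv_apply ℝ _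
  have hf2 : ∀ i, Continuous fun y => fderiv ℝ (fun y => fderiv ℝ f y (basisVec i)) y (basisVec i) :=
    fun i => ((hf1 i).continuous_fderiv one_ne_zero).clm_apply continuous_const
  have hφ2 : ∀ i, Continuous fun y => fderiv ℝ (fun y => fderiv ℝ φ y (basisVec i)) y (basisVec i) :=
    fun i => ((hφ1 i).continuous_fderiv one_ne_zero).clm_apply continuous_const
  simp_rw [fun x => laplacian_eq_sum (hφ.contDiffAt (x := x)),
    fun x => laplacian_eq_sum (hf.contDiffAt (x := x)), Finset.mul_sum, Finset.sum_mul]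
  rw [integral_finsetSum, integral_finsetSum]
  · refine Finset.sum_congr rfl fun i _ => ?_
    rw [integral_mul_fderiv_fderiv (hf.of_le (by norm_num)) (hφ1 i) (hc1 i),
      integral_mul_fderiv_fderiv (hf1 i) (hφ.of_le (by norm_num)) hc, neg_neg]
  · exact fun i _ => ((hf2 i).mul hφ.continuous).integrable_of_hasCompactSupport hc.mul_left
  · exact fun i _ => (hf.continuous.mul (hφ2 i)).integrable_of_hasCompactSupport
      ((hc1 i).fderiv_apply ℝ _).mul_left

theorem laplacian_comp_sub (f : Plane → ℝ) (a x : Plane) :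
    Laplacian.laplacian (fun y => f (y - a)) x = Laplacian.laplacian f (x - a) := by
  rw [InnerProductSpace.laplacian_eq_iteratedFDeriv_orthonormalBasis _
    (EuclideanSpace.basisFun (Fin 2) ℝ), InnerProductSpace.laplacian_eq_iteratedFDeriv_orthonormalBasis _
    (EuclideanSpace.basisFun (Fin 2) ℝ)]
  simp [iteratedFDeriv_comp_sub]

/-- This is the rescaling at size ε of the fixed profile 2/(|y|² + 1)², so it is an approximate
identity of total mass 2π. -/
theorem laplacian_logReg {ε : ℝ} (hε : 0 < ε) (x : Plane) :
    Laplacian.laplacian (logReg ε) x = 2 * ε ^ 2 / (‖x‖ ^ 2 + ε ^ 2) ^ 2 := by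
  rw [laplacian_eq_sum (((logReg_contDiff hε).of_le two_le_infty).contDiffAt)]
  have h1 : ∀ i, (fun y => fderiv ℝ (logReg ε) y (basisVec i))
      = fun y : Plane => (‖y‖ ^ 2 + ε ^ 2)⁻¹ * y i := by
    intro i
    ext y
    rw [(hasFDerivAt_logReg hε y).fderiv]
    simp [inner_basisVec]
  have h2 : ∀ i, fderiv ℝ (fun y : Plane => (‖y‖ ^ 2 + ε ^ 2)⁻¹ * y i) x (basisVec i)
      = (‖x‖ ^ 2 + ε ^ 2)⁻¹ - 2 * (x i) ^ 2 / (‖x‖ ^ 2 + ε ^ 2) ^ 2 := by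
    intro i
    have ha := ((hasStrictFDerivAt_norm_sq x).hasFDerivAt.add_const (ε ^ 2))
    have hb := (hasDerivAt_inv (x := ‖x‖ ^ 2 + ε ^ 2) (by positivity)).comp_hasFDerivAt x ha
    have hc : HasFDerivAt (fun y : Plane => y i) (EuclideanSpace.proj i : Plane →L[ℝ] ℝ) x :=
      (EuclideanSpace.proj i : Plane →L[ℝ] ℝ).hasFDerivAt
    have hd := hb.mul hc
    have he : fderiv ℝ (fun y : Plane => (‖y‖ ^ 2 + ε ^ 2)⁻¹ * y i) x = _ := hd.fderiv
    rw [he]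
    have hf : (EuclideanSpace.proj i : Plane →L[ℝ] ℝ) (basisVec i) = 1 := by simp [basisVec]
    simp only [_root_.add_apply, _root_.smul_apply, hf, innerSL_apply_apply, inner_basisVec,
      Function.comp_apply, smul_eq_mul, two_smul]
    field_simp
    ring
  simp_rw [h1, h2]
  rw [Finset.sum_sub_distrib, ← Finset.sum_div, ← Finset.mul_sum, sum_sq_coord]
  simp
  field_simp
  ring

theorem integral_bubble : ∫ y : Plane, 2 / (‖y‖ ^ 2 + 1) ^ 2 = 2 * Real.pi := by
  rw [integral_fun_norm_addHaar (volume : Measure Plane) (fun t => 2 / (t ^ 2 + 1) ^ 2),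
    finrank_plane, volume_real_ball _ zero_le_one]
  have h : ∫ y in Set.Ioi (0 : ℝ), y ^ (2 - 1) • (2 / (y ^ 2 + 1) ^ 2) = 0 - (-1) := by
    have hd : ∀ x ∈ Set.Ici (0 : ℝ), HasDerivAt (fun y : ℝ => -(y ^ 2 + 1)⁻¹)
        (x ^ (2 - 1) • (2 / (x ^ 2 + 1) ^ 2)) x := by
      intro x _
      have h1 := (((hasDerivAt_pow 2 x).add_const 1).inv (by positivity)).neg
      refine h1.congr_deriv ?_
      simp
      field_simp
    have ht : Tendsto (fun y : ℝ => -(y ^ 2 + 1)⁻¹) atTop (𝓝 0) := by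
      have : Tendsto (fun y : ℝ => y ^ 2 + 1) atTop atTop :=
        tendsto_atTop_add_const_right _ _ (tendsto_pow_atTop (by norm_num))
      simpa using this.inv_tendsto_atTop.neg
    have := integral_Ioi_of_hasDerivAt_of_nonneg' hd (fun x hx => ?_) ht
    · simpa using this
    · have : 0 < x := hx
      simp only [smul_eq_mul]; positivity
  rw [h]
  simp

/-- The integral of a non-integrable function is 0 by convention, so the value 2π already forces
integrability. -/
theorem integrable_bubble : Integrable fun y : Plane => 2 / (‖y‖ ^ 2 + 1) ^ 2 := by
  by_contra h
  have := integral_bubble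
  rw [integral_undef h] at this
  linarith [Real.pi_pos]

theorem integrable_norm_sub_rpow_mul {s : ℝ} (hs : s < 2) (z : Plane) {g : Plane → ℝ}
    (hg : Continuous g) (hc : HasCompactSupport g) :
    Integrable fun x => ‖x - z‖ ^ (-s) * g x := by
  obtain ⟨R, hR⟩ := hc.isCompact.isBounded.subset_ball z
  obtain ⟨B, hB⟩ := hg.bounded_above_of_compact_support hc
  have h1 := integrableOn_norm_sub_rpow_ball hs z R
  simp_rw [norm_sub_rev z] at h1
  have h2 : IntegrableOn (fun x => ‖x - z‖ ^ (-s) * g x) (ball z R) :=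
    Integrable.mul_bdd (c := B) h1 hg.aestronglyMeasurable (Eventually.of_forall hB)
  rw [← integrableOn_univ]
  refine h2.of_forall_sdiff_eq_zero MeasurableSet.univ fun x hx => ?_
  have : g x = 0 := by
    by_contra h
    exact hx.2 (hR (subset_tsupport _ h))
  simp [this]

theorem integrable_log_mul (z : Plane) {g : Plane → ℝ}
    (hg : Continuous g) (hc : HasCompactSupport g) :
    Integrable fun x => Real.log ‖x - z‖ * g x := by
  have h1 : Integrable fun x => ‖x - z‖ * g x :=
    ((continuous_id.sub continuous_const).norm.mul hg).integrable_of_hasCompactSupport hc.mul_left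
  have h2 := integrable_norm_sub_rpow_mul (s := 1) (by norm_num) z hg hc
  refine Integrable.mono' (h1.norm.add h2.norm) ?_ (Eventually.of_forall fun x => ?_)
  · exact ((Real.measurable_log.comp (by fun_prop)).mul hg.measurable).aestronglyMeasurable
  · have := abs_log_le_rpow one_pos (norm_nonneg (x - z))
    simp only [norm_mul, Pi.add_apply, Real.norm_eq_abs, abs_norm]
    rw [← add_mul]
    refine mul_le_mul_of_nonneg_right (this.trans ?_) (abs_nonneg _)
    rw [div_one, abs_of_nonneg (Real.rpow_nonneg (norm_nonneg _) _)]

theorem integral_scaled_bubble {ε : ℝ} (hε : 0 < ε) (φ : Plane → ℝ) (z : Plane) :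
    ∫ x, 2 * ε ^ 2 / (‖x - z‖ ^ 2 + ε ^ 2) ^ 2 * φ x
      = ∫ y : Plane, 2 / (‖y‖ ^ 2 + 1) ^ 2 * φ (ε • y + z) := by
  have h1 := integral_sub_right_eq_self (μ := (volume : Measure Plane))
    (fun w => 2 * ε ^ 2 / (‖w‖ ^ 2 + ε ^ 2) ^ 2 * φ (w + z)) z
  have h2 := Measure.integral_comp_smul (volume : Measure Plane)
    (fun w => 2 * ε ^ 2 / (‖w‖ ^ 2 + ε ^ 2) ^ 2 * φ (w + z)) ε
  simp only [sub_add_cancel] at h1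
  rw [h1]
  rw [finrank_plane, abs_of_nonneg (by positivity), smul_eq_mul] at h2
  rw [eq_comm, inv_mul_eq_iff_eq_mul₀ (by positivity)] at h2
  rw [h2, ← integral_const_mul]
  refine integral_congr_ae (Eventually.of_forall fun y => ?_)
  simp only [norm_smul, Real.norm_of_nonneg hε.le]
  field_simp

/-- Both sides are limits of the same integrals with `logReg` in place of the logarithm: dominated
convergence gives the left side. After Green's identity and the substitution x = z + εy, the same
integrals are averages of φ(z + εy) against the bubble profile, which converge to the right side. -/
theorem integral_log_mul_laplacian {φ : Plane → ℝ} (hφ : ContDiff ℝ 2 φ)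
    (hc : HasCompactSupport φ) (z : Plane) :
    ∫ x, Real.log ‖x - z‖ * Laplacian.laplacian φ x = 2 * Real.pi * φ z := by
  set e : ℕ → ℝ := fun n => 1 / ((n : ℝ) + 1) with he
  have he0 : ∀ n, 0 < e n := fun n => by positivity
  have he1 : ∀ n, e n ≤ 1 := fun n => by
    rw [he]; simp only; rw [div_le_one (by positivity)]; linarith [(Nat.cast_nonneg n : (0:ℝ) ≤ n)]
  have het : Tendsto e atTop (𝓝 0) := tendsto_one_div_add_atTop_nhds_zero_nat
  have hΔ : Continuous (Laplacian.laplacian φ) := continuous_laplacian hφ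
  have hΔc : HasCompactSupport (Laplacian.laplacian φ) :=
    hc.of_isClosed_subset (isClosed_tsupport _) tsupport_laplacian_subset
  have hL : Tendsto (fun n => ∫ x, logReg (e n) (x - z) * Laplacian.laplacian φ x) atTop
      (𝓝 (∫ x, Real.log ‖x - z‖ * Laplacian.laplacian φ x)) := by
    have h1 : Integrable fun x => ‖x - z‖ * Laplacian.laplacian φ x :=
      ((continuous_id.sub continuous_const).norm.mul hΔ).integrable_of_hasCompactSupport
        hΔc.mul_left
    have h2 := integrable_norm_sub_rpow_mul (s := 1) (by norm_num) z hΔ hΔc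
    have hne : ∀ᵐ x : Plane, x - z ≠ 0 := by
      have h1 : ∀ᵐ x ∂(volume : Measure Plane), x ≠ z := by
        rw [ae_iff]; simp
      filter_upwards [h1] with x hx using sub_ne_zero.2 hx
    refine tendsto_integral_of_dominated_convergence
      (fun x => ‖‖x - z‖ * Laplacian.laplacian φ x‖
        + 2 * ‖‖x - z‖ ^ (-1 : ℝ) * Laplacian.laplacian φ x‖) ?_
      (h1.norm.add (h2.norm.const_mul 2)) ?_ ?_
    · intro n
      exact ((((logReg_contDiff (he0 n)).continuous.comp
        (continuous_id.sub continuous_const)).mul hΔ).aestronglyMeasurable)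
    · intro n
      filter_upwards [hne] with x hx
      have := abs_logReg_le one_pos le_rfl (he0 n) (he1 n) hx
      simp only [norm_mul, Real.norm_eq_abs, abs_norm]
      rw [← mul_assoc, ← add_mul]
      refine mul_le_mul_of_nonneg_right (this.trans ?_) (abs_nonneg _)
      rw [div_one, abs_of_nonneg (Real.rpow_nonneg (norm_nonneg _) _)]
    · filter_upwards [hne] with x hx
      refine Tendsto.mul_const _ ?_
      rw [tendsto_iff_norm_sub_tendsto_zero]
      refine squeeze_zero (fun _ => norm_nonneg _)
        (fun n => abs_logReg_sub_log_le one_pos le_rfl (he0 n) hx) ?_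
      simp only [Real.rpow_one, div_one]
      simpa using het.mul_const (‖x - z‖ ^ (-1 : ℝ))
  have hR : Tendsto (fun n => ∫ x, logReg (e n) (x - z) * Laplacian.laplacian φ x) atTop
      (𝓝 (2 * Real.pi * φ z)) := by
    have h1 : ∀ n, ∫ x, logReg (e n) (x - z) * Laplacian.laplacian φ x
        = ∫ y : Plane, 2 / (‖y‖ ^ 2 + 1) ^ 2 * φ (e n • y + z) := by
      intro n
      rw [← integral_scaled_bubble (he0 n),
        integral_mul_laplacian (f := fun x => logReg (e n) (x - z)) ?_ hφ hc]
      · refine integral_congr_ae (Eventually.of_forall fun x => ?_)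
        simp only
        rw [laplacian_comp_sub, laplacian_logReg (he0 n)]
      · exact ((logReg_contDiff (he0 n)).of_le two_le_infty).comp (contDiff_id.sub contDiff_const)
    simp_rw [h1]
    rw [← integral_bubble, ← integral_mul_const]
    obtain ⟨B, hB⟩ := hφ.continuous.bounded_above_of_compact_support hc
    refine tendsto_integral_of_dominated_convergence
      (fun y : Plane => 2 / (‖y‖ ^ 2 + 1) ^ 2 * B) ?_ (integrable_bubble.mul_const B) ?_ ?_
    · intro n
      refine AEStronglyMeasurable.mul integrable_bubble.aestronglyMeasurable ?_
      exact (hφ.continuous.comp (by fun_prop)).aestronglyMeasurable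
    · refine fun n => Eventually.of_forall fun y => ?_
      rw [norm_mul, Real.norm_of_nonneg (by positivity)]
      exact mul_le_mul_of_nonneg_left (hB _) (by positivity)
    · refine Eventually.of_forall fun y => ?_
      refine Tendsto.const_mul _ ?_
      have h2 : Tendsto (fun n => e n • y + z) atTop (𝓝 z) := by
        simpa using (het.smul_const y).add_const z
      exact (hφ.continuous.tendsto z).comp h2
  exact tendsto_nhds_unique hL hR

/-! ### Weakly harmonic functions: mollification and the maximum principle. -/

/-- Harmonicity in the unit disc in the sense of distributions. -/
def WeaklyHarmonic (h : Plane → ℝ) : Prop :=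
  ∀ φ : Plane → ℝ, ContDiff ℝ ∞ φ → HasCompactSupport φ → tsupport φ ⊆ ball 0 1 →
    ∫ x, h x * Laplacian.laplacian φ x = 0

/-- Convolution with a normed bump function. -/
def mollify (b : ContDiffBump (0 : Plane)) (g : Plane → ℝ) : Plane → ℝ :=
  convolution g (b.normed volume) (ContinuousLinearMap.mul ℝ ℝ) volume

theorem abs_mollify_sub_le (b : ContDiffBump (0 : Plane)) {g : Plane → ℝ} {x : Plane} {a e : ℝ}
    (he : 0 ≤ e) (hm : AEStronglyMeasurable g volume)
    (hg : ∀ t ∈ ball x b.rOut, |g t - a| ≤ e) : |mollify b g x - a| ≤ e := by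
  have h := dist_convolution_le (f := b.normed volume) (g := g) (x₀ := x) (R := b.rOut) (ε := e)
    (z₀ := a) (μ := volume) he b.support_normed_eq.subset b.nonneg_normed b.integral_normed hm
    (by simpa [Real.dist_eq] using hg)
  have h2 : convolution (b.normed volume) g (ContinuousLinearMap.lsmul ℝ ℝ) volume
      = mollify b g := by
    rw [mollify, ← convolution_flip]
    congr 1
    ext; simp
  rwa [h2, Real.dist_eq] at h

theorem contDiff_mollify (b : ContDiffBump (0 : Plane)) {g : Plane → ℝ}
    (hg : LocallyIntegrable g volume) : ContDiff ℝ ∞ (mollify b g) :=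
  b.hasCompactSupport_normed.contDiff_convolution_right _ hg b.contDiff_normed

theorem fderiv_convolution_apply {g ψ : Plane → ℝ} (hg : LocallyIntegrable g volume)
    (hψ : ContDiff ℝ 1 ψ) (hc : HasCompactSupport ψ) (v : Plane) :
    (fun x => fderiv ℝ (convolution g ψ (ContinuousLinearMap.mul ℝ ℝ) volume) x v)
      = convolution g (fun y => fderiv ℝ ψ y v) (ContinuousLinearMap.mul ℝ ℝ) volume := by
  ext x
  rw [(hc.hasFDerivAt_convolution_right _ hg hψ x).fderiv]
  exact convolution_precompR_apply _ hg (hc.fderiv ℝ) (hψ.continuous_fderiv one_ne_zero) x v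

theorem laplacian_convolution {g ψ : Plane → ℝ} (hg : LocallyIntegrable g volume)
    (hψ : ContDiff ℝ 2 ψ) (hc : HasCompactSupport ψ) (x : Plane) :
    Laplacian.laplacian (convolution g ψ (ContinuousLinearMap.mul ℝ ℝ) volume) x
      = ∫ t, g t * Laplacian.laplacian ψ (x - t) := by
  have hψ1 : ∀ i, ContDiff ℝ 1 fun y => fderiv ℝ ψ y (basisVec i) :=
    fun i => contDiff_fderiv_apply (n := 1) (by exact_mod_cast hψ) _
  have hc1 : ∀ i, HasCompactSupport fun y => fderiv ℝ ψ y (basisVec i) :=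
    fun i => hc.fderiv_apply ℝ _
  have hψ2 : ∀ i, Continuous fun y => fderiv ℝ (fun y => fderiv ℝ ψ y (basisVec i)) y (basisVec i) :=
    fun i => ((hψ1 i).continuous_fderiv one_ne_zero).clm_apply continuous_const
  rw [laplacian_eq_sum (hc.contDiff_convolution_right _ hg hψ).contDiffAt]
  simp_rw [fun x => laplacian_eq_sum (hψ.contDiffAt (x := x)), Finset.mul_sum]
  rw [integral_finsetSum]
  · refine Finset.sum_congr rfl fun i _ => ?_
    rw [fderiv_convolution_apply hg (hψ.of_le (by norm_num)) hc]
    exact congrFun (fderiv_convolution_apply hg (hψ1 i) (hc1 i) (basisVec i)) x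
  · intro i _
    exact ((hc1 i).fderiv_apply ℝ _).convolutionExists_right
      (ContinuousLinearMap.mul ℝ ℝ) hg (hψ2 i) x

theorem laplacian_comp_const_sub (f : Plane → ℝ) (hf : ContDiff ℝ 2 f) (a x : Plane) :
    Laplacian.laplacian (fun y => f (a - y)) x = Laplacian.laplacian f (a - x) := by
  have h1 : ContDiff ℝ 2 fun y => f (a - y) := hf.comp (contDiff_const.sub contDiff_id)
  rw [laplacian_eq_sum h1.contDiffAt, laplacian_eq_sum hf.contDiffAt]
  refine Finset.sum_congr rfl fun i _ => ?_
  have h2 : ∀ (g : Plane → ℝ), Differentiable ℝ g → ∀ y v,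
      fderiv ℝ (fun y => g (a - y)) y v = - fderiv ℝ g (a - y) v := by
    intro g hg y v
    have := ((hg (a - y)).hasFDerivAt.comp y ((hasFDerivAt_id y).const_sub a)).fderiv
    have h3 : fderiv ℝ (fun y => g (a - y)) y = _ := this
    rw [h3]; simp
  have h4 : (fun y => fderiv ℝ (fun y => f (a - y)) y (basisVec i))
      = fun y => - (fun w => fderiv ℝ f w (basisVec i)) (a - y) := by
    ext y; exact h2 f (hf.differentiable (by norm_num)) y _
  rw [h4, fderiv_fun_neg]
  simp only [_root_.neg_apply]
  rw [h2 (fun w => fderiv ℝ f w (basisVec i)) ?_ x (basisVec i), neg_neg]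
  exact (contDiff_fderiv_apply (n := 1) (by exact_mod_cast hf) _).differentiable (by norm_num)

/-- The extension by zero of a function on the closed unit disc. -/
def extend (h : Plane → ℝ) : Plane → ℝ := (closedBall (0 : Plane) 1).indicator h

theorem integrable_extend {h : Plane → ℝ} (hh : ContinuousOn h (closedBall 0 1)) :
    Integrable (extend h) := by
  rw [extend, integrable_indicator_iff measurableSet_closedBall]
  exact hh.integrableOn_compact (isCompact_closedBall _ _)

/-- The Laplacian falls on the bump, and for ‖x‖ + rOut < 1 the reflected bump centred at x is an
admissible test function for weak harmonicity. The extension by zero changes nothing there, since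
the bump is supported inside the disc. -/
theorem laplacian_mollify_eq_zero {h : Plane → ℝ} (hh : ContinuousOn h (closedBall 0 1))
    (hw : WeaklyHarmonic h) (b : ContDiffBump (0 : Plane)) {x : Plane}
    (hx : ‖x‖ + b.rOut < 1) : Laplacian.laplacian (mollify b (extend h)) x = 0 := by
  have hb : ContDiff ℝ ∞ (b.normed volume : Plane → ℝ) := b.contDiff_normed
  have hb2 : ContDiff ℝ 2 (b.normed volume : Plane → ℝ) := hb.of_le two_le_infty
  rw [mollify, laplacian_convolution (integrable_extend hh).locallyIntegrable hb2
    b.hasCompactSupport_normed]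
  have hsub : tsupport (fun y => b.normed volume (x - y)) ⊆ closedBall x b.rOut := by
    refine closure_minimal (fun y hy => ?_) isClosed_closedBall
    have : x - y ∈ Function.support (b.normed volume : Plane → ℝ) := hy
    rw [b.support_normed_eq, mem_ball_zero_iff] at this
    rw [mem_closedBall, dist_comm, dist_eq_norm]
    exact this.le
  have hball : closedBall x b.rOut ⊆ ball (0 : Plane) 1 := by
    intro y hy
    rw [mem_closedBall, dist_eq_norm] at hy
    rw [mem_ball_zero_iff]
    have : y = x + (y - x) := by abel
    rw [this]
    linarith [norm_add_le x (y - x)]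
  have h1 := hw (fun y => b.normed volume (x - y)) (hb.comp (contDiff_const.sub contDiff_id))
    (IsCompact.of_isClosed_subset (isCompact_closedBall x b.rOut) (isClosed_tsupport _) hsub)
    (hsub.trans hball)
  rw [← h1]
  refine integral_congr_ae (Eventually.of_forall fun t => ?_)
  simp only
  rw [laplacian_comp_const_sub _ hb2]
  by_cases ht : t ∈ closedBall (0 : Plane) 1
  · rw [extend, Set.indicator_of_mem ht]
  · have : Laplacian.laplacian (b.normed volume : Plane → ℝ) (x - t) = 0 := by
      rw [← laplacian_comp_const_sub _ hb2]
      by_contra hne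
      exact ht (ball_subset_closedBall (hball (hsub (tsupport_laplacian_subset
        (subset_tsupport _ hne)))))
    rw [this, mul_zero, mul_zero]

/-- If the second derivative along v were positive, the restriction to the line would have a local
minimum as well as a local maximum. It would then be locally constant and its second derivative
would vanish. -/
theorem fderiv_fderiv_nonpos_of_isLocalMax {f : Plane → ℝ} (hf : ContDiff ℝ 2 f) {x : Plane}
    (hx : IsLocalMax f x) (v : Plane) : fderiv ℝ (fun y => fderiv ℝ f y v) x v ≤ 0 := by
  by_contra! hpos
  set p : ℝ → ℝ := fun t => f (x + t • v) with hp
  have hline : ∀ t : ℝ, HasDerivAt (fun t : ℝ => x + t • v) v t := by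
    intro t
    simpa using ((hasDerivAt_id t).smul_const v).const_add x
  have hd1 : ∀ t, deriv p t = fderiv ℝ f (x + t • v) v := by
    intro t
    exact ((hf.differentiable (by norm_num) _).hasFDerivAt.comp_hasDerivAt t (hline t)).deriv
  have hd2 : deriv (deriv p) 0 = fderiv ℝ (fun y => fderiv ℝ f y v) x v := by
    have h1 : deriv p = fun t => (fun y => fderiv ℝ f y v) (x + t • v) := by
      ext t; exact hd1 t
    rw [h1]
    have h2 : DifferentiableAt ℝ (fun y => fderiv ℝ f y v) (x + (0 : ℝ) • v) :=
      (contDiff_fderiv_apply (n := 1) (by exact_mod_cast hf) v).differentiable (by norm_num) _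
    have := (h2.hasFDerivAt.comp_hasDerivAt (0 : ℝ) (hline 0)).deriv
    rw [zero_smul, add_zero] at this
    exact this
  have hcont : Continuous p := hf.continuous.comp (by fun_prop)
  have hmax : IsLocalMax p 0 := by
    have h1 : Tendsto (fun t : ℝ => x + t • v) (𝓝 0) (𝓝 x) := by
      have : Continuous fun t : ℝ => x + t • v := by fun_prop
      simpa using this.tendsto 0
    have h2 : IsLocalMax f (x + (0 : ℝ) • v) := by simpa using hx
    exact (h1.eventually hx).mono fun t ht => by simpa [hp] using ht
  have hmin : IsLocalMin p 0 :=
    isLocalMin_of_deriv_deriv_pos (by rw [hd2]; exact hpos) hmax.deriv_eq_zero hcont.continuousAt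
  have hconst : p =ᶠ[𝓝 0] fun _ => p 0 := by
    filter_upwards [hmax, hmin] with t h1 h2 using le_antisymm h1 h2
  have h3 : deriv p =ᶠ[𝓝 0] fun _ => 0 := by
    have := hconst.deriv
    simpa using this
  have h4 := h3.deriv_eq
  rw [hd2, deriv_const] at h4
  exact hpos.ne' h4

theorem laplacian_norm_sq (x : Plane) :
    Laplacian.laplacian (fun y : Plane => ‖y‖ ^ 2) x = 4 := by
  rw [laplacian_eq_sum (contDiff_norm_sq ℝ).contDiffAt]
  have h1 : ∀ i, (fun y => fderiv ℝ (fun y : Plane => ‖y‖ ^ 2) y (basisVec i))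
      = fun y : Plane => 2 * y i := by
    intro i; ext y
    rw [(hasStrictFDerivAt_norm_sq y).hasFDerivAt.fderiv]
    simp [two_smul, inner_basisVec, two_mul]
  have h2 : ∀ i, fderiv ℝ (fun y : Plane => 2 * y i) x (basisVec i) = 2 := by
    intro i
    have hc : HasFDerivAt (fun y : Plane => y i) (EuclideanSpace.proj i : Plane →L[ℝ] ℝ) x :=
      (EuclideanSpace.proj i : Plane →L[ℝ] ℝ).hasFDerivAt
    rw [(hc.const_mul 2).fderiv]
    simp [basisVec]
  simp_rw [h1, h2]
  norm_num

/-- Adding e|y|² makes the Laplacian equal to 4e > 0 inside, which excludes an interior maximum.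
Then e → 0. -/
theorem le_of_laplacian_eq_zero {f : Plane → ℝ} (hf : ContDiff ℝ 2 f) {ρ m : ℝ} (hρ : 0 < ρ)
    (hΔ : ∀ x ∈ ball (0 : Plane) ρ, Laplacian.laplacian f x = 0)
    (hm : ∀ x ∈ sphere (0 : Plane) ρ, f x ≤ m) {x : Plane} (hx : x ∈ closedBall (0 : Plane) ρ) :
    f x ≤ m := by
  have key : ∀ e > 0, f x ≤ m + e * ρ ^ 2 := by
    intro e he
    set g : Plane → ℝ := fun y => f y + e * ‖y‖ ^ 2 with hg
    have hq : ContDiff ℝ 2 fun y : Plane => e * ‖y‖ ^ 2 := contDiff_const.mul (contDiff_norm_sq ℝ)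
    have hg2 : ContDiff ℝ 2 g := hf.add hq
    obtain ⟨x0, hx0, hmax⟩ := (isCompact_closedBall (0 : Plane) ρ).exists_isMaxOn ⟨x, hx⟩
      hg2.continuous.continuousOn
    have hx0s : x0 ∈ sphere (0 : Plane) ρ := by
      by_contra hns
      have hb : x0 ∈ ball (0 : Plane) ρ := by
        rw [mem_ball]
        exact lt_of_le_of_ne hx0 hns
      have hloc : IsLocalMax g x0 := hmax.isLocalMax (closedBall_mem_nhds_of_mem hb)
      have h1 : Laplacian.laplacian g x0 ≤ 0 := by
        rw [laplacian_eq_sum hg2.contDiffAt]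
        exact Finset.sum_nonpos fun i _ => fderiv_fderiv_nonpos_of_isLocalMax hg2 hloc _
      have h2 : Laplacian.laplacian g x0 = 4 * e := by
        have h3 := hf.contDiffAt.laplacian_add (x := x0) hq.contDiffAt
        have h4 : Laplacian.laplacian g x0 = _ := h3
        rw [h4, hΔ x0 hb]
        have h5 := InnerProductSpace.laplacian_smul (x := x0) e
          ((contDiff_norm_sq ℝ : ContDiff ℝ 2 fun y : Plane => ‖y‖ ^ 2).contDiffAt)
        have h6 : Laplacian.laplacian (fun y : Plane => e * ‖y‖ ^ 2) x0 = _ := h5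
        rw [h6, laplacian_norm_sq, smul_eq_mul]; ring
      linarith
    have h1 : g x ≤ g x0 := hmax hx
    have h2 := hm x0 hx0s
    rw [mem_sphere_zero_iff_norm] at hx0s
    simp only [hg, hx0s] at h1
    have h3 : 0 ≤ e * ‖x‖ ^ 2 := by positivity
    linarith
  refine le_of_forall_pos_le_add fun d hd => ?_
  have := key (d / ρ ^ 2) (by positivity)
  rwa [div_mul_cancel₀ _ (by positivity)] at this

/-- A bump function at the origin with outer radius `r`. -/
def bumpOfRadius (r : ℝ) (hr : 0 < r) : ContDiffBump (0 : Plane) :=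
  ⟨r / 2, r, by positivity, by linarith⟩

/-- The mollification is smooth and harmonic on a slightly smaller disc, where the classical maximum
principle applies. Uniform continuity transfers the boundary bound to the smaller circle and the
conclusion back to h. -/
theorem WeaklyHarmonic.le_of_le_sphere {h : Plane → ℝ} (hw : WeaklyHarmonic h)
    (hh : ContinuousOn h (closedBall 0 1)) {m : ℝ} (hm : ∀ x ∈ sphere (0 : Plane) 1, h x ≤ m)
    {x : Plane} (hx : x ∈ closedBall (0 : Plane) 1) : h x ≤ m := by
  have main : ∀ x ∈ ball (0 : Plane) 1, h x ≤ m := by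
    clear hx x
    intro x hx
    refine le_of_forall_pos_le_add fun e he => ?_
    have huc := (isCompact_closedBall (0 : Plane) 1).uniformContinuousOn_of_continuous hh
    rw [Metric.uniformContinuousOn_iff] at huc
    obtain ⟨d, hd, hd'⟩ := huc (e / 3) (by positivity)
    have hx1 : ‖x‖ < 1 := by simpa using hx
    -- The circle of radius 1 - 2r is at distance 2r < d from the unit circle, and x lies in the
    -- disc of radius 1 - 2r because ‖x‖ ≤ 1 - 3r.
    set r : ℝ := min (d / 3) ((1 - ‖x‖) / 3) with hr
    have hr0 : 0 < r := lt_min (by positivity) (by linarith)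
    have hrd : r ≤ d / 3 := min_le_left _ _
    have hrx : r ≤ (1 - ‖x‖) / 3 := min_le_right _ _
    have hx0 := norm_nonneg x
    set b := bumpOfRadius r hr0
    have hbr : b.rOut = r := rfl
    have hclose : ∀ y : Plane, ‖y‖ ≤ 1 - 2 * r → |mollify b (extend h) y - h y| ≤ e / 3 := by
      intro y hy
      refine abs_mollify_sub_le b (by positivity) (integrable_extend hh).aestronglyMeasurable ?_
      intro t ht
      rw [hbr, mem_ball, dist_eq_norm] at ht
      have ht1 : t ∈ closedBall (0 : Plane) 1 := by
        rw [mem_closedBall_zero_iff]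
        have : t = y + (t - y) := by abel
        rw [this]
        linarith [norm_add_le y (t - y)]
      rw [extend, Set.indicator_of_mem ht1, ← Real.dist_eq]
      refine (hd' t ht1 y ?_ ?_).le
      · rw [mem_closedBall_zero_iff]; linarith
      · rw [dist_eq_norm]; linarith
    have hρ : 0 < 1 - 2 * r := by linarith
    have hsph : ∀ y ∈ sphere (0 : Plane) (1 - 2 * r), mollify b (extend h) y ≤ m + 2 * e / 3 := by
      intro y hy
      rw [mem_sphere_zero_iff_norm] at hy
      have h1 := (abs_le.1 (hclose y hy.le)).2
      have hy0 : 0 < ‖y‖ := by rw [hy]; exact hρ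
      have hn : ‖‖y‖⁻¹ • y‖ = 1 := by
        rw [norm_smul, norm_inv, norm_norm, inv_mul_cancel₀ hy0.ne']
      have h2 : dist y (‖y‖⁻¹ • y) < d := by
        have h3 : y - ‖y‖⁻¹ • y = (1 - ‖y‖⁻¹) • y := by rw [sub_smul, one_smul]
        have h4 : |1 - ‖y‖⁻¹| * ‖y‖ = |‖y‖ - 1| := by
          rw [← abs_norm y, ← abs_mul, abs_norm]
          congr 1; field_simp
        rw [dist_eq_norm, h3, norm_smul, Real.norm_eq_abs, h4, hy, abs_sub_comm,
          abs_of_nonneg (by linarith)]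
        linarith
      have h5 := hd' y (by rw [mem_closedBall_zero_iff]; linarith) _
        (by rw [mem_closedBall_zero_iff, hn]) h2
      rw [Real.dist_eq] at h5
      have h6 := hm _ (by rw [mem_sphere_zero_iff_norm]; exact hn)
      have h7 := (abs_lt.1 h5).2
      linarith
    have h1 := le_of_laplacian_eq_zero
      ((contDiff_mollify b (integrable_extend hh).locallyIntegrable).of_le two_le_infty) hρ
      (fun y hy => laplacian_mollify_eq_zero hh hw b (by
        rw [mem_ball_zero_iff] at hy
        rw [hbr]; linarith)) hsph (x := x) (by rw [mem_closedBall_zero_iff]; linarith)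
    have h2 := (abs_le.1 (hclose x (by linarith))).1
    linarith
  have hcl : closedBall (0 : Plane) 1 = closure (ball (0 : Plane) 1) :=
    (closure_ball _ one_ne_zero).symm
  have h1 := hh
  rw [hcl] at h1
  exact le_on_closure main h1 continuousOn_const (by rwa [← hcl])

theorem WeaklyHarmonic.neg {h : Plane → ℝ} (hw : WeaklyHarmonic h) :
    WeaklyHarmonic fun x => - h x := by
  intro φ h1 h2 h3
  simp [integral_neg, hw φ h1 h2 h3]

theorem integral_laplacian_eq_zero {φ : Plane → ℝ} (hφ : ContDiff ℝ 2 φ)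
    (hc : HasCompactSupport φ) : ∫ x, Laplacian.laplacian φ x = 0 := by
  have := integral_mul_laplacian (f := fun _ => 1) contDiff_const hφ hc
  simpa using this

theorem hasCompactSupport_laplacian {φ : Plane → ℝ} (hc : HasCompactSupport φ) :
    HasCompactSupport (Laplacian.laplacian φ) :=
  hc.of_isClosed_subset (isClosed_tsupport _) tsupport_laplacian_subset

theorem integrable_continuousOn_mul {h g : Plane → ℝ} (hh : ContinuousOn h (closedBall 0 1))
    (hg : Continuous g) (hc : HasCompactSupport g) (hs : tsupport g ⊆ ball 0 1) :
    Integrable fun x => h x * g x := by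
  have h1 : IntegrableOn (fun x => h x * g x) (closedBall 0 1) :=
    (hh.mul hg.continuousOn).integrableOn_compact (isCompact_closedBall _ _)
  rw [← integrableOn_univ]
  refine h1.of_forall_sdiff_eq_zero MeasurableSet.univ fun x hx => ?_
  have : g x = 0 := by
    by_contra hne
    exact hx.2 (ball_subset_closedBall (hs (subset_tsupport _ hne)))
  simp [this]

theorem WeaklyHarmonic.sub_const {h : Plane → ℝ} (hw : WeaklyHarmonic h)
    (hh : ContinuousOn h (closedBall 0 1)) (c : ℝ) : WeaklyHarmonic fun x => h x - c := by
  intro φ h1 h2 h3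
  have hφ2 := h1.of_le two_le_infty
  have hcΔ := hasCompactSupport_laplacian h2
  simp_rw [sub_mul]
  rw [integral_sub, hw φ h1 h2 h3, integral_const_mul, integral_laplacian_eq_zero hφ2 h2]
  · simp
  · exact integrable_continuousOn_mul hh (continuous_laplacian hφ2) hcΔ
      (tsupport_laplacian_subset.trans h3)
  · exact ((continuous_laplacian hφ2).integrable_of_hasCompactSupport hcΔ).const_mul c

theorem WeaklyHarmonic.osc_le {h : Plane → ℝ} (hw : WeaklyHarmonic h)
    (hh : ContinuousOn h (closedBall 0 1)) {B : ℝ}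
    (hB : ∀ x ∈ sphere (0 : Plane) 1, ∀ y ∈ sphere (0 : Plane) 1, |h x - h y| ≤ B) :
    ∃ c, ∀ x ∈ closedBall (0 : Plane) 1, |h x - c| ≤ B := by
  have he : basisVec 0 ∈ sphere (0 : Plane) 1 := by
    simp [basisVec]
  refine ⟨h (basisVec 0), fun x hx => ?_⟩
  rw [abs_le]
  constructor
  · have := hw.neg.le_of_le_sphere hh.neg (m := - h (basisVec 0) + B) ?_ hx
    · linarith
    · intro y hy
      have := (abs_le.1 (hB y hy _ he)).1
      linarith
  · have := hw.le_of_le_sphere hh (m := h (basisVec 0) + B) ?_ hx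
    · linarith
    · intro y hy
      have := (abs_le.1 (hB y hy _ he)).2
      linarith

/-! ### Interior gradient bound for harmonic functions. -/

/-- A smooth function on the plane which is equal to `log |y|` for `|y| ≥ 1 / 4`. -/
def cutLog (y : Plane) : ℝ := (1 - bumpOfRadius (1 / 4) (by norm_num) y) * Real.log ‖y‖

theorem cutLog_eq {y : Plane} (hy : 1 / 4 ≤ ‖y‖) : cutLog y = Real.log ‖y‖ := by
  rw [cutLog, (bumpOfRadius (1 / 4) (by norm_num)).zero_of_le_dist (by simpa [bumpOfRadius] using hy)]
  ring

theorem contDiff_cutLog : ContDiff ℝ ∞ cutLog := by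
  rw [contDiff_iff_contDiffAt]
  intro y
  rcases eq_or_ne y 0 with rfl | hy
  · have h1 : cutLog =ᶠ[𝓝 0] fun _ => 0 := by
      filter_upwards [(bumpOfRadius (1 / 4) (by norm_num)).eventuallyEq_one] with y hy
      rw [cutLog, hy]; simp
    exact contDiffAt_const.congr_of_eventuallyEq h1
  · refine ContDiffAt.mul ?_ ?_
    · exact contDiffAt_const.sub (bumpOfRadius (1 / 4) (by norm_num)).contDiff.contDiffAt
    · exact (contDiffAt_norm ℝ hy).log (norm_ne_zero_iff.2 hy)

theorem contDiff_laplacian {f : Plane → ℝ} (hf : ContDiff ℝ 3 f) :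
    ContDiff ℝ 1 (Laplacian.laplacian f) := by
  have : Laplacian.laplacian f
      = fun x => ∑ i, fderiv ℝ (fun y => fderiv ℝ f y (basisVec i)) x (basisVec i) := by
    ext1 x; exact laplacian_eq_sum (hf.of_le (by norm_num)).contDiffAt
  rw [this]
  refine ContDiff.sum fun i _ => ?_
  exact contDiff_fderiv_apply (n := 1)
    (contDiff_fderiv_apply (n := 2) (by exact_mod_cast hf) _) _

/-- The function Δ`cutLog` is the kernel that reproduces harmonic functions, so its Lipschitz
constant becomes their gradient bound. Radius 2 contains the differences of two points of the unit
disc. -/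
theorem exists_lipschitz_laplacian_cutLog : ∃ L : ℝ, 0 ≤ L ∧ ∀ x ∈ closedBall (0 : Plane) 2,
    ∀ y ∈ closedBall (0 : Plane) 2,
      |Laplacian.laplacian cutLog x - Laplacian.laplacian cutLog y| ≤ L * ‖x - y‖ := by
  have h3 : (3 : WithTop ℕ∞) ≤ ((⊤ : ℕ∞) : WithTop ℕ∞) :=
    WithTop.coe_le_coe.2 (le_top : (3 : ℕ∞) ≤ ⊤)
  have h1 : ContDiff ℝ 1 (Laplacian.laplacian cutLog) :=
    contDiff_laplacian (contDiff_cutLog.of_le h3)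
  obtain ⟨L, hL⟩ := (isCompact_closedBall (0 : Plane) 2).exists_bound_of_continuousOn
    (h1.continuous_fderiv one_ne_zero).continuousOn
  refine ⟨L, (norm_nonneg _).trans (hL 0 (by simp)), fun x hx y hy => ?_⟩
  exact (convex_closedBall (0 : Plane) 2).norm_image_sub_le_of_norm_fderiv_le
    (fun z _ => h1.differentiable one_ne_zero z) hL hy hx

/-- A plateau function supported in the unit disc and equal to `1` on the disc of radius `5 / 8`. -/
def plateau : ContDiffBump (0 : Plane) := ⟨5 / 8, 3 / 4, by norm_num, by norm_num⟩

/-- The fundamental solution represents `plateau` · f. Its Laplacian vanishes on the disc of radius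
5/8, so the singular part of the logarithm at x is never seen. The logarithm may be replaced by the
smooth `cutLog`, and the Laplacian moved onto it. -/
theorem two_pi_mul_eq_integral {f : Plane → ℝ} (hf : ContDiff ℝ ∞ f)
    (hΔ : ∀ x ∈ ball (0 : Plane) (5 / 8), Laplacian.laplacian f x = 0) {x : Plane}
    (hx : ‖x‖ < 1 / 4) :
    2 * Real.pi * f x = ∫ z, Laplacian.laplacian cutLog (z - x) * (plateau z * f z) := by
  have hφ : ContDiff ℝ ∞ fun z => plateau z * f z := plateau.contDiff.mul hf
  have hφ2 := hφ.of_le two_le_infty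
  have hc : HasCompactSupport fun z => plateau z * f z := plateau.hasCompactSupport.mul_right
  have h1 := integral_log_mul_laplacian hφ2 hc x
  have hx1 : plateau x = 1 := plateau.one_of_mem_closedBall (by
    rw [mem_closedBall_zero_iff]; change ‖x‖ ≤ 5 / 8; linarith)
  rw [hx1, one_mul] at h1
  have h2 := integral_mul_laplacian (f := fun z => cutLog (z - x))
    ((contDiff_cutLog.of_le two_le_infty).comp (contDiff_id.sub contDiff_const)) hφ2 hc
  simp_rw [laplacian_comp_sub] at h2
  rw [← h1, ← h2]
  refine integral_congr_ae (Eventually.of_forall fun z => ?_)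
  simp only
  -- Since ‖x‖ < 1/4 and 1/4 + 1/4 < 5/8, points where `cutLog` may differ from the logarithm lie
  -- where f is harmonic and the plateau is 1.
  rcases lt_or_ge ‖z - x‖ (1 / 4) with h | h
  · have hz : z ∈ ball (0 : Plane) (5 / 8) := by
      rw [mem_ball_zero_iff]
      have : z = x + (z - x) := by abel
      rw [this]
      linarith [norm_add_le x (z - x)]
    have hev : (fun z => plateau z * f z) =ᶠ[𝓝 z] f := by
      filter_upwards [isOpen_ball.mem_nhds hz] with w hw
      rw [plateau.one_of_mem_closedBall (ball_subset_closedBall hw), one_mul]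
    rw [(InnerProductSpace.laplacian_congr_nhds hev).eq_of_nhds, hΔ z hz, mul_zero, mul_zero]
  · rw [cutLog_eq h]

/-- Subtract the representation formulas at x and y, and integrate the Lipschitz bound of the kernel
over the unit disc of area π. -/
theorem abs_sub_le_of_laplacian_eq_zero {L : ℝ} (hL0 : 0 ≤ L)
    (hL : ∀ x ∈ closedBall (0 : Plane) 2, ∀ y ∈ closedBall (0 : Plane) 2,
      |Laplacian.laplacian cutLog x - Laplacian.laplacian cutLog y| ≤ L * ‖x - y‖)
    {f : Plane → ℝ} (hf : ContDiff ℝ ∞ f)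
    (hΔ : ∀ x ∈ ball (0 : Plane) (5 / 8), Laplacian.laplacian f x = 0) {B : ℝ} (hB0 : 0 ≤ B)
    (hB : ∀ x ∈ ball (0 : Plane) 1, |f x| ≤ B) {x y : Plane}
    (hx : ‖x‖ < 1 / 4) (hy : ‖y‖ < 1 / 4) : |f x - f y| ≤ L * B * ‖x - y‖ := by
  have hcont : ∀ x : Plane, Continuous fun z => Laplacian.laplacian cutLog (z - x) := fun x =>
    (continuous_laplacian (contDiff_cutLog.of_le two_le_infty)).comp
      (continuous_id.sub continuous_const)
  have hint : ∀ x : Plane,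
      Integrable fun z => Laplacian.laplacian cutLog (z - x) * (plateau z * f z) := fun x =>
    ((hcont x).mul (plateau.continuous.mul hf.continuous)).integrable_of_hasCompactSupport
      plateau.hasCompactSupport.mul_right.mul_left
  have h1 : 2 * Real.pi * (f x - f y) = ∫ z, (Laplacian.laplacian cutLog (z - x)
      - Laplacian.laplacian cutLog (z - y)) * (plateau z * f z) := by
    rw [mul_sub, two_pi_mul_eq_integral hf hΔ hx, two_pi_mul_eq_integral hf hΔ hy,
      ← integral_sub (hint x) (hint y)]
    simp_rw [sub_mul]
  have h2 : |2 * Real.pi * (f x - f y)| ≤ L * B * ‖x - y‖ * Real.pi := by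
    rw [h1]
    have h3 : ∫ z, (Laplacian.laplacian cutLog (z - x)
        - Laplacian.laplacian cutLog (z - y)) * (plateau z * f z)
        = ∫ z in ball (0 : Plane) 1, (Laplacian.laplacian cutLog (z - x)
        - Laplacian.laplacian cutLog (z - y)) * (plateau z * f z) := by
      refine (setIntegral_eq_integral_of_forall_compl_eq_zero fun z hz => ?_).symm
      have : plateau z = 0 := plateau.zero_of_le_dist (by
        rw [mem_ball_zero_iff, not_lt] at hz
        rw [dist_zero_right]; change (3 / 4 : ℝ) ≤ _; linarith)
      rw [this]; ring
    rw [h3, ← Real.norm_eq_abs]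
    refine (norm_setIntegral_le_of_norm_le_const (C := L * B * ‖x - y‖) ?_ ?_).trans ?_
    · exact measure_ball_lt_top
    · intro z hz
      rw [mem_ball_zero_iff] at hz
      have ha := hL (z - x) (by rw [mem_closedBall_zero_iff]; linarith [norm_sub_le z x])
        (z - y) (by rw [mem_closedBall_zero_iff]; linarith [norm_sub_le z y])
      rw [sub_sub_sub_cancel_left, norm_sub_rev] at ha
      have hb : |plateau z * f z| ≤ B := by
        rw [abs_mul, abs_of_nonneg plateau.nonneg]
        exact (mul_le_of_le_one_left (abs_nonneg _) plateau.le_one).trans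
          (hB z (by rwa [mem_ball_zero_iff]))
      rw [norm_mul, Real.norm_eq_abs, Real.norm_eq_abs]
      calc _ ≤ L * ‖x - y‖ * B := mul_le_mul ha hb (abs_nonneg _) (by positivity)
        _ = _ := by ring
    · rw [volume_real_ball _ zero_le_one]; simp
  rw [abs_mul, abs_of_pos Real.two_pi_pos] at h2
  have h4 : 2 * |f x - f y| ≤ L * B * ‖x - y‖ := by
    have := Real.pi_pos
    have h5 : (2 * |f x - f y|) * Real.pi ≤ L * B * ‖x - y‖ * Real.pi := by linarith
    exact le_of_mul_le_mul_right h5 this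
  linarith [abs_nonneg (f x - f y)]

/-- Smooth approximation of a weakly harmonic function, with a gradient bound. -/
theorem exists_harmonic_approx : ∃ L : ℝ, 0 ≤ L ∧ ∀ (h : Plane → ℝ) (B c : ℝ),
    ContinuousOn h (closedBall 0 1) → WeaklyHarmonic h →
    (∀ x ∈ closedBall (0 : Plane) 1, |h x - c| ≤ B) →
    ∃ g : ℕ → Plane → ℝ, (∀ n, ContDiff ℝ 1 (g n)) ∧
      (∀ x ∈ ball (0 : Plane) (1 / 4), Tendsto (fun n => g n x) atTop (𝓝 (h x))) ∧
      (∀ n, ∀ x ∈ ball (0 : Plane) (1 / 4), ‖fderiv ℝ (g n) x‖ ≤ L * B) ∧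
      (∀ n, ∀ x ∈ ball (0 : Plane) (1 / 4), |g n x - c| ≤ B) := by
  obtain ⟨L, hL0, hL⟩ := exists_lipschitz_laplacian_cutLog
  refine ⟨L, hL0, fun h B c hh hw hB => ?_⟩
  have hB0 : 0 ≤ B := (abs_nonneg _).trans (hB 0 (by simp))
  set k : Plane → ℝ := fun x => h x - c with hk
  have hkc : ContinuousOn k (closedBall 0 1) := hh.sub continuousOn_const
  have hkw : WeaklyHarmonic k := hw.sub_const hh c
  have hr : ∀ n : ℕ, (0 : ℝ) < 1 / (4 * ((n : ℝ) + 1)) := fun n => by positivity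
  -- The bump radius is at most 1/4, and 5/8 + 1/4 < 1, so every mollification is harmonic on the
  -- disc of radius 5/8 required by the gradient estimate.
  have hr4 : ∀ n : ℕ, 1 / (4 * ((n : ℝ) + 1)) ≤ 1 / 4 := fun n => by
    apply one_div_le_one_div_of_le (by norm_num)
    linarith [(Nat.cast_nonneg n : (0 : ℝ) ≤ n)]
  set b : ℕ → ContDiffBump (0 : Plane) := fun n => bumpOfRadius _ (hr n) with hb
  have hbr : ∀ n, (b n).rOut = 1 / (4 * ((n : ℝ) + 1)) := fun n => rfl
  have hkm := (integrable_extend hkc).aestronglyMeasurable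
  have hsm : ∀ n, ContDiff ℝ ∞ (mollify (b n) (extend k)) := fun n =>
    contDiff_mollify _ (integrable_extend hkc).locallyIntegrable
  have hbd : ∀ n x, |mollify (b n) (extend k) x| ≤ B := by
    intro n x
    have := abs_mollify_sub_le (b n) (x := x) (a := 0) hB0 hkm ?_
    · simpa using this
    · intro t _
      by_cases ht : t ∈ closedBall (0 : Plane) 1
      · rw [extend, Set.indicator_of_mem ht, sub_zero]; exact hB t ht
      · rw [extend, Set.indicator_of_notMem ht]; simpa using hB0
  refine ⟨fun n x => mollify (b n) (extend k) x + c, ?_, ?_, ?_, ?_⟩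
  · exact fun n => ((hsm n).of_le (WithTop.coe_le_coe.2 le_top)).add contDiff_const
  · intro x hx
    rw [mem_ball_zero_iff] at hx
    have h1 : Tendsto (fun n => mollify (b n) (extend k) x) atTop (𝓝 (k x)) := by
      rw [Metric.tendsto_atTop']
      intro e he
      have hx1 : closedBall (0 : Plane) 1 ∈ 𝓝 x :=
        mem_of_superset (isOpen_ball.mem_nhds (show x ∈ ball (0 : Plane) 1 by
          rw [mem_ball_zero_iff]; linarith)) ball_subset_closedBall
      have h2 := (hkc.continuousAt hx1).eventually (Metric.ball_mem_nhds _ (half_pos he))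
      obtain ⟨d, hd, hd'⟩ := Metric.eventually_nhds_iff.1 (h2.and hx1)
      obtain ⟨N, hN⟩ := exists_nat_one_div_lt hd
      refine ⟨N, fun n hn => ?_⟩
      have h3 := abs_mollify_sub_le (b n) (x := x) (a := k x) (half_pos he).le hkm ?_
      · rw [Real.dist_eq]; linarith
      · intro t ht
        rw [mem_ball, hbr] at ht
        have h4 : 1 / (4 * ((n : ℝ) + 1)) ≤ 1 / ((N : ℝ) + 1) := by
          apply one_div_le_one_div_of_le (by positivity)
          have : (N : ℝ) ≤ n := by exact_mod_cast (le_of_lt hn)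
          linarith [(Nat.cast_nonneg n : (0 : ℝ) ≤ n)]
        obtain ⟨h5, h6⟩ := hd' (lt_trans ht (lt_of_le_of_lt h4 hN))
        rw [extend, Set.indicator_of_mem (mem_closedBall.2 h6), ← Real.dist_eq]
        exact (mem_ball.1 h5).le
    simpa [hk] using h1.add_const c
  · intro n x hx
    rw [fderiv_add_const]
    refine norm_fderiv_le_of_lip' ℝ (by positivity) ?_
    filter_upwards [isOpen_ball.mem_nhds hx] with y hy
    rw [mem_ball_zero_iff] at hx hy
    refine abs_sub_le_of_laplacian_eq_zero hL0 hL (hsm n) ?_ hB0 (fun z _ => hbd n z) hy hx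
    intro z hz
    rw [mem_ball_zero_iff] at hz
    refine laplacian_mollify_eq_zero hkc hkw _ ?_
    rw [hbr]
    linarith [hr4 n]
  · intro n x _
    simpa using hbd n x

/-! ### The virial inequality for one component. -/

section

/-- The integrand is the divergence of the compactly supported field g(x)x. -/
theorem integral_div_radial {g : Plane → ℝ} (hg : ContDiff ℝ 1 g) (hc : HasCompactSupport g) :
    ∫ x, (2 * g x + fderiv ℝ g x x) = 0 := by
  have hcoord : ∀ i : Fin 2, ContDiff ℝ 1 fun x : Plane => x i := fun i =>
    (EuclideanSpace.proj i : Plane →L[ℝ] ℝ).contDiff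
  have hd : ∀ i, Continuous fun x => fderiv ℝ g x (basisVec i) := fun i =>
    (hg.continuous_fderiv one_ne_zero).clm_apply continuous_const
  have h1 : ∀ x, fderiv ℝ g x x = ∑ i, x i * fderiv ℝ g x (basisVec i) := by
    intro x
    have hx : x = ∑ i, x i • basisVec i := by
      have := (EuclideanSpace.basisFun (Fin 2) ℝ).sum_repr x
      simpa [basisVec] using this.symm
    conv_lhs => rw [hx]
    rw [map_sum]
    simp only [map_smul, smul_eq_mul, ← hx]
  have h2 : ∀ i : Fin 2, ∫ x : Plane, x i * fderiv ℝ g x (basisVec i) = - ∫ x, g x := by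
    intro i
    rw [integral_mul_fderiv_fderiv (hcoord i) hg hc]
    have : ∀ x : Plane, fderiv ℝ (fun x : Plane => x i) x (basisVec i) = 1 := by
      intro x
      have hcd : HasFDerivAt (fun y : Plane => y i) (EuclideanSpace.proj i : Plane →L[ℝ] ℝ) x :=
        (EuclideanSpace.proj i : Plane →L[ℝ] ℝ).hasFDerivAt
      rw [hcd.fderiv]; simp [basisVec]
    simp [this]
  have h3 : ∀ i : Fin 2, Integrable fun x : Plane => x i * fderiv ℝ g x (basisVec i) := fun i =>
    ((hcoord i).continuous.mul (hd i)).integrable_of_hasCompactSupport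
      (hc.fderiv_apply ℝ _).mul_left
  simp_rw [h1]
  rw [integral_add ((hg.continuous.integrable_of_hasCompactSupport hc).const_mul 2)
    (integrable_finsetSum _ fun i _ => h3 i), integral_finsetSum _ fun i _ => h3 i,
    integral_const_mul]
  simp [h2]

/-- For γ < 0 the regularisation only increases the logarithm, so |x|^{2γ} is a majorant. For γ ≥ 0
a constant suffices. For γ > -1 the majorant is integrable, uniformly in ε. -/
theorem exp_logReg_le {γ ε : ℝ} (hε : 0 < ε) (hε1 : ε ≤ 1) {x : Plane} (hx0 : x ≠ 0)
    (hx1 : ‖x‖ ≤ 1) :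
    Real.exp (2 * γ * logReg ε x) ≤ Real.exp (2 * |γ|) * ‖x‖ ^ min (2 * γ) 0 := by
  have hn : 0 < ‖x‖ := norm_pos_iff.2 hx0
  rcases le_or_gt 0 γ with h | h
  · rw [min_eq_right (by linarith), Real.rpow_zero, mul_one, abs_of_nonneg h]
    apply Real.exp_le_exp.2
    have : logReg ε x ≤ 1 := by
      have h1 := Real.log_le_sub_one_of_pos (x := ‖x‖ ^ 2 + ε ^ 2) (by positivity)
      rw [logReg]
      nlinarith [norm_nonneg x]
    nlinarith
  · rw [min_eq_left (by linarith), Real.rpow_def_of_pos hn, ← Real.exp_add]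
    apply Real.exp_le_exp.2
    have : Real.log ‖x‖ ≤ logReg ε x := by
      rw [logReg, le_div_iff₀ two_pos, mul_comm, ← Nat.cast_two (R := ℝ), ← Real.log_pow]
      apply Real.log_le_log (by positivity)
      nlinarith [sq_nonneg ε]
    have := abs_nonneg γ
    nlinarith

theorem integrableOn_norm_rpow_min {γ : ℝ} (hγ : -1 < γ) :
    IntegrableOn (fun x : Plane => ‖x‖ ^ min (2 * γ) 0) (ball 0 1) := by
  have h : -min (2 * γ) 0 < 2 := by
    rcases min_choice (2 * γ) 0 with h | h <;> rw [h] <;> linarith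
  have := integrableOn_norm_rpow_ball h 1
  simpa using this

/-- The regularised density. -/
def densReg (γ : ℝ) (b : Fin 3 → ℝ) (ν : Fin 3 → Measure Plane) (g : Plane → ℝ) (ε : ℝ)
    (x : Plane) : ℝ :=
  Real.exp (g x + 2 * γ * logReg ε x - ∑ j, b j * potReg (ν j) ε x)

variable {γ : ℝ} {b : Fin 3 → ℝ} {ν : Fin 3 → Measure Plane} [∀ j, IsFiniteMeasure (ν j)]
  {q C : Fin 3 → ℝ}

theorem contDiff_densReg (hν : ∀ j, Tame (ν j) (q j) (C j)) {g : Plane → ℝ} (hg : ContDiff ℝ 1 g)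
    {ε : ℝ} (hε : 0 < ε) : ContDiff ℝ 1 (densReg γ b ν g ε) := by
  unfold densReg
  refine ContDiff.exp ((hg.add (contDiff_const.mul
    ((logReg_contDiff hε).of_le (WithTop.coe_le_coe.2 le_top)))).sub ?_)
  exact ContDiff.sum fun j _ => contDiff_const.mul (contDiff_potReg (hν j).supp hε)

theorem fderiv_densReg_self (hν : ∀ j, Tame (ν j) (q j) (C j)) {g : Plane → ℝ}
    (hg : ContDiff ℝ 1 g) {ε : ℝ} (hε : 0 < ε) (x : Plane) :
    fderiv ℝ (densReg γ b ν g ε) x x = densReg γ b ν g ε x *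
      (fderiv ℝ g x x + 2 * γ * (‖x‖ ^ 2 / (‖x‖ ^ 2 + ε ^ 2))
        - ∑ j, b j * radialPot (ν j) ε x) := by
  have h1 := (hg.differentiable one_ne_zero x).hasFDerivAt
  have h2 := (hasFDerivAt_logReg hε x).const_mul (2 * γ)
  have h3 := HasFDerivAt.fun_sum (u := Finset.univ) fun j (_ : j ∈ Finset.univ) =>
    ((contDiff_potReg (hν j).supp hε).differentiable one_ne_zero x).hasFDerivAt.const_mul (b j)
  have h4 : fderiv ℝ (densReg γ b ν g ε) x = _ := (((h1.add h2).sub h3).exp).fderiv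
  rw [h4]
  simp only [_root_.smul_apply, _root_.sub_apply, _root_.add_apply, smul_eq_mul,
    _root_.sum_apply, fderiv_potReg_self (hν _).supp hε, innerSL_apply_apply,
    real_inner_self_eq_norm_sq, densReg, Pi.add_apply, Pi.sub_apply]
  congr 2
  ring

theorem densReg_le (hν : ∀ j, Tame (ν j) (q j) (C j)) {g : Plane → ℝ} {G : ℝ} {ε : ℝ}
    (hε : 0 < ε) (hε1 : ε ≤ 1) {x : Plane} (hx0 : x ≠ 0) (hx : x ∈ ball (0 : Plane) 1)
    (hG : g x ≤ G) :
    densReg γ b ν g ε x ≤ Real.exp (G + 2 * |γ|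
      + ∑ j, |b j| * (2 * (ν j).real Set.univ + 2 * C j / q j)) * ‖x‖ ^ min (2 * γ) 0 := by
  have hx1 : ‖x‖ ≤ 1 := by rw [mem_ball_zero_iff] at hx; exact hx.le
  have h1 : - ∑ j, b j * potReg (ν j) ε x
      ≤ ∑ j, |b j| * (2 * (ν j).real Set.univ + 2 * C j / q j) := by
    rw [← Finset.sum_neg_distrib]
    refine Finset.sum_le_sum fun j _ => ?_
    have := (hν j).abs_potReg_le hε hε1 (ball_subset_closedBall hx)
    refine (neg_le_abs _).trans ?_
    rw [abs_mul]
    exact mul_le_mul_of_nonneg_left this (abs_nonneg _)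
  have h2 := exp_logReg_le (γ := γ) hε hε1 hx0 hx1
  have h3 : densReg γ b ν g ε x = Real.exp (2 * γ * logReg ε x)
      * Real.exp (g x - ∑ j, b j * potReg (ν j) ε x) := by
    rw [densReg, ← Real.exp_add]; congr 1; ring
  rw [h3]
  calc _ ≤ Real.exp (2 * |γ|) * ‖x‖ ^ min (2 * γ) 0
        * Real.exp (G + ∑ j, |b j| * (2 * (ν j).real Set.univ + 2 * C j / q j)) := by
        refine mul_le_mul h2 (Real.exp_le_exp.2 ?_) (Real.exp_pos _).le (by positivity)
        linarith
    _ = _ := by rw [mul_right_comm, ← Real.exp_add]; congr 2; ring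

theorem tendsto_densReg (hν : ∀ j, Tame (ν j) (q j) (C j)) {g : ℕ → Plane → ℝ} {h : Plane → ℝ}
    {ε : ℕ → ℝ} (hε : ∀ n, 0 < ε n) (hε0 : Tendsto ε atTop (𝓝 0)) {x : Plane}
    (hx0 : x ≠ 0) (hx : x ∈ ball (0 : Plane) 1)
    (hg : Tendsto (fun n => g n x) atTop (𝓝 (h x))) :
    Tendsto (fun n => densReg γ b ν (g n) (ε n) x) atTop
      (𝓝 (Real.exp (h x + 2 * γ * Real.log ‖x‖ - ∑ j, b j * pot (ν j) x))) := by
  have h1 : Tendsto (fun n => logReg (ε n) x) atTop (𝓝 (Real.log ‖x‖)) := by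
    rw [tendsto_iff_norm_sub_tendsto_zero]
    refine squeeze_zero (fun _ => norm_nonneg _)
      (fun n => abs_logReg_sub_log_le one_pos le_rfl (hε n) hx0) ?_
    simp only [Real.rpow_one, div_one]
    simpa using hε0.mul_const (‖x‖ ^ (-1 : ℝ))
  have h2 : ∀ j, Tendsto (fun n => potReg (ν j) (ε n) x) atTop (𝓝 (pot (ν j) x)) := by
    intro j
    rw [tendsto_iff_norm_sub_tendsto_zero]
    refine squeeze_zero (fun _ => norm_nonneg _)
      (fun n => (hν j).abs_potReg_sub_pot_le (hε n) (ball_subset_closedBall hx)) ?_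
    have := hε0.rpow_const (p := q j) (Or.inr (hν j).q_pos.le)
    rw [Real.zero_rpow (hν j).q_pos.ne'] at this
    simpa using (this.div_const (q j)).mul_const (C j)
  exact ((hg.add (h1.const_mul _)).sub
    (tendsto_finsetSum _ fun j _ => (h2 j).const_mul _)).rexp

/-- The density is singular at 0 and need not be differentiable in the form required, so the
divergence theorem is applied to η times the regularised density, and the regularisation is then
removed by dominated convergence. All terms of x·∇ log u converge except the one from the harmonic
approximation g. Only its gradient bound H is used, and it is the whole error since |x| ≤ δ on the
support of η. -/
theorem abs_virial_component_le (hγ : -1 < γ) (hν : ∀ j, Tame (ν j) (q j) (C j))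
    {g : ℕ → Plane → ℝ} {h : Plane → ℝ} {H G : ℝ} (hg : ∀ n, ContDiff ℝ 1 (g n))
    (hgh : ∀ x ∈ ball (0 : Plane) (1 / 4), Tendsto (fun n => g n x) atTop (𝓝 (h x)))
    (hgH : ∀ n, ∀ x ∈ ball (0 : Plane) (1 / 4), ‖fderiv ℝ (g n) x‖ ≤ H)
    (hgG : ∀ n, ∀ x ∈ ball (0 : Plane) (1 / 4), g n x ≤ G)
    {U : Plane → ℝ} (hU : ∀ x ∈ ball (0 : Plane) (1 / 4), x ≠ 0 →
      U x = Real.exp (h x + 2 * γ * Real.log ‖x‖ - ∑ j, b j * pot (ν j) x))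
    {η : Plane → ℝ} (hη : ContDiff ℝ 1 η) {δ : ℝ} (hδ : δ < 1 / 4)
    (hs : tsupport η ⊆ closedBall 0 δ) :
    |∫ x, U x * ((2 + 2 * γ) * η x + fderiv ℝ η x x
        - η x * ∑ j, b j * radialPot (ν j) 0 x)| ≤ H * δ * ∫ x, U x * |η x| := by
  set e : ℕ → ℝ := fun n => 1 / ((n : ℝ) + 1) with he
  have he0 : ∀ n, 0 < e n := fun n => by positivity
  have he1 : ∀ n, e n ≤ 1 := fun n => by
    rw [he]; simp only; rw [div_le_one (by positivity)]; linarith [(Nat.cast_nonneg n : (0:ℝ) ≤ n)]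
  have het : Tendsto e atTop (𝓝 0) := tendsto_one_div_add_atTop_nhds_zero_nat
  have hc : HasCompactSupport η :=
    IsCompact.of_isClosed_subset (isCompact_closedBall 0 δ) (isClosed_tsupport _) hs
  have hsub : closedBall (0 : Plane) δ ⊆ ball 0 (1 / 4) := closedBall_subset_ball hδ
  have hsub1 : ball (0 : Plane) (1 / 4) ⊆ ball 0 1 := ball_subset_ball (by norm_num)
  have hη0 : ∀ x, x ∉ closedBall (0 : Plane) δ → η x = 0 := fun x hx => by
    by_contra hne; exact hx (hs (subset_tsupport _ hne))
  have hη1 : ∀ x, x ∉ closedBall (0 : Plane) δ → fderiv ℝ η x = 0 := fun x hx => by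
    by_contra hne; exact hx (hs (support_fderiv_subset ℝ hne))
  have hηc : Continuous fun x => fderiv ℝ η x x :=
    (hη.continuous_fderiv one_ne_zero).clm_apply continuous_id
  set u : ℕ → Plane → ℝ := fun n => densReg γ b ν (g n) (e n) with hu
  have hu1 : ∀ n, ContDiff ℝ 1 (u n) := fun n => contDiff_densReg hν (hg n) (he0 n)
  have hne : ∀ᵐ x : Plane, x ≠ 0 := by rw [ae_iff]; simp
  set K : ℝ := Real.exp (G + 2 * |γ|
      + ∑ j, |b j| * (2 * (ν j).real Set.univ + 2 * C j / q j)) with hK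
  have hK0 : 0 ≤ K := (Real.exp_pos _).le
  -- The integrable majorant common to all regularised densities.
  set w : Plane → ℝ := (ball (0 : Plane) 1).indicator fun x => ‖x‖ ^ min (2 * γ) 0 with hw
  have hwi : Integrable w := by
    rw [hw, integrable_indicator_iff measurableSet_ball]
    exact integrableOn_norm_rpow_min hγ
  have hule : ∀ n, ∀ x ∈ ball (0 : Plane) (1 / 4), x ≠ 0 → u n x ≤ K * w x := by
    intro n x hx hx0
    rw [hw, Set.indicator_of_mem (hsub1 hx)]
    exact densReg_le hν (he0 n) (he1 n) hx0 (hsub1 hx) (hgG n x hx)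
  have hu0 : ∀ n x, 0 ≤ u n x := fun n x => (Real.exp_pos _).le
  have hut : ∀ x ∈ ball (0 : Plane) (1 / 4), x ≠ 0 →
      Tendsto (fun n => u n x) atTop (𝓝 (U x)) := by
    intro x hx hx0
    rw [hU x hx hx0]
    exact tendsto_densReg hν he0 het hx0 (hsub1 hx) (hgh x hx)
  set E : ℕ → Plane → ℝ := fun n x => u n x * (2 * η x + fderiv ℝ η x x
    + η x * (2 * γ * (‖x‖ ^ 2 / (‖x‖ ^ 2 + e n ^ 2)) - ∑ j, b j * radialPot (ν j) (e n) x)) with hE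
  have hrad : ∀ n j, Continuous fun x => radialPot (ν j) (e n) x := by
    intro n j
    have : (fun x => radialPot (ν j) (e n) x) = fun x => fderiv ℝ (potReg (ν j) (e n)) x x := by
      ext x; rw [fderiv_potReg_self (hν j).supp (he0 n)]
    rw [this]
    exact ((contDiff_potReg (hν j).supp (he0 n)).continuous_fderiv one_ne_zero).clm_apply
      continuous_id
  have hEc : ∀ n, Continuous (E n) := by
    intro n
    have h1 : Continuous fun x : Plane => ‖x‖ ^ 2 / (‖x‖ ^ 2 + e n ^ 2) :=
      Continuous.div₀ (by fun_prop) (by fun_prop) fun x => by have := he0 n; positivity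
    refine (hu1 n).continuous.mul (((continuous_const.mul hη.continuous).add hηc).add
      (hη.continuous.mul ((continuous_const.mul h1).sub ?_)))
    exact continuous_finsetSum _ fun j _ => continuous_const.mul (hrad n j)
  have hgc : ∀ n, Continuous fun x => u n x * η x * fderiv ℝ (g n) x x := fun n =>
    ((hu1 n).continuous.mul hη.continuous).mul
      (((hg n).continuous_fderiv one_ne_zero).clm_apply continuous_id)
  -- The divergence identity for η u_n, with the term containing ∇g isolated on the right.
  have hid : ∀ n, ∫ x, E n x = - ∫ x, u n x * η x * fderiv ℝ (g n) x x := by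
    intro n
    have h1 := integral_div_radial (hη.mul (hu1 n)) hc.mul_right
    have h2 : ∀ x, 2 * (η x * u n x) + fderiv ℝ (fun x => η x * u n x) x x
        = E n x + u n x * η x * fderiv ℝ (g n) x x := by
      intro x
      rw [fderiv_fun_mul (hη.differentiable one_ne_zero x) ((hu1 n).differentiable one_ne_zero x)]
      simp only [_root_.add_apply, _root_.smul_apply, smul_eq_mul]
      rw [hu, fderiv_densReg_self hν (hg n) (he0 n)]
      simp only [hE, hu]
      ring
    have h3 : ∫ x, (E n x + u n x * η x * fderiv ℝ (g n) x x) = 0 := by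
      rw [← h1]
      exact integral_congr_ae (Eventually.of_forall fun x => (h2 x).symm)
    rw [integral_add] at h3
    · linarith
    · refine (hEc n).integrable_of_hasCompactSupport ?_
      refine HasCompactSupport.intro (isCompact_closedBall (0 : Plane) δ) fun x hx => ?_
      simp [hE, hη0 x hx, hη1 x hx]
    · refine (hgc n).integrable_of_hasCompactSupport ?_
      refine HasCompactSupport.intro (isCompact_closedBall (0 : Plane) δ) fun x hx => ?_
      simp [hη0 x hx]
  have hui : ∀ n, Integrable fun x => u n x * |η x| := by
    intro n
    refine ((hu1 n).continuous.mul hη.continuous.abs).integrable_of_hasCompactSupport ?_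
    refine HasCompactSupport.intro (isCompact_closedBall (0 : Plane) δ) fun x hx => ?_
    simp [hη0 x hx]
  have hH0 : 0 ≤ H := (norm_nonneg _).trans (hgH 0 0 (by simp))
  have hbd : ∀ n, |∫ x, E n x| ≤ H * δ * ∫ x, u n x * |η x| := by
    intro n
    rw [hid n, abs_neg, ← integral_const_mul]
    refine abs_integral_le_integral_abs.trans (integral_mono_of_nonneg
      (Eventually.of_forall fun _ => abs_nonneg _) ((hui n).const_mul _)
      (Eventually.of_forall fun x => ?_))
    simp only
    by_cases hx : x ∈ closedBall (0 : Plane) δ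
    · have h1 : |fderiv ℝ (g n) x x| ≤ H * δ := by
        refine ((fderiv ℝ (g n) x).le_opNorm x).trans ?_
        exact mul_le_mul (hgH n x (hsub hx)) (by simpa using hx) (norm_nonneg _) hH0
      rw [abs_mul, abs_mul, abs_of_nonneg (hu0 n x), mul_comm]
      exact mul_le_mul_of_nonneg_right h1 (mul_nonneg (hu0 n x) (abs_nonneg _))
    · simp [hη0 x hx]
  obtain ⟨B0, hB0⟩ := hη.continuous.bounded_above_of_compact_support hc
  obtain ⟨B1, hB1⟩ := hηc.bounded_above_of_compact_support
    (HasCompactSupport.intro (isCompact_closedBall (0 : Plane) δ) fun x hx => by simp [hη1 x hx])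
  have hB00 : 0 ≤ B0 := (norm_nonneg _).trans (hB0 0)
  have hB10 : 0 ≤ B1 := (norm_nonneg _).trans (hB1 0)
  have hlim1 : Tendsto (fun n => ∫ x, u n x * |η x|) atTop (𝓝 (∫ x, U x * |η x|)) := by
    refine tendsto_integral_of_dominated_convergence (fun x => K * w x * B0)
      (fun n => (hui n).aestronglyMeasurable) ((hwi.const_mul K).mul_const B0) ?_ ?_
    · intro n
      filter_upwards [hne] with x hx0
      have hw0 : 0 ≤ w x := Set.indicator_nonneg (fun _ _ => by positivity) _
      rw [norm_mul, Real.norm_of_nonneg (hu0 n x), norm_abs_eq_norm]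
      by_cases hx : x ∈ closedBall (0 : Plane) δ
      · exact mul_le_mul (hule n x (hsub hx) hx0) (hB0 x) (norm_nonneg _) (by positivity)
      · simp only [hη0 x hx, norm_zero, mul_zero]; positivity
    · filter_upwards [hne] with x hx0
      by_cases hx : x ∈ closedBall (0 : Plane) δ
      · exact (hut x (hsub hx) hx0).mul_const _
      · simp [hη0 x hx]
  -- Domination works because the radial potentials are bounded by C j uniformly in ε and x, which
  -- is the Newtonian bound in `Tame`.
  have hlim2 : Tendsto (fun n => ∫ x, E n x) atTop (𝓝 (∫ x, U x * ((2 + 2 * γ) * η x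
      + fderiv ℝ η x x - η x * ∑ j, b j * radialPot (ν j) 0 x))) := by
    refine tendsto_integral_of_dominated_convergence
      (fun x => K * w x * (2 * B0 + B1 + B0 * (2 * |γ| + ∑ j, |b j| * C j)))
      (fun n => (hEc n).aestronglyMeasurable) ((hwi.const_mul K).mul_const _) ?_ ?_
    · intro n
      filter_upwards [hne] with x hx0
      have hw0 : 0 ≤ w x := Set.indicator_nonneg (fun _ _ => by positivity) _
      by_cases hx : x ∈ closedBall (0 : Plane) δ
      · have hrb : ∀ j, |radialPot (ν j) (e n) x| ≤ C j := fun j =>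
          (hν j).abs_radialPot_le (e n) (hsub1 (hsub hx)) hx0
        have h1 : |2 * γ * (‖x‖ ^ 2 / (‖x‖ ^ 2 + e n ^ 2)) - ∑ j, b j * radialPot (ν j) (e n) x|
            ≤ 2 * |γ| + ∑ j, |b j| * C j := by
          refine (abs_sub _ _).trans (add_le_add ?_ ?_)
          · rw [abs_mul, abs_mul, abs_two]
            refine mul_le_of_le_one_right (by positivity) ?_
            rw [abs_of_nonneg (by positivity)]
            refine div_le_one_of_le₀ ?_ (by positivity)
            nlinarith [sq_nonneg (e n)]
          · refine (Finset.abs_sum_le_sum_abs _ _).trans (Finset.sum_le_sum fun j _ => ?_)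
            rw [abs_mul]
            exact mul_le_mul_of_nonneg_left (hrb j) (abs_nonneg _)
        have h2 : ‖2 * η x + fderiv ℝ η x x + η x * (2 * γ * (‖x‖ ^ 2 / (‖x‖ ^ 2 + e n ^ 2))
            - ∑ j, b j * radialPot (ν j) (e n) x)‖
            ≤ 2 * B0 + B1 + B0 * (2 * |γ| + ∑ j, |b j| * C j) := by
          refine (norm_add_le _ _).trans (add_le_add ((norm_add_le _ _).trans
            (add_le_add ?_ (hB1 x))) ?_)
          · rw [norm_mul, Real.norm_two]; linarith [hB0 x]
          · rw [norm_mul]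
            exact mul_le_mul (hB0 x) h1 (norm_nonneg _) hB00
        rw [hE]
        simp only
        rw [norm_mul, Real.norm_of_nonneg (hu0 n x)]
        exact mul_le_mul (hule n x (hsub hx) hx0) h2 (norm_nonneg _) (by positivity)
      · have hC : ∀ j, 0 ≤ C j := fun j =>
          (integral_nonneg fun z => by positivity).trans ((hν j).riesz_le 0 (by simp))
        have : 0 ≤ ∑ j, |b j| * C j := Finset.sum_nonneg fun j _ =>
          mul_nonneg (abs_nonneg _) (hC j)
        simp only [hE, hη0 x hx, hη1 x hx, _root_.zero_apply, mul_zero, zero_mul, add_zero,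
          norm_zero]
        positivity
    · filter_upwards [hne] with x hx0
      by_cases hx : x ∈ closedBall (0 : Plane) δ
      · refine (hut x (hsub hx) hx0).mul ?_
        have h1 : Tendsto (fun n => ‖x‖ ^ 2 / (‖x‖ ^ 2 + e n ^ 2)) atTop (𝓝 1) := by
          have hp : ‖x‖ ^ 2 ≠ 0 := pow_ne_zero _ (norm_ne_zero_iff.2 hx0)
          have : Tendsto (fun n => ‖x‖ ^ 2 / (‖x‖ ^ 2 + e n ^ 2)) atTop
              (𝓝 (‖x‖ ^ 2 / (‖x‖ ^ 2 + 0 ^ 2))) :=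
            tendsto_const_nhds.div (tendsto_const_nhds.add (het.pow 2)) (by simpa using hp)
          simpa [hp] using this
        have h2 := tendsto_finsetSum (Finset.univ : Finset (Fin 3)) fun j _ =>
          ((hν j).tendsto_radialPot het (hsub1 (hsub hx)) hx0).const_mul (b j)
        have h3 := ((h1.const_mul (2 * γ)).sub h2).const_mul (η x)
        have h4 := h3.const_add (2 * η x + fderiv ℝ η x x)
        convert h4 using 2
        ring
      · simp [hE, hη0 x hx, hη1 x hx]
  exact le_of_tendsto_of_tendsto hlim2.abs (hlim1.const_mul (H * δ)) (Eventually.of_forall hbd)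

end

/-! ### Symmetrisation of the virial kernel. -/

section

/-- A cutoff function adapted to the disc of radius `ρ`. -/
structure IsCutoff (L ρ : ℝ) (η : Plane → ℝ) : Prop where
  contDiff : ContDiff ℝ 1 η
  tsupport_subset : tsupport η ⊆ closedBall 0 (2 * ρ)
  nonneg : ∀ x, 0 ≤ η x
  le_one : ∀ x, η x ≤ 1
  eq_one : ∀ x, ‖x‖ ≤ ρ → η x = 1
  eq_zero : ∀ x, 2 * ρ ≤ ‖x‖ → η x = 0
  radial_le : ∀ x, |fderiv ℝ η x x| ≤ L
  radial_eq_zero : ∀ x, ‖x‖ < ρ → fderiv ℝ η x x = 0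
  radial_eq_zero' : ∀ x, 2 * ρ < ‖x‖ → fderiv ℝ η x x = 0
  lipschitz : ∀ x z, ‖η x • x - η z • z‖ ≤ L * ‖x - z‖

/-- With η(x) = θ(x/ρ) for one fixed θ, both x·∇η and the Lipschitz constant of η(x)x are invariant
under scaling. Hence L does not depend on ρ. -/
theorem exists_isCutoff : ∃ L : ℝ, 1 ≤ L ∧ ∀ ρ > 0, ∃ η, IsCutoff L ρ η := by
  let θ : ContDiffBump (0 : Plane) := ⟨1, 2, one_pos, one_lt_two⟩
  have hθ : ContDiff ℝ 1 θ := θ.contDiff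
  have hθc : HasCompactSupport θ := θ.hasCompactSupport
  obtain ⟨L1, hL1⟩ := (((hθ.continuous_fderiv one_ne_zero).clm_apply
    continuous_id : Continuous fun y => fderiv ℝ θ y y)).bounded_above_of_compact_support
    (HasCompactSupport.of_support_subset_isCompact hθc.isCompact fun y hy => by
      by_contra hne
      refine hy ?_
      have : fderiv ℝ θ y = 0 := by
        by_contra h; exact hne (support_fderiv_subset ℝ h)
      simp [this])
  obtain ⟨L2, hL2⟩ := ContDiff.lipschitzWith_of_hasCompactSupport (𝕂 := ℝ)
    (f := fun y : Plane => θ y • y) hθc.smul_right (hθ.smul contDiff_id) one_ne_zero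
  refine ⟨max 1 (max L1 L2), le_max_left _ _, fun ρ hρ => ⟨fun x => θ (ρ⁻¹ • x), ?_⟩⟩
  have hρ' : 0 < ρ⁻¹ := inv_pos.2 hρ
  have hnorm : ∀ x : Plane, ‖ρ⁻¹ • x‖ = ‖x‖ / ρ := fun x => by
    rw [norm_smul, Real.norm_of_nonneg hρ'.le, div_eq_inv_mul]
  have hd : ∀ x : Plane, fderiv ℝ (fun x => θ (ρ⁻¹ • x)) x x
      = fderiv ℝ θ (ρ⁻¹ • x) (ρ⁻¹ • x) := by
    intro x
    have h1 : HasFDerivAt (fun x : Plane => ρ⁻¹ • x)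
        (ρ⁻¹ • ContinuousLinearMap.id ℝ Plane) x := (hasFDerivAt_id x).const_smul ρ⁻¹
    have h2 := ((hθ.differentiable one_ne_zero (ρ⁻¹ • x)).hasFDerivAt.comp x h1).fderiv
    have h3 : fderiv ℝ (fun x => θ (ρ⁻¹ • x)) x = _ := h2
    rw [h3]
    simp
  have hzero : ∀ x : Plane, 2 * ρ ≤ ‖x‖ → θ (ρ⁻¹ • x) = 0 := fun x hx =>
    θ.zero_of_le_dist (by
      rw [dist_zero_right, hnorm, le_div_iff₀ hρ]; exact hx)
  have hts : tsupport (fun x => θ (ρ⁻¹ • x)) ⊆ closedBall 0 (2 * ρ) := by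
    refine closure_minimal (fun x hx => ?_) isClosed_closedBall
    rw [mem_closedBall_zero_iff]
    by_contra h
    exact hx (hzero x (not_le.1 h).le)
  refine ⟨hθ.comp (contDiff_id.const_smul ρ⁻¹), hts, fun x => θ.nonneg, fun x => θ.le_one,
    ?_, hzero, ?_, ?_, ?_, ?_⟩
  · intro x hx
    refine θ.one_of_mem_closedBall ?_
    rw [mem_closedBall_zero_iff, hnorm, div_le_iff₀ hρ]
    change ‖x‖ ≤ 1 * ρ
    linarith
  · intro x
    rw [hd]
    exact (hL1 _).trans ((le_max_left _ _).trans (le_max_right _ _))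
  · intro x hx
    rw [hd]
    have h1 : (θ : Plane → ℝ) =ᶠ[𝓝 (ρ⁻¹ • x)] fun _ => 1 := by
      have : ρ⁻¹ • x ∈ ball (0 : Plane) 1 := by
        rw [mem_ball_zero_iff, hnorm, div_lt_iff₀ hρ]; linarith
      filter_upwards [isOpen_ball.mem_nhds this] with w hw
      exact θ.one_of_mem_closedBall (ball_subset_closedBall hw)
    rw [h1.fderiv_eq]
    simp
  · intro x hx
    have : fderiv ℝ (fun x => θ (ρ⁻¹ • x)) x = 0 := by
      by_contra h
      have := hts (support_fderiv_subset ℝ h)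
      rw [mem_closedBall_zero_iff] at this
      linarith
    simp [this]
  · intro x z
    have h1 := hL2.norm_sub_le (ρ⁻¹ • x) (ρ⁻¹ • z)
    have h2 : ∀ x : Plane, θ (ρ⁻¹ • x) • x = ρ • (θ (ρ⁻¹ • x) • ρ⁻¹ • x) := by
      intro x
      rw [smul_comm ρ, smul_smul ρ, mul_inv_cancel₀ hρ.ne', one_smul]
    have h3 : ‖x - z‖ = ρ * ‖ρ⁻¹ • x - ρ⁻¹ • z‖ := by
      rw [← smul_sub, norm_smul, Real.norm_of_nonneg hρ'.le, mul_inv_cancel_left₀ hρ.ne']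
    rw [h2 x, h2 z, ← smul_sub, norm_smul, Real.norm_of_nonneg hρ.le, h3, mul_left_comm]
    refine mul_le_mul_of_nonneg_left (h1.trans ?_) hρ.le
    exact mul_le_mul_of_nonneg_right ((le_max_right _ _).trans (le_max_right _ _)) (norm_nonneg _)

/-- The symmetrised virial kernel. -/
def symKernel (η : Plane → ℝ) (x z : Plane) : ℝ :=
  inner ℝ (η x • x - η z • z) (x - z) / ‖x - z‖ ^ 2

/-- The virial kernel before symmetrisation. -/
def virialKernel (η : Plane → ℝ) (x z : Plane) : ℝ :=
  η x * (inner ℝ (x - z) x / (‖x - z‖ ^ 2 + 0 ^ 2))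

/-- Exchanging x and z changes the sign of (x - z)/|x - z|², so the two copies combine into a
difference that cancels the singularity on the diagonal. -/
theorem virialKernel_add_swap (η : Plane → ℝ) (x z : Plane) :
    virialKernel η x z + virialKernel η z x = symKernel η x z := by
  rw [virialKernel, virialKernel, symKernel, norm_sub_rev z x, inner_sub_left (η x • x),
    real_inner_smul_left, real_inner_smul_left, real_inner_comm x (x - z),
    ← neg_sub x z, inner_neg_left, real_inner_comm z (x - z)]
  ring

variable {L ρ : ℝ} {η : Plane → ℝ}

theorem IsCutoff.abs_symKernel_le (hη : IsCutoff L ρ η) (hL : 1 ≤ L) (x z : Plane) :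
    |symKernel η x z| ≤ L := by
  rcases eq_or_ne (x - z) 0 with h | h
  · simp [symKernel, h]; linarith
  have h0 : 0 < ‖x - z‖ := norm_pos_iff.2 h
  rw [symKernel, abs_div, abs_of_nonneg (by positivity : 0 ≤ ‖x - z‖ ^ 2),
    div_le_iff₀ (by positivity)]
  refine (abs_real_inner_le_norm _ _).trans ?_
  calc _ ≤ L * ‖x - z‖ * ‖x - z‖ := by gcongr; exact hη.lipschitz x z
    _ = _ := by ring

theorem symKernel_comm (η : Plane → ℝ) (x z : Plane) : symKernel η x z = symKernel η z x := by
  rw [← virialKernel_add_swap, ← virialKernel_add_swap, add_comm]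

theorem IsCutoff.abs_symKernel_far (hη : IsCutoff L ρ η) (hρ : 0 < ρ) {t : ℝ} {x z : Plane}
    (hx : ‖x‖ ≤ ρ) (hxt : ‖x‖ ≤ t) (hz : 4 * ρ ≤ ‖z‖) : |symKernel η x z| ≤ t / (3 * ρ) := by
  have h1 : 3 * ρ ≤ ‖x - z‖ := by
    have := norm_sub_norm_le z x
    rw [norm_sub_rev] at this
    linarith
  have h0 : 0 < ‖x - z‖ := by linarith
  rw [symKernel, hη.eq_zero z (by linarith), hη.eq_one x hx, zero_smul, one_smul, sub_zero,
    abs_div, abs_of_nonneg (by positivity : 0 ≤ ‖x - z‖ ^ 2), div_le_div_iff₀ (by positivity)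
    (by positivity)]
  have h2 := abs_real_inner_le_norm x (x - z)
  have ht : 0 ≤ t := (norm_nonneg x).trans hxt
  calc |inner ℝ x (x - z)| * (3 * ρ) ≤ (t * ‖x - z‖) * ‖x - z‖ :=
        mul_le_mul (h2.trans (by gcongr)) h1 (by positivity) (by positivity)
    _ = _ := by ring

/-- Off the diagonal the kernel is exactly 1 on M × M, and exactly 0 when both points are beyond 4ρ.
It is at most t/(3ρ) when one point is in M and the other beyond 4ρ. Any pair with a point in the
intermediate region B(0, 4ρ) \ M is charged to the global bound L. -/
theorem IsCutoff.abs_symKernel_sub_le (hη : IsCutoff L ρ η) (hL : 1 ≤ L) (hρ : 0 < ρ) {t : ℝ}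
    (ht0 : 0 ≤ t) (ht : t ≤ ρ) {M : Set Plane} (hM : ∀ x ∈ M, ‖x‖ ≤ t) {x z : Plane}
    (hxz : x - z ≠ 0) :
    |symKernel η x z - M.indicator (fun _ => (1 : ℝ)) x * M.indicator (fun _ => (1 : ℝ)) z|
      ≤ L * ((ball (0 : Plane) (4 * ρ) \ M).indicator (fun _ => (1 : ℝ)) x
        + (ball (0 : Plane) (4 * ρ) \ M).indicator (fun _ => (1 : ℝ)) z) + t / (3 * ρ) := by
  set E := ball (0 : Plane) (4 * ρ) \ M with hE
  have hi : ∀ w, 0 ≤ E.indicator (fun _ => (1 : ℝ)) w :=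
    fun w => Set.indicator_nonneg (fun _ _ => zero_le_one) w
  have htr : 0 ≤ t / (3 * ρ) := by positivity
  have hS := hη.abs_symKernel_le hL x z
  by_cases hxE : x ∈ E
  · rw [Set.indicator_of_mem hxE, Set.indicator_of_notMem hxE.2, zero_mul, sub_zero]
    nlinarith [hi z]
  by_cases hzE : z ∈ E
  · rw [Set.indicator_of_mem hzE, Set.indicator_of_notMem hzE.2, mul_zero, sub_zero]
    nlinarith [hi x]
  rw [Set.indicator_of_notMem hxE, Set.indicator_of_notMem hzE, add_zero, mul_zero, zero_add]
  have hout : ∀ w, w ∉ E → w ∉ M → 4 * ρ ≤ ‖w‖ := by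
    intro w hw hwM
    by_contra h
    exact hw ⟨by rw [mem_ball_zero_iff]; exact not_le.1 h, hwM⟩
  by_cases hxM : x ∈ M
  · have hx := hM x hxM
    by_cases hzM : z ∈ M
    · have hz := hM z hzM
      rw [Set.indicator_of_mem hxM, Set.indicator_of_mem hzM, symKernel,
        hη.eq_one x (hx.trans ht), hη.eq_one z (hz.trans ht), one_smul, one_smul,
        real_inner_self_eq_norm_sq, div_self (pow_ne_zero _ (norm_ne_zero_iff.2 hxz))]
      simpa using htr
    · rw [Set.indicator_of_notMem hzM, mul_zero, sub_zero]
      exact hη.abs_symKernel_far hρ (hx.trans ht) hx (hout z hzE hzM)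
  · rw [Set.indicator_of_notMem hxM, zero_mul, sub_zero]
    have hx := hout x hxE hxM
    by_cases hzM : z ∈ M
    · have hz := hM z hzM
      rw [symKernel_comm]
      exact hη.abs_symKernel_far hρ (hz.trans ht) hz hx
    · have hz := hout z hzE hzM
      rw [symKernel, hη.eq_zero x (by linarith), hη.eq_zero z (by linarith)]
      simpa using htr

theorem measurable_symKernel (hη : Continuous η) :
    Measurable (fun p : Plane × Plane => symKernel η p.1 p.2) := by
  have h1 : Continuous fun p : Plane × Plane => inner ℝ (η p.1 • p.1 - η p.2 • p.2) (p.1 - p.2) := by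
    fun_prop
  have h2 : Continuous fun p : Plane × Plane => ‖p.1 - p.2‖ ^ 2 := by fun_prop
  exact h1.measurable.div h2.measurable

theorem measurable_virialKernel (hη : Continuous η) :
    Measurable (fun p : Plane × Plane => virialKernel η p.1 p.2) := by
  have h1 : Continuous fun p : Plane × Plane => inner ℝ (p.1 - p.2) p.1 := by fun_prop
  have h2 : Continuous fun p : Plane × Plane => ‖p.1 - p.2‖ ^ 2 + 0 ^ 2 := by fun_prop
  exact (hη.comp continuous_fst).measurable.mul (h1.measurable.div h2.measurable)

/-- The unsymmetrised kernel is singular like |x|/|x - z|. The bound `newton_le` on the inner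
integral is uniform in x, so finiteness of μ gives joint integrability, which is what Fubini needs
before symmetrising. -/
theorem integrable_prod_virialKernel (hη : IsCutoff L ρ η) (hρ1 : 2 * ρ < 1)
    {μ ν : Measure Plane} [IsFiniteMeasure μ] [IsFiniteMeasure ν] {q C : ℝ} (hν : Tame ν q C) :
    Integrable (fun p : Plane × Plane => virialKernel η p.1 p.2) (μ.prod ν) := by
  have hm := (measurable_virialKernel hη.contDiff.continuous).aestronglyMeasurable (μ := μ.prod ν)
  have hC : 0 ≤ C := (integral_nonneg fun z => by positivity).trans (hν.riesz_le 0 (by simp))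
  have hk : ∀ x z, ‖virialKernel η x z‖ ≤ η x * (‖x‖ * ‖x - z‖⁻¹) := by
    intro x z
    rw [virialKernel, norm_mul, Real.norm_of_nonneg (hη.nonneg x)]
    exact mul_le_mul_of_nonneg_left (abs_radial_kernel_le 0 x z) (hη.nonneg x)
  have hcase : ∀ x, η x = 0 ∨ x = 0 ∨ (x ∈ ball (0 : Plane) 1 ∧ x ≠ 0) := by
    intro x
    rcases eq_or_ne x 0 with h | h
    · exact Or.inr (Or.inl h)
    rcases le_or_gt (2 * ρ) ‖x‖ with h2 | h2
    · exact Or.inl (hη.eq_zero x h2)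
    · exact Or.inr (Or.inr ⟨by rw [mem_ball_zero_iff]; linarith, h⟩)
  have hx : ∀ x, Integrable (fun z => virialKernel η x z) ν ∧
      ∫ z, ‖virialKernel η x z‖ ∂ν ≤ C := by
    intro x
    rcases hcase x with h | h | ⟨h, h0⟩
    · simp [virialKernel, h, hC]
    · simp [virialKernel, h, hC]
    · have h1 : Integrable (fun z => virialKernel η x z) ν := by
        refine Integrable.mono' (((hν.newton_int x h h0).const_mul ‖x‖).const_mul (η x)) ?_
          (Eventually.of_forall fun z => hk x z)
        exact ((measurable_virialKernel hη.contDiff.continuous).comp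
          measurable_prodMk_left).aestronglyMeasurable
      refine ⟨h1, ?_⟩
      refine (integral_mono h1.norm (((hν.newton_int x h h0).const_mul ‖x‖).const_mul (η x))
        fun z => hk x z).trans ?_
      rw [integral_const_mul, integral_const_mul]
      have h2 := hν.newton_le x h h0
      have h3 : 0 ≤ ‖x‖ * ∫ z, ‖x - z‖⁻¹ ∂ν :=
        mul_nonneg (norm_nonneg _) (integral_nonneg fun z => by positivity)
      exact (mul_le_of_le_one_left h3 (hη.le_one x)).trans h2
  rw [integrable_prod_iff hm]
  refine ⟨Eventually.of_forall fun x => (hx x).1, ?_⟩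
  refine Integrable.mono' (integrable_const C) hm.norm.integral_prod_right' ?_
  refine Eventually.of_forall fun x => ?_
  rw [Real.norm_of_nonneg (integral_nonneg fun z => norm_nonneg _)]
  exact (hx x).2

theorem integral_mul_radialPot_add (hη : IsCutoff L ρ η) (hρ1 : 2 * ρ < 1)
    {μ ν : Measure Plane} [IsFiniteMeasure μ] [IsFiniteMeasure ν] {q C q' C' : ℝ}
    (hμ : Tame μ q C) (hν : Tame ν q' C') :
    (∫ x, η x * radialPot ν 0 x ∂μ) + (∫ z, η z * radialPot μ 0 z ∂ν)
      = ∫ x, ∫ z, symKernel η x z ∂ν ∂μ := by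
  have h1 : ∀ (ν' : Measure Plane) x, η x * radialPot ν' 0 x = ∫ z, virialKernel η x z ∂ν' := by
    intro ν' x
    rw [radialPot, ← integral_const_mul]; rfl
  simp_rw [h1]
  have ha := integrable_prod_virialKernel (μ := μ) hη hρ1 hν
  have hb := integrable_prod_virialKernel (μ := ν) hη hρ1 hμ
  rw [integral_integral_swap (f := fun z x => virialKernel η z x) hb]
  have hb' : Integrable (fun p : Plane × Plane => virialKernel η p.2 p.1) (μ.prod ν) := hb.swap
  rw [integral_integral ha, integral_integral hb', ← integral_add ha hb', integral_prod]
  · simp_rw [virialKernel_add_swap]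
  · exact ha.add hb'

theorem integral_affine {μ : Measure Plane} [IsFiniteMeasure μ] {f : Plane → ℝ}
    (hf : Integrable f μ) (l a c : ℝ) :
    ∫ x, (l * (f x + a) + c) ∂μ
      = l * (∫ x, f x ∂μ + a * μ.real Set.univ) + c * μ.real Set.univ := by
  have h1 : Integrable (fun x => f x + a) μ := hf.add (integrable_const a)
  rw [integral_add (h1.const_mul l) (integrable_const c), integral_const_mul,
    integral_add hf (integrable_const a)]
  simp [mul_comm]

theorem abs_integral_symKernel_sub_le (hη : IsCutoff L ρ η) (hL : 1 ≤ L) (hρ : 0 < ρ) {t : ℝ}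
    (ht0 : 0 ≤ t) (ht : t ≤ ρ) {M : Set Plane} (hMm : MeasurableSet M) (hM : ∀ x ∈ M, ‖x‖ ≤ t)
    {μ ν : Measure Plane} [IsFiniteMeasure μ] [IsFiniteMeasure ν] {q C : ℝ} (hν : Tame ν q C) :
    |(∫ x, ∫ z, symKernel η x z ∂ν ∂μ) - μ.real M * ν.real M|
      ≤ L * (μ.real (ball (0 : Plane) (4 * ρ) \ M) * ν.real Set.univ
        + μ.real Set.univ * ν.real (ball (0 : Plane) (4 * ρ) \ M))
        + t / (3 * ρ) * (μ.real Set.univ * ν.real Set.univ) := by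
  set E := ball (0 : Plane) (4 * ρ) \ M with hE
  have hEm : MeasurableSet E := measurableSet_ball.diff hMm
  have hS := measurable_symKernel (η := η) hη.contDiff.continuous
  have hSx : ∀ x, Integrable (fun z => symKernel η x z) ν := fun x =>
    Integrable.mono' (integrable_const L) (hS.comp measurable_prodMk_left).aestronglyMeasurable
      (Eventually.of_forall fun z => hη.abs_symKernel_le hL x z)
  have hind : ∀ (κ : Measure Plane) [IsFiniteMeasure κ] (s : Set Plane), MeasurableSet s →
      Integrable (s.indicator fun _ => (1 : ℝ)) κ := fun κ _ s hs =>
    (integrable_const 1).indicator hs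
  have hindI : ∀ (κ : Measure Plane) [IsFiniteMeasure κ] (s : Set Plane), MeasurableSet s →
      ∫ x, s.indicator (fun _ => (1 : ℝ)) x ∂κ = κ.real s := fun κ _ s hs => by
    rw [integral_indicator hs]; simp
  have hSS : Integrable (fun x => ∫ z, symKernel η x z ∂ν) μ := by
    refine Integrable.mono' (integrable_const (L * ν.real Set.univ))
      hS.stronglyMeasurable.integral_prod_right'.aestronglyMeasurable
      (Eventually.of_forall fun x => ?_)
    exact norm_integral_le_of_norm_le_const (Eventually.of_forall fun z =>
      hη.abs_symKernel_le hL x z)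
  have h1 : μ.real M * ν.real M
      = ∫ x, M.indicator (fun _ => (1 : ℝ)) x * ν.real M ∂μ := by
    rw [integral_mul_const, hindI μ M hMm]
  rw [h1, ← integral_sub hSS ((hind μ M hMm).mul_const _)]
  have h2 : ∀ x, |(∫ z, symKernel η x z ∂ν) - M.indicator (fun _ => (1 : ℝ)) x * ν.real M|
      ≤ L * (E.indicator (fun _ => (1 : ℝ)) x * ν.real Set.univ + ν.real E)
        + t / (3 * ρ) * ν.real Set.univ := by
    intro x
    rw [← hindI ν M hMm, ← integral_const_mul, ← integral_sub (hSx x) ((hind ν M hMm).const_mul _)]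
    refine abs_integral_le_integral_abs.trans ?_
    have hi : Integrable (fun z => L * (E.indicator (fun _ => (1 : ℝ)) x
        + E.indicator (fun _ => (1 : ℝ)) z) + t / (3 * ρ)) ν :=
      (((integrable_const _).add (hind ν E hEm)).const_mul L).add (integrable_const _)
    refine (integral_mono_ae ((hSx x).sub ((hind ν M hMm).const_mul _)).abs hi ?_).trans ?_
    · filter_upwards [hν.sub_ne_zero x] with z hz
      exact hη.abs_symKernel_sub_le hL hρ ht0 ht hM hz
    · simp_rw [add_comm (E.indicator (fun _ => (1 : ℝ)) x)]
      rw [integral_affine (hind ν E hEm), hindI ν E hEm]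
      exact le_of_eq (by ring)
  refine abs_integral_le_integral_abs.trans ?_
  have hi2 : Integrable (fun x => L * (E.indicator (fun _ => (1 : ℝ)) x * ν.real Set.univ
      + ν.real E) + t / (3 * ρ) * ν.real Set.univ) μ :=
    ((((hind μ E hEm).mul_const _).add (integrable_const _)).const_mul L).add (integrable_const _)
  refine (integral_mono (hSS.sub ((hind μ M hMm).mul_const _)).abs hi2 h2).trans ?_
  rw [integral_affine ((hind μ E hEm).mul_const _), integral_mul_const, hindI μ E hEm]
  exact le_of_eq (by ring)

end

/-! ### The approximate Pohozaev identity for the masses. -/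

section

/-- The symmetrising weights of the coefficient matrix. -/
def wt : Fin 3 → ℝ := ![1, 1, 2]

theorem wt_mul_A_comm (i j : Fin 3) : wt i * A i j = wt j * A j i := by
  fin_cases i <;> fin_cases j <;> norm_num [wt, A]

theorem abs_wt_mul_A_le (i j : Fin 3) : |wt i * A i j / (2 * Real.pi)| ≤ 1 := by
  have h1 : |wt i * A i j| ≤ 2 := by
    fin_cases i <;> fin_cases j <;> norm_num [wt, A]
  rw [abs_div, abs_of_pos Real.two_pi_pos, div_le_one Real.two_pi_pos]
  linarith [Real.pi_gt_three]

theorem wt_pos (i : Fin 3) : 0 < wt i := by fin_cases i <;> norm_num [wt]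

/-- The virial inequality for one component, tested with all cutoff functions near the origin. -/
def VirialComponent (γ : Fin 3 → ℝ) (ν : Fin 3 → Measure Plane) (H : ℝ) : Prop :=
  ∀ (i : Fin 3) (η : Plane → ℝ) (δ : ℝ), ContDiff ℝ 1 η → δ < 1 / 4 → tsupport η ⊆ closedBall 0 δ →
    |∫ x, ((2 + 2 * γ i) * η x + fderiv ℝ η x x
      - η x * ∑ j, A i j / (2 * Real.pi) * radialPot (ν j) 0 x) ∂(ν i)| ≤ H * δ * ∫ x, |η x| ∂(ν i)

variable {L ρ : ℝ} {η : Plane → ℝ}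

theorem integrable_mul_radialPot (hη : IsCutoff L ρ η) (hρ1 : 2 * ρ < 1)
    {μ ν : Measure Plane} [IsFiniteMeasure μ] [IsFiniteMeasure ν] {q C : ℝ} (hν : Tame ν q C) :
    Integrable (fun x => η x * radialPot ν 0 x) μ := by
  have h1 : ∀ x, η x * radialPot ν 0 x = ∫ z, virialKernel η x z ∂ν := by
    intro x
    rw [radialPot, ← integral_const_mul]; rfl
  simp_rw [h1]
  exact (integrable_prod_virialKernel (μ := μ) hη hρ1 hν).integral_prod_left

theorem integrable_radial_cutoff (hη : IsCutoff L ρ η) {μ : Measure Plane} [IsFiniteMeasure μ]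
    (c : ℝ) : Integrable (fun x => c * η x + fderiv ℝ η x x) μ := by
  have h1 : Continuous fun x => fderiv ℝ η x x :=
    (hη.contDiff.continuous_fderiv one_ne_zero).clm_apply continuous_id
  refine Integrable.mono' (integrable_const (|c| + L))
    ((continuous_const.mul hη.contDiff.continuous).add h1).aestronglyMeasurable
    (Eventually.of_forall fun x => ?_)
  refine (norm_add_le _ _).trans (add_le_add ?_ (hη.radial_le x))
  rw [norm_mul, Real.norm_of_nonneg (hη.nonneg x)]
  exact mul_le_of_le_one_right (abs_nonneg _) (hη.le_one x)

theorem abs_integral_radial_cutoff_sub_le (hη : IsCutoff L ρ η) (hL : 1 ≤ L) (hρ : 0 < ρ)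
    {M : Set Plane} (hMm : MeasurableSet M) (hM : ∀ x ∈ M, ‖x‖ < ρ) {μ : Measure Plane}
    [IsFiniteMeasure μ] (c : ℝ) :
    |(∫ x, (c * η x + fderiv ℝ η x x) ∂μ) - c * μ.real M|
      ≤ (|c| + L) * μ.real (ball (0 : Plane) (4 * ρ) \ M) := by
  set E := ball (0 : Plane) (4 * ρ) \ M with hE
  have hEm : MeasurableSet E := measurableSet_ball.diff hMm
  have h1 : c * μ.real M = ∫ x, c * M.indicator (fun _ => (1 : ℝ)) x ∂μ := by
    rw [integral_const_mul, integral_indicator hMm]; simp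
  have h2 : (|c| + L) * μ.real E = ∫ x, (|c| + L) * E.indicator (fun _ => (1 : ℝ)) x ∂μ := by
    rw [integral_const_mul, integral_indicator hEm]; simp
  have hi : Integrable (fun x => c * M.indicator (fun _ => (1 : ℝ)) x) μ :=
    ((integrable_const (1 : ℝ)).indicator hMm).const_mul c
  rw [h1, h2, ← integral_sub (integrable_radial_cutoff hη c) hi]
  refine abs_integral_le_integral_abs.trans (integral_mono
    ((integrable_radial_cutoff hη c).sub hi).abs
    (((integrable_const (1 : ℝ)).indicator hEm).const_mul _) fun x => ?_)
  simp only
  by_cases hxM : x ∈ M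
  · have hxE : x ∉ E := fun h => h.2 hxM
    rw [Set.indicator_of_mem hxM, Set.indicator_of_notMem hxE, hη.eq_one x (hM x hxM).le,
      hη.radial_eq_zero x (hM x hxM)]
    simp
  by_cases hxE : x ∈ E
  · rw [Set.indicator_of_mem hxE, Set.indicator_of_notMem hxM, mul_zero, sub_zero, mul_one]
    refine (abs_add_le _ _).trans (add_le_add ?_ (hη.radial_le x))
    rw [abs_mul, abs_of_nonneg (hη.nonneg x)]
    exact mul_le_of_le_one_right (abs_nonneg _) (hη.le_one x)
  · have : 4 * ρ ≤ ‖x‖ := by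
      by_contra h
      exact hxE ⟨by rw [mem_ball_zero_iff]; exact not_le.1 h, hxM⟩
    rw [Set.indicator_of_notMem hxE, Set.indicator_of_notMem hxM, hη.eq_zero x (by linarith),
      hη.radial_eq_zero' x (by linarith)]
    simp

/-- Approximate Pohozaev identity for the masses of a set near the origin. -/
theorem exists_virial_bound (γ : Fin 3 → ℝ) {H M₀ : ℝ} (hH : 0 ≤ H) (hM₀ : 0 ≤ M₀) :
    ∃ K : ℝ, 0 ≤ K ∧ ∀ (ν : Fin 3 → Measure Plane) (_ : ∀ i, IsFiniteMeasure (ν i))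
      (q C : Fin 3 → ℝ), (∀ i, Tame (ν i) (q i) (C i)) → (∀ i, (ν i).real Set.univ ≤ M₀) →
      VirialComponent γ ν H → ∀ (M : Set Plane) (ρ t τ : ℝ), MeasurableSet M → 0 < ρ → ρ < 1 / 8 →
      0 ≤ t → t < ρ → (∀ x ∈ M, ‖x‖ ≤ t) →
      (∀ i, (ν i).real (ball (0 : Plane) (4 * ρ) \ M) ≤ τ) →
      |∑ i, wt i * ((2 + 2 * γ i) * (ν i).real M)
        - 1 / 2 * ∑ i, ∑ j, wt i * A i j / (2 * Real.pi) * ((ν i).real M * (ν j).real M)|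
        ≤ K * (τ + ρ + t / ρ) := by
  obtain ⟨L, hL, hcut⟩ := exists_isCutoff
  have hL0 : 0 ≤ L := by linarith
  refine ⟨∑ i, wt i * (2 * H * M₀ + (|2 + 2 * γ i| + L)) + 1 / 2 * ∑ _i : Fin 3, ∑ _j : Fin 3,
    (2 * L * M₀ + M₀ ^ 2), ?_, ?_⟩
  · have := fun i => (wt_pos i).le
    refine add_nonneg (Finset.sum_nonneg fun i _ => mul_nonneg (this i) (by positivity)) ?_
    positivity
  intro ν hfin q C hν hM0 hvir M ρ t τ hMm hρ hρ8 ht0 htρ hM hτ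
  obtain ⟨η, hη⟩ := hcut ρ hρ
  have hτ0 : 0 ≤ τ := measureReal_nonneg.trans (hτ 0)
  have hρ1 : 2 * ρ < 1 := by linarith
  set s : Fin 3 → Fin 3 → ℝ := fun i j => wt i * A i j / (2 * Real.pi) with hs
  have hss : ∀ i j, s i j = s j i := fun i j => by simp only [hs, wt_mul_A_comm i j]
  set a : Fin 3 → ℝ := fun i => ∫ x, ((2 + 2 * γ i) * η x + fderiv ℝ η x x) ∂(ν i) with ha
  set I : Fin 3 → Fin 3 → ℝ := fun i j => ∫ x, η x * radialPot (ν j) 0 x ∂(ν i) with hI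
  set J : Fin 3 → Fin 3 → ℝ := fun i j => ∫ x, ∫ z, symKernel η x z ∂(ν j) ∂(ν i) with hJ
  have hIJ : ∀ i j, I i j + I j i = J i j := fun i j =>
    integral_mul_radialPot_add hη hρ1 (hν i) (hν j)
  have h1 : ∀ i, |a i - ∑ j, A i j / (2 * Real.pi) * I i j| ≤ 2 * H * M₀ * ρ := by
    intro i
    have h2 := hvir i η (2 * ρ) hη.contDiff (by linarith) hη.tsupport_subset
    have h3 : ∫ x, ((2 + 2 * γ i) * η x + fderiv ℝ η x x
        - η x * ∑ j, A i j / (2 * Real.pi) * radialPot (ν j) 0 x) ∂(ν i)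
        = a i - ∑ j, A i j / (2 * Real.pi) * I i j := by
      have hint : ∀ j, Integrable (fun x => A i j / (2 * Real.pi) * (η x * radialPot (ν j) 0 x))
          (ν i) := fun j => (integrable_mul_radialPot hη hρ1 (hν j)).const_mul _
      have h4 : ∀ x, η x * ∑ j, A i j / (2 * Real.pi) * radialPot (ν j) 0 x
          = ∑ j, A i j / (2 * Real.pi) * (η x * radialPot (ν j) 0 x) := fun x => by
        rw [Finset.mul_sum]; exact Finset.sum_congr rfl fun j _ => by ring
      simp_rw [h4]
      rw [integral_sub (integrable_radial_cutoff hη _) (integrable_finsetSum _ fun j _ => hint j),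
        integral_finsetSum _ fun j _ => hint j]
      simp_rw [integral_const_mul]
      rfl
    rw [h3] at h2
    have h5 : ∫ x, |η x| ∂(ν i) ≤ M₀ := by
      refine le_trans ?_ (hM0 i)
      have h6 : ∫ x, |η x| ∂(ν i) ≤ ∫ _x, (1 : ℝ) ∂(ν i) := by
        refine integral_mono_of_nonneg (Eventually.of_forall fun _ => abs_nonneg _)
          (integrable_const _) (Eventually.of_forall fun x => ?_)
        simp only
        rw [abs_of_nonneg (hη.nonneg x)]; exact hη.le_one x
      simpa using h6
    calc _ ≤ H * (2 * ρ) * ∫ x, |η x| ∂(ν i) := h2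
      _ ≤ H * (2 * ρ) * M₀ := by gcongr
      _ = _ := by ring
  have h2 : ∀ i, |a i - (2 + 2 * γ i) * (ν i).real M| ≤ (|2 + 2 * γ i| + L) * τ := by
    intro i
    refine (abs_integral_radial_cutoff_sub_le hη hL hρ hMm
      (fun x hx => (hM x hx).trans_lt htρ) _).trans ?_
    exact mul_le_mul_of_nonneg_left (hτ i) (by positivity)
  have h3 : ∀ i j, |J i j - (ν i).real M * (ν j).real M|
      ≤ 2 * L * M₀ * τ + M₀ ^ 2 * (t / ρ) := by
    intro i j
    refine (abs_integral_symKernel_sub_le hη hL hρ ht0 htρ.le hMm hM (hν j)).trans ?_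
    have e1 : (ν i).real (ball (0 : Plane) (4 * ρ) \ M) * (ν j).real Set.univ ≤ τ * M₀ :=
      mul_le_mul (hτ i) (hM0 j) measureReal_nonneg hτ0
    have e2 : (ν i).real Set.univ * (ν j).real (ball (0 : Plane) (4 * ρ) \ M) ≤ M₀ * τ :=
      mul_le_mul (hM0 i) (hτ j) measureReal_nonneg hM₀
    have e3 : (ν i).real Set.univ * (ν j).real Set.univ ≤ M₀ * M₀ :=
      mul_le_mul (hM0 i) (hM0 j) measureReal_nonneg hM₀
    have e4 : t / (3 * ρ) ≤ t / ρ := by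
      apply div_le_div_of_nonneg_left ht0 hρ; linarith
    calc _ ≤ L * (τ * M₀ + M₀ * τ) + t / ρ * (M₀ * M₀) := by gcongr
      _ = _ := by ring
  -- Symmetry of s allows I i j to be averaged with I j i, and their sum is the symmetrised integral
  -- J i j. This is where the factor 1/2 comes from.
  have h4 : ∑ i, wt i * ∑ j, A i j / (2 * Real.pi) * I i j = 1 / 2 * ∑ i, ∑ j, s i j * J i j := by
    have e1 : ∑ i, wt i * ∑ j, A i j / (2 * Real.pi) * I i j = ∑ i, ∑ j, s i j * I i j := by
      refine Finset.sum_congr rfl fun i _ => ?_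
      rw [Finset.mul_sum]
      refine Finset.sum_congr rfl fun j _ => ?_
      simp only [hs]; ring
    have e2 : ∑ i, ∑ j, s i j * I j i = ∑ i, ∑ j, s i j * I i j := by
      rw [Finset.sum_comm]
      refine Finset.sum_congr rfl fun i _ => Finset.sum_congr rfl fun j _ => ?_
      rw [hss]
    have e3 : ∑ i, ∑ j, s i j * J i j = ∑ i, ∑ j, s i j * I i j + ∑ i, ∑ j, s i j * I j i := by
      rw [← Finset.sum_add_distrib]
      refine Finset.sum_congr rfl fun i _ => ?_
      rw [← Finset.sum_add_distrib]
      refine Finset.sum_congr rfl fun j _ => ?_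
      rw [← hIJ]; ring
    rw [e1, e3, e2]; ring
  -- The three errors: replacing the cutoff by the indicator of M, the harmonic part, and replacing
  -- the symmetrised kernel by 1 on M × M.
  have h5 : ∑ i, wt i * ((2 + 2 * γ i) * (ν i).real M)
        - 1 / 2 * ∑ i, ∑ j, s i j * ((ν i).real M * (ν j).real M)
      = ∑ i, wt i * (((2 + 2 * γ i) * (ν i).real M - a i)
          + (a i - ∑ j, A i j / (2 * Real.pi) * I i j))
        + 1 / 2 * ∑ i, ∑ j, s i j * (J i j - (ν i).real M * (ν j).real M) := by
    simp only [mul_add, mul_sub, Finset.sum_add_distrib, Finset.sum_sub_distrib]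
    rw [h4]; ring
  rw [h5]
  have h6 : |∑ i, wt i * (((2 + 2 * γ i) * (ν i).real M - a i)
          + (a i - ∑ j, A i j / (2 * Real.pi) * I i j))|
      ≤ ∑ i, wt i * (2 * H * M₀ + (|2 + 2 * γ i| + L)) * (τ + ρ + t / ρ) := by
    refine (Finset.abs_sum_le_sum_abs _ _).trans (Finset.sum_le_sum fun i _ => ?_)
    rw [abs_mul, abs_of_pos (wt_pos i), mul_assoc]
    refine mul_le_mul_of_nonneg_left ((abs_add_le _ _).trans ?_) (wt_pos i).le
    have e1 := h1 i
    have e2 := h2 i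
    rw [abs_sub_comm] at e2
    have e3 : 0 ≤ t / ρ := by positivity
    have e4 : 0 ≤ |2 + 2 * γ i| + L := by positivity
    have e5 : 0 ≤ 2 * H * M₀ := by positivity
    nlinarith [mul_nonneg e4 hρ.le, mul_nonneg e4 e3, mul_nonneg e5 hτ0, mul_nonneg e5 e3]
  have h7 : |∑ i, ∑ j, s i j * (J i j - (ν i).real M * (ν j).real M)|
      ≤ ∑ _i : Fin 3, ∑ _j : Fin 3, (2 * L * M₀ + M₀ ^ 2) * (τ + ρ + t / ρ) := by
    refine (Finset.abs_sum_le_sum_abs _ _).trans (Finset.sum_le_sum fun i _ => ?_)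
    refine (Finset.abs_sum_le_sum_abs _ _).trans (Finset.sum_le_sum fun j _ => ?_)
    rw [abs_mul]
    have e0 : 0 ≤ t / ρ := by positivity
    have e1 : 0 ≤ 2 * L * M₀ := by positivity
    have e2 : 0 ≤ M₀ ^ 2 := by positivity
    calc _ ≤ 1 * (2 * L * M₀ * τ + M₀ ^ 2 * (t / ρ)) :=
          mul_le_mul (abs_wt_mul_A_le i j) (h3 i j) (abs_nonneg _) zero_le_one
      _ ≤ _ := by
          nlinarith [mul_nonneg e1 hρ.le, mul_nonneg e1 e0, mul_nonneg e2 hρ.le,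
            mul_nonneg e2 hτ0]
  refine (abs_add_le _ _).trans ?_
  rw [add_mul, Finset.sum_mul]
  refine add_le_add h6 ?_
  rw [abs_mul, abs_of_pos (by norm_num : (0 : ℝ) < 1 / 2), mul_assoc]
  refine mul_le_mul_of_nonneg_left (h7.trans_eq ?_) (by norm_num)
  simp_rw [Finset.sum_mul]

end

/-! ### Measures with density on the disc and tameness. -/

section

/-- The measure with density `e` on the unit disc. -/
def discMeasure (e : Plane → ℝ) : Measure Plane :=
  (volume.restrict (ball (0 : Plane) 1)).withDensity fun z => ENNReal.ofReal (e z)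

section discMeasure

variable {e : Plane → ℝ}

theorem integral_discMeasure (hm : AEMeasurable e (volume.restrict (ball (0 : Plane) 1)))
    (h0 : ∀ z, 0 ≤ e z) (f : Plane → ℝ) :
    ∫ z, f z ∂(discMeasure e) = ∫ z in ball (0 : Plane) 1, e z * f z := by
  rw [discMeasure, integral_withDensity_eq_integral_toReal_smul₀ hm.ennreal_ofReal
    (Eventually.of_forall fun _ => ENNReal.ofReal_lt_top)]
  refine integral_congr_ae (Eventually.of_forall fun z => ?_)
  simp [ENNReal.toReal_ofReal (h0 z)]

theorem integrable_discMeasure_iff (hm : AEMeasurable e (volume.restrict (ball (0 : Plane) 1)))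
    (h0 : ∀ z, 0 ≤ e z) {f : Plane → ℝ} :
    Integrable f (discMeasure e) ↔ IntegrableOn (fun z => e z * f z) (ball (0 : Plane) 1) := by
  rw [discMeasure, integrable_withDensity_iff_integrable_smul₀' hm.ennreal_ofReal
    (Eventually.of_forall fun _ => ENNReal.ofReal_lt_top), IntegrableOn]
  refine integrable_congr (Eventually.of_forall fun z => ?_)
  simp [ENNReal.toReal_ofReal (h0 z)]

theorem isFiniteMeasure_discMeasure (he : IntegrableOn e (ball (0 : Plane) 1)) :
    IsFiniteMeasure (discMeasure e) :=
  isFiniteMeasure_withDensity_ofReal he.2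

theorem discMeasure_ac (e : Plane → ℝ) : discMeasure e ≪ volume :=
  (withDensity_absolutelyContinuous _ _).trans Measure.absolutelyContinuous_restrict

theorem ae_mem_ball_discMeasure (e : Plane → ℝ) :
    ∀ᵐ z ∂(discMeasure e), z ∈ ball (0 : Plane) 1 :=
  (withDensity_absolutelyContinuous _ _).ae_le (ae_restrict_mem measurableSet_ball)

theorem discMeasure_real (hm : AEMeasurable e (volume.restrict (ball (0 : Plane) 1)))
    (h0 : ∀ z, 0 ≤ e z) {M : Set Plane} (hM : MeasurableSet M) :
    (discMeasure e).real M = ∫ z in ball (0 : Plane) 1 ∩ M, e z := by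
  have h1 : (discMeasure e).real M = ∫ z, M.indicator (fun _ => (1 : ℝ)) z ∂(discMeasure e) := by
    rw [integral_indicator hM]; simp
  rw [h1, integral_discMeasure hm h0, ← setIntegral_indicator hM]
  refine integral_congr_ae (Eventually.of_forall fun z => ?_)
  by_cases hz : z ∈ M <;> simp [hz]

/-- Both exponents are nonpositive, so the product is at most the power -(a + q) of the smaller of s
and t. -/
theorem rpow_mul_rpow_le {a q s t : ℝ} (ha : 0 ≤ a) (hq : 0 ≤ q) (hs : 0 < s) (ht : 0 < t) :
    s ^ (-a) * t ^ (-q) ≤ s ^ (-(a + q)) + t ^ (-(a + q)) := by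
  rcases le_total s t with h | h
  · have h1 : t ^ (-q) ≤ s ^ (-q) := Real.rpow_le_rpow_of_nonpos hs h (by linarith)
    have h2 : s ^ (-a) * s ^ (-q) = s ^ (-(a + q)) := by rw [← Real.rpow_add hs]; congr 1; ring
    have h3 : 0 ≤ t ^ (-(a + q)) := by positivity
    have := mul_le_mul_of_nonneg_left h1 (by positivity : 0 ≤ s ^ (-a))
    linarith
  · have h1 : s ^ (-a) ≤ t ^ (-a) := Real.rpow_le_rpow_of_nonpos ht h (by linarith)
    have h2 : t ^ (-a) * t ^ (-q) = t ^ (-(a + q)) := by rw [← Real.rpow_add ht]; congr 1; ring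
    have h3 : 0 ≤ s ^ (-(a + q)) := by positivity
    have := mul_le_mul_of_nonneg_right h1 (by positivity : 0 ≤ t ^ (-q))
    linarith

theorem ae_ne (x : Plane) : ∀ᵐ z : Plane, z ≠ x := by rw [ae_iff]; simp

theorem setIntegral_norm_sub_rpow_le {p : ℝ} (hp : p < 2) {x : Plane}
    (hx : x ∈ closedBall (0 : Plane) 1) :
    IntegrableOn (fun z => ‖x - z‖ ^ (-p)) (ball (0 : Plane) 1) ∧
      ∫ z in ball (0 : Plane) 1, ‖x - z‖ ^ (-p) ≤ ∫ z in ball (0 : Plane) 2, ‖z‖ ^ (-p) := by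
  have hsub : ball (0 : Plane) 1 ⊆ ball x 2 := by
    intro z hz
    rw [mem_closedBall_zero_iff] at hx
    rw [mem_ball_zero_iff] at hz
    rw [mem_ball, dist_eq_norm]
    linarith [norm_sub_le z x]
  have h1 := integrableOn_norm_sub_rpow_ball hp x 2
  refine ⟨h1.mono_set hsub, ?_⟩
  rw [← setIntegral_norm_sub_ball (fun y => y ^ (-p)) x 2]
  exact setIntegral_mono_set h1 (Eventually.of_forall fun z => by positivity)
    (Eventually.of_forall hsub)

/-- A singularity |z|^{-a} with a < 2 leaves room for a further power q with a + q < 2. For the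
Newtonian field the disc is split at the ball of radius |x|/2 around x. Inside, |z| is at least
|x|/2 and only 1/|x - z| is singular. Outside, 1/|x - z| ≤ 2/|x|. -/
theorem tame_discMeasure (hm : AEMeasurable e (volume.restrict (ball (0 : Plane) 1)))
    (h0 : ∀ z, 0 ≤ e z) {a K : ℝ} (ha : 0 ≤ a) (ha2 : a < 2) (hK : 0 ≤ K)
    (he : ∀ z ∈ ball (0 : Plane) 1, z ≠ 0 → e z ≤ K * ‖z‖ ^ (-a)) :
    ∃ q C, Tame (discMeasure e) q C := by
  set q : ℝ := (2 - a) / 2 with hq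
  have hq0 : 0 < q := by rw [hq]; linarith
  have hq1 : q ≤ 1 := by rw [hq]; linarith
  have hp : a + q < 2 := by rw [hq]; linarith
  set C1 : ℝ := K * ((∫ z in ball (0 : Plane) 2, ‖z‖ ^ (-(a + q)))
    + ∫ z in ball (0 : Plane) 2, ‖z‖ ^ (-(a + q))) with hC1
  set Ia : ℝ := ∫ z in ball (0 : Plane) 1, ‖z‖ ^ (-a) with hIa
  set C2 : ℝ := K * (2 * Ia + 4 * Real.pi) with hC2
  have hae : ∀ᵐ z ∂(volume.restrict (ball (0 : Plane) 1)), z ∈ ball (0 : Plane) 1 ∧ z ≠ 0 :=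
    (ae_restrict_mem measurableSet_ball).and (ae_restrict_of_ae (ae_ne 0))
  have hriesz : ∀ x ∈ closedBall (0 : Plane) 1,
      IntegrableOn (fun z => e z * ‖x - z‖ ^ (-q)) (ball (0 : Plane) 1) ∧
      ∫ z in ball (0 : Plane) 1, e z * ‖x - z‖ ^ (-q) ≤ C1 := by
    intro x hx
    obtain ⟨i1, b1⟩ := setIntegral_norm_sub_rpow_le hp hx
    obtain ⟨i2, b2⟩ := setIntegral_norm_sub_rpow_le hp (x := 0) (by simp)
    simp only [zero_sub, norm_neg] at i2 b2
    have hbd : ∀ᵐ z ∂(volume.restrict (ball (0 : Plane) 1)), e z * ‖x - z‖ ^ (-q)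
        ≤ K * (‖z‖ ^ (-(a + q)) + ‖x - z‖ ^ (-(a + q))) := by
      filter_upwards [hae, ae_restrict_of_ae (ae_ne x)] with z hz hzx
      have hz0 : 0 < ‖z‖ := norm_pos_iff.2 hz.2
      have hx0 : 0 < ‖x - z‖ := norm_pos_iff.2 (sub_ne_zero.2 (Ne.symm hzx))
      calc _ ≤ K * ‖z‖ ^ (-a) * ‖x - z‖ ^ (-q) :=
            mul_le_mul_of_nonneg_right (he z hz.1 hz.2) (by positivity)
        _ ≤ _ := by
            rw [mul_assoc]
            exact mul_le_mul_of_nonneg_left (rpow_mul_rpow_le ha hq0.le hz0 hx0) hK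
    have hi : IntegrableOn (fun z => K * (‖z‖ ^ (-(a + q)) + ‖x - z‖ ^ (-(a + q))))
        (ball (0 : Plane) 1) := (i2.add i1).const_mul K
    have hI : IntegrableOn (fun z => e z * ‖x - z‖ ^ (-q)) (ball (0 : Plane) 1) := by
      refine Integrable.mono' hi (hm.mul (by fun_prop)).aestronglyMeasurable ?_
      filter_upwards [hbd] with z hz
      rwa [Real.norm_of_nonneg (mul_nonneg (h0 z) (by positivity))]
    refine ⟨hI, (integral_mono_ae hI hi hbd).trans ?_⟩
    rw [integral_const_mul, integral_add i2 i1, hC1]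
    gcongr
  have hnewton : ∀ x ∈ ball (0 : Plane) 1, x ≠ 0 →
      IntegrableOn (fun z => e z * ‖x - z‖⁻¹) (ball (0 : Plane) 1) ∧
      ‖x‖ * ∫ z in ball (0 : Plane) 1, e z * ‖x - z‖⁻¹ ≤ C2 := by
    intro x hx hx0
    have hxn : 0 < ‖x‖ := norm_pos_iff.2 hx0
    have hx1 : ‖x‖ < 1 := by simpa using hx
    set B := ball x (‖x‖ / 2) with hB
    have hbd : ∀ᵐ z ∂(volume.restrict (ball (0 : Plane) 1)), e z * ‖x - z‖⁻¹
        ≤ K * (2 / ‖x‖ * ‖z‖ ^ (-a)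
          + (‖x‖ / 2) ^ (-a) * B.indicator (fun z => ‖x - z‖⁻¹) z) := by
      filter_upwards [hae] with z hz
      have hz0 : 0 < ‖z‖ := norm_pos_iff.2 hz.2
      have h1 := mul_le_mul_of_nonneg_right (he z hz.1 hz.2) (inv_nonneg.2 (norm_nonneg (x - z)))
      refine h1.trans ?_
      rw [mul_assoc]
      refine mul_le_mul_of_nonneg_left ?_ hK
      by_cases hzB : z ∈ B
      · rw [Set.indicator_of_mem hzB]
        have h2 : ‖x‖ / 2 ≤ ‖z‖ := by
          rw [hB, mem_ball, dist_eq_norm] at hzB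
          have := norm_sub_norm_le x z
          rw [norm_sub_rev] at this
          linarith
        have h3 : ‖z‖ ^ (-a) ≤ (‖x‖ / 2) ^ (-a) :=
          Real.rpow_le_rpow_of_nonpos (by positivity) h2 (by linarith)
        have h4 := mul_le_mul_of_nonneg_right h3 (inv_nonneg.2 (norm_nonneg (x - z)))
        have h5 : 0 ≤ 2 / ‖x‖ * ‖z‖ ^ (-a) := by positivity
        linarith
      · rw [Set.indicator_of_notMem hzB, mul_zero, add_zero, mul_comm]
        refine mul_le_mul_of_nonneg_right ?_ (by positivity)
        rw [hB, mem_ball, dist_comm, dist_eq_norm, not_lt] at hzB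
        rw [show 2 / ‖x‖ = (‖x‖ / 2)⁻¹ by rw [inv_div]]
        exact inv_anti₀ (by positivity) hzB
    have ia : IntegrableOn (fun z : Plane => ‖z‖ ^ (-a)) (ball (0 : Plane) 1) :=
      integrableOn_norm_rpow_ball ha2 1
    have ib : Integrable (B.indicator fun z => ‖x - z‖⁻¹) := by
      rw [integrable_indicator_iff measurableSet_ball]
      have := integrableOn_norm_sub_rpow_ball (s := 1) (by norm_num) x (‖x‖ / 2)
      simpa [Real.rpow_neg_one] using this
    have hi : IntegrableOn (fun z => K * (2 / ‖x‖ * ‖z‖ ^ (-a)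
          + (‖x‖ / 2) ^ (-a) * B.indicator (fun z => ‖x - z‖⁻¹) z)) (ball (0 : Plane) 1) :=
      ((ia.const_mul _).add (ib.integrableOn.const_mul _)).const_mul K
    have hI : IntegrableOn (fun z => e z * ‖x - z‖⁻¹) (ball (0 : Plane) 1) := by
      refine Integrable.mono' hi (hm.mul (by fun_prop)).aestronglyMeasurable ?_
      filter_upwards [hbd] with z hz
      rwa [Real.norm_of_nonneg (mul_nonneg (h0 z) (by positivity))]
    refine ⟨hI, ?_⟩
    have h1 := integral_mono_ae hI hi hbd
    rw [integral_const_mul, integral_add (ia.const_mul _) (ib.integrableOn.const_mul _),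
      integral_const_mul, integral_const_mul] at h1
    have h2 : ∫ z in ball (0 : Plane) 1, B.indicator (fun z => ‖x - z‖⁻¹) z
        ≤ Real.pi * ‖x‖ := by
      refine (setIntegral_le_integral ib (Eventually.of_forall fun z =>
        Set.indicator_nonneg (fun _ _ => by positivity) z)).trans ?_
      rw [integral_indicator measurableSet_ball, setIntegral_norm_sub_ball (fun y => y⁻¹),
        setIntegral_norm_inv_ball (by positivity)]
      exact le_of_eq (by ring)
    -- One factor ‖x‖ comes from the statement and one from the integral of 1/|x - z| over the small
    -- ball. Their product absorbs the power -a because a < 2 and ‖x‖ < 1.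
    have h3 : (‖x‖ / 2) ^ (-a) * ‖x‖ ^ 2 ≤ 4 := by
      have e1 : (‖x‖ / 2) ^ (-a) * ‖x‖ ^ 2 = 4 * (‖x‖ / 2) ^ (2 - a) := by
        rw [show 2 - a = -a + 2 by ring, Real.rpow_add (by positivity), Real.rpow_two]; ring
      rw [e1]
      have := Real.rpow_le_one (by positivity : 0 ≤ ‖x‖ / 2) (by linarith) (by linarith : 0 ≤ 2 - a)
      linarith
    calc _ ≤ ‖x‖ * (K * (2 / ‖x‖ * Ia + (‖x‖ / 2) ^ (-a) * (Real.pi * ‖x‖))) := by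
          refine mul_le_mul_of_nonneg_left (h1.trans ?_) hxn.le
          gcongr
      _ = K * (2 * Ia + Real.pi * ((‖x‖ / 2) ^ (-a) * ‖x‖ ^ 2)) := by field_simp
      _ ≤ C2 := by
          rw [hC2]
          have := Real.pi_pos
          refine mul_le_mul_of_nonneg_left ?_ hK
          nlinarith
  refine ⟨q, max C1 C2, hq0, hq1, discMeasure_ac e, ae_mem_ball_discMeasure e, ?_, ?_, ?_, ?_⟩
  · exact fun x hx => (integrable_discMeasure_iff hm h0).2 (hriesz x hx).1
  · intro x hx
    rw [integral_discMeasure hm h0]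
    exact (hriesz x hx).2.trans (le_max_left _ _)
  · exact fun x hx hx0 => (integrable_discMeasure_iff hm h0).2 (hnewton x hx hx0).1
  · intro x hx hx0
    rw [integral_discMeasure hm h0]
    exact (hnewton x hx hx0).2.trans (le_max_right _ _)

end discMeasure

/-- Fubini and the fundamental solution. Joint integrability follows from the bound on ∫ |log|x -
z|| dν(z), uniform over the closed disc. -/
theorem integral_pot_mul_laplacian {ν : Measure Plane} [IsFiniteMeasure ν] {q C : ℝ}
    (hν : Tame ν q C) {φ : Plane → ℝ} (hφ : ContDiff ℝ 2 φ) (hc : HasCompactSupport φ)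
    (hs : tsupport φ ⊆ ball 0 1) :
    ∫ x, pot ν x * Laplacian.laplacian φ x = 2 * Real.pi * ∫ z, φ z ∂ν := by
  have hΔ := continuous_laplacian hφ
  have hΔc := hasCompactSupport_laplacian hc
  have hm : AEStronglyMeasurable
      (fun p : Plane × Plane => Real.log ‖p.1 - p.2‖ * Laplacian.laplacian φ p.1)
      (volume.prod ν) :=
    ((Real.measurable_log.comp (by fun_prop)).mul
      (hΔ.comp continuous_fst).measurable).aestronglyMeasurable
  have hcase : ∀ x, Laplacian.laplacian φ x = 0 ∨ x ∈ closedBall (0 : Plane) 1 := by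
    intro x
    by_cases hx : Laplacian.laplacian φ x = 0
    · exact Or.inl hx
    · exact Or.inr (ball_subset_closedBall (hs (tsupport_laplacian_subset (subset_tsupport _ hx))))
  have hint : Integrable
      (fun p : Plane × Plane => Real.log ‖p.1 - p.2‖ * Laplacian.laplacian φ p.1)
      (volume.prod ν) := by
    rw [integrable_prod_iff hm]
    constructor
    · refine Eventually.of_forall fun x => ?_
      rcases hcase x with h | h
      · simp [h]
      · exact (hν.integrable_log h).mul_const (Laplacian.laplacian φ x)
    · refine Integrable.mono' ((hΔ.integrable_of_hasCompactSupport hΔc).norm.const_mul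
        (2 * ν.real Set.univ + C / q)) hm.norm.integral_prod_right'
        (Eventually.of_forall fun x => ?_)
      rw [Real.norm_of_nonneg (integral_nonneg fun z => norm_nonneg _)]
      simp_rw [norm_mul]
      rw [integral_mul_const]
      rcases hcase x with h | h
      · simp [h]
      · exact mul_le_mul_of_nonneg_right (hν.integral_abs_log_le h) (norm_nonneg _)
  simp_rw [pot, ← integral_mul_const]
  rw [integral_integral_swap hint]
  simp_rw [integral_log_mul_laplacian hφ hc]
  rw [integral_const_mul]

end

/-! ### Representation of solutions and the relation between the γ_i. -/

section

/-- The measure `e^{u_i} dx` on the unit disc. -/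
def expMeasure (u : Fin 3 → Plane → ℝ) (i : Fin 3) : Measure Plane :=
  discMeasure fun z => Real.exp (u i z)

/-- The sum of the regular part of `u_i` and of the logarithmic potentials of the densities. -/
def harmonicPart (γ : Fin 3 → ℝ) (u : Fin 3 → Plane → ℝ) (i : Fin 3) (x : Plane) : ℝ :=
  regularPart γ u i x + ∑ j, A i j / (2 * Real.pi) * pot (expMeasure u j) x

theorem eq_harmonicPart (γ : Fin 3 → ℝ) (u : Fin 3 → Plane → ℝ) (i : Fin 3) (x : Plane) :
    u i x = harmonicPart γ u i x + 2 * γ i * Real.log ‖x‖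
      - ∑ j, A i j / (2 * Real.pi) * pot (expMeasure u j) x := by
  simp only [harmonicPart, regularPart]; ring

section

variable {γ : Fin 3 → ℝ} {c : ℝ} {u : Fin 3 → Plane → ℝ}

theorem IsSolution.aemeasurable_exp (hu : IsSolution γ c u) (i : Fin 3) :
    AEMeasurable (fun z => Real.exp (u i z)) (volume.restrict (ball (0 : Plane) 1)) := by
  have h1 : AEMeasurable (regularPart γ u i) (volume.restrict (ball (0 : Plane) 1)) :=
    (((hu.continuous_regularPart i).mono ball_subset_closedBall).aestronglyMeasurable
      measurableSet_ball).aemeasurable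
  have h2 : AEMeasurable (fun z : Plane => 2 * γ i * Real.log ‖z‖)
      (volume.restrict (ball (0 : Plane) 1)) :=
    ((Real.measurable_log.comp measurable_norm).const_mul _).aemeasurable
  refine (Real.measurable_exp.comp_aemeasurable (h1.add h2)).congr
    (Eventually.of_forall fun z => ?_)
  simp [regularPart]

theorem IsSolution.exists_exp_le (hu : IsSolution γ c u) (i : Fin 3) :
    ∃ K, 0 ≤ K ∧ ∀ z ∈ ball (0 : Plane) 1, z ≠ 0 →
      Real.exp (u i z) ≤ K * ‖z‖ ^ (-(max (-(2 * γ i)) 0)) := by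
  obtain ⟨G, hG⟩ := (isCompact_closedBall (0 : Plane) 1).exists_bound_of_continuousOn
    (hu.continuous_regularPart i)
  refine ⟨Real.exp G, (Real.exp_pos _).le, fun z hz hz0 => ?_⟩
  have hz1 : 0 < ‖z‖ := norm_pos_iff.2 hz0
  have h1 : u i z = regularPart γ u i z + Real.log ‖z‖ * (2 * γ i) := by
    simp only [regularPart]; ring
  rw [h1, Real.exp_add, ← Real.rpow_def_of_pos hz1]
  refine mul_le_mul (Real.exp_le_exp.2 ?_) ?_ (by positivity) (Real.exp_pos _).le
  · exact (le_abs_self _).trans (hG z (ball_subset_closedBall hz))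
  · refine Real.rpow_le_rpow_of_exponent_ge hz1 (mem_ball_zero_iff.1 hz).le ?_
    linarith [le_max_left (-(2 * γ i)) 0]

theorem IsSolution.exists_tame (hu : IsSolution γ c u) (hγ : ∀ i, -1 < γ i) (i : Fin 3) :
    ∃ q C, Tame (expMeasure u i) q C := by
  obtain ⟨K, hK, h⟩ := hu.exists_exp_le i
  exact tame_discMeasure (hu.aemeasurable_exp i) (fun _ => (Real.exp_pos _).le)
    (le_max_right _ _) (max_lt (by linarith [hγ i]) (by norm_num)) hK h

theorem IsSolution.integrableOn_exp (hu : IsSolution γ c u) (hγ : ∀ i, -1 < γ i) (i : Fin 3) :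
    IntegrableOn (fun z => Real.exp (u i z)) (ball (0 : Plane) 1) := by
  obtain ⟨K, hK, h⟩ := hu.exists_exp_le i
  have h1 := (integrableOn_norm_rpow_ball (s := max (-(2 * γ i)) 0)
    (max_lt (by linarith [hγ i]) (by norm_num)) 1).const_mul K
  refine Integrable.mono' h1 (hu.aemeasurable_exp i).aestronglyMeasurable ?_
  filter_upwards [ae_restrict_mem measurableSet_ball, ae_restrict_of_ae (ae_ne 0)] with z hz hz0
  rw [Real.norm_of_nonneg (Real.exp_pos _).le]
  exact h z hz hz0

theorem IsSolution.isFiniteMeasure (hu : IsSolution γ c u) (hγ : ∀ i, -1 < γ i) (i : Fin 3) :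
    IsFiniteMeasure (expMeasure u i) :=
  isFiniteMeasure_discMeasure (hu.integrableOn_exp hγ i)

theorem IsSolution.expMeasure_real (hu : IsSolution γ c u) (i : Fin 3) {M : Set Plane}
    (hM : MeasurableSet M) :
    (expMeasure u i).real M = ∫ z in ball (0 : Plane) 1 ∩ M, Real.exp (u i z) :=
  discMeasure_real (hu.aemeasurable_exp i) (fun _ => (Real.exp_pos _).le) hM

theorem IsSolution.continuousOn_harmonicPart (hu : IsSolution γ c u) (hγ : ∀ i, -1 < γ i)
    (i : Fin 3) : ContinuousOn (harmonicPart γ u i) (closedBall 0 1) := by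
  refine (hu.continuous_regularPart i).add (continuousOn_finsetSum _ fun j _ => ?_)
  have := hu.isFiniteMeasure hγ j
  obtain ⟨q, C, h⟩ := hu.exists_tame hγ j
  exact h.continuousOn_pot.const_mul _

/-- The potentials have distributional Laplacian 2π e^{u_j} and cancel the nonlinear terms. Removing
2γ_i log|x| from u_i cancels the Dirac mass, since 2γ_i · 2π = 4πγ_i. -/
theorem IsSolution.weaklyHarmonic (hu : IsSolution γ c u) (hγ : ∀ i, -1 < γ i)
    (i : Fin 3) : WeaklyHarmonic (harmonicPart γ u i) := by
  intro φ hφ hc hs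
  have hφ2 := hφ.of_le two_le_infty
  have hcΔ := hasCompactSupport_laplacian hc
  have hsΔ : tsupport (Laplacian.laplacian φ) ⊆ ball 0 1 := tsupport_laplacian_subset.trans hs
  have hΔ := continuous_laplacian hφ2
  have hi1 := integrable_continuousOn_mul (hu.continuous_regularPart i) hΔ hcΔ hsΔ
  have hi2 := (integrable_log_mul 0 hΔ hcΔ).const_mul (2 * γ i)
  simp only [sub_zero] at hi2
  have hlog := integral_log_mul_laplacian hφ2 hc 0
  simp only [sub_zero] at hlog
  have hpi : ∀ j, Integrable fun x => A i j / (2 * Real.pi) *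
      (pot (expMeasure u j) x * Laplacian.laplacian φ x) := by
    intro j
    have := hu.isFiniteMeasure hγ j
    obtain ⟨q, C, h⟩ := hu.exists_tame hγ j
    exact (integrable_continuousOn_mul h.continuousOn_pot hΔ hcΔ hsΔ).const_mul _
  have hpot : ∀ j, ∫ x, A i j / (2 * Real.pi) *
      (pot (expMeasure u j) x * Laplacian.laplacian φ x)
      = A i j * ∫ x, Real.exp (u j x) * φ x := by
    intro j
    have := hu.isFiniteMeasure hγ j
    obtain ⟨q, C, h⟩ := hu.exists_tame hγ j
    rw [integral_const_mul, integral_pot_mul_laplacian h hφ2 hc hs, expMeasure,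
      integral_discMeasure (hu.aemeasurable_exp j) (fun _ => (Real.exp_pos _).le),
      setIntegral_eq_integral_of_forall_compl_eq_zero]
    · have := Real.pi_pos
      field_simp
    · intro x hx
      have : φ x = 0 := by
        by_contra hne
        exact hx (hs (subset_tsupport _ hne))
      simp [this]
  have heq := hu.equation i φ hφ hc hs
  have hu1 : ∫ x, u i x * Laplacian.laplacian φ x
      = (∫ x, regularPart γ u i x * Laplacian.laplacian φ x) + 2 * γ i * (2 * Real.pi * φ 0) := by
    rw [← hlog, ← integral_const_mul, ← integral_add hi1 hi2]
    refine integral_congr_ae (Eventually.of_forall fun x => ?_)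
    simp only [regularPart]; ring
  have hsplit : ∀ x, harmonicPart γ u i x * Laplacian.laplacian φ x
      = regularPart γ u i x * Laplacian.laplacian φ x + ∑ j, A i j / (2 * Real.pi) *
      (pot (expMeasure u j) x * Laplacian.laplacian φ x) := by
    intro x
    simp only [harmonicPart, add_mul, Finset.sum_mul, mul_assoc]
  simp_rw [hsplit]
  rw [integral_add hi1 (integrable_finsetSum _ fun j _ => hpi j),
    integral_finsetSum _ fun j _ => hpi j]
  simp_rw [hpot]
  linarith

/-- The constant of `exists_harmonic_approx` controls the virial identities of all solutions whose
harmonic part has oscillation at most `B`. -/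
theorem exists_virialComponent (γ : Fin 3 → ℝ) (hγ : ∀ i, -1 < γ i) :
    ∃ L : ℝ, 0 ≤ L ∧ ∀ (c : ℝ) (u : Fin 3 → Plane → ℝ) (B : ℝ), IsSolution γ c u →
      (∀ i, ∃ b, ∀ x ∈ closedBall (0 : Plane) 1, |harmonicPart γ u i x - b| ≤ B) →
      VirialComponent γ (expMeasure u) (L * B) := by
  obtain ⟨L, hL, happ⟩ := exists_harmonic_approx
  refine ⟨L, hL, fun c u B hu hB i η δ hη hδ hs => ?_⟩
  obtain ⟨b, hb⟩ := hB i
  obtain ⟨g, hg1, hg2, hg3, hg4⟩ := happ _ B b (hu.continuousOn_harmonicPart hγ i)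
    (hu.weaklyHarmonic hγ i) hb
  have hfin := fun j => hu.isFiniteMeasure hγ j
  choose q C hqC using fun j => hu.exists_tame hγ j
  have key := abs_virial_component_le (hγ i) hqC hg1 hg2 hg3 (G := b + B)
    (fun n x hx => by have := (abs_le.1 (hg4 n x hx)).2; linarith)
    (U := fun x => Real.exp (u i x)) (b := fun j => A i j / (2 * Real.pi))
    (fun x _ _ => by rw [eq_harmonicPart γ u i x]) hη hδ hs
  have hz : ∀ x ∉ ball (0 : Plane) 1, η x = 0 ∧ fderiv ℝ η x = 0 := by
    intro x hx
    have hxs : x ∉ tsupport η := fun h => hx (by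
      have := hs h
      rw [mem_closedBall_zero_iff] at this
      rw [mem_ball_zero_iff]; linarith)
    refine ⟨image_eq_zero_of_notMem_tsupport hxs, ?_⟩
    exact image_eq_zero_of_notMem_tsupport fun h => hxs (tsupport_fderiv_subset ℝ h)
  rw [expMeasure, integral_discMeasure (hu.aemeasurable_exp i) (fun _ => (Real.exp_pos _).le),
    integral_discMeasure (hu.aemeasurable_exp i) (fun _ => (Real.exp_pos _).le),
    setIntegral_eq_integral_of_forall_compl_eq_zero,
    setIntegral_eq_integral_of_forall_compl_eq_zero]
  · exact key
  · intro x hx; simp [(hz x hx).1]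
  · intro x hx; simp [(hz x hx).1, (hz x hx).2]

/-- Circles of fast decay may touch the unit circle, so the constraint is extended by continuity of
the regular parts. -/
theorem IsSolution.constraint_closedBall (hu : IsSolution γ c u) {x : Plane}
    (hx : x ∈ closedBall (0 : Plane) 1) (hx0 : x ≠ 0) : u 0 x + u 1 x + 2 * u 2 x = c := by
  have hcl : x ∈ closure (ball (0 : Plane) 1 \ {0}) := by
    rcases (mem_closedBall_zero_iff.1 hx).lt_or_eq with h | h
    · exact subset_closure ⟨by simpa using h, hx0⟩
    · have h1 : Tendsto (fun t : ℝ => t • x) (𝓝[<] 1) (𝓝 x) := by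
        have : Continuous fun t : ℝ => t • x := by fun_prop
        simpa using (this.tendsto 1).mono_left (nhdsWithin_le_nhds (s := Set.Iio 1))
      refine mem_closure_of_tendsto h1 ?_
      have h2 : ∀ᶠ t : ℝ in 𝓝[<] (1 : ℝ), 0 < t := nhdsWithin_le_nhds (lt_mem_nhds one_pos)
      filter_upwards [h2, self_mem_nhdsWithin] with t ht ht1
      refine ⟨?_, smul_ne_zero ht.ne' hx0⟩
      rw [mem_ball_zero_iff, norm_smul, h, Real.norm_of_nonneg ht.le]
      simpa using ht1
  have hcont : ∀ i, ContinuousWithinAt (u i) (ball (0 : Plane) 1 \ {0}) x := by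
    intro i
    have h1 : ContinuousWithinAt (regularPart γ u i) (ball (0 : Plane) 1 \ {0}) x :=
      (hu.continuous_regularPart i x hx).mono
        (Set.sdiff_subset.trans ball_subset_closedBall)
    have h2 : ContinuousWithinAt (fun z : Plane => 2 * γ i * Real.log ‖z‖)
        (ball (0 : Plane) 1 \ {0}) x :=
      ((continuous_norm.continuousAt.log (norm_ne_zero_iff.2 hx0)).const_mul
        _).continuousWithinAt
    refine (h1.add h2).congr (fun z _ => ?_) ?_ <;> simp [regularPart]
  have hF : ContinuousWithinAt (fun z => u 0 z + u 1 z + 2 * u 2 z)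
      (ball (0 : Plane) 1 \ {0}) x := ((hcont 0).add (hcont 1)).add ((hcont 2).const_mul 2)
  have : (𝓝[ball (0 : Plane) 1 \ {0}] x).NeBot := mem_closure_iff_nhdsWithin_neBot.1 hcl
  refine tendsto_nhds_unique hF.tendsto (tendsto_const_nhds.congr' ?_)
  filter_upwards [self_mem_nhdsWithin] with z hz
  exact (hu.constraint z hz).symm

/-- The constraint forces a linear relation between the strengths of the singularities. -/
theorem IsSolution.weights_eq_zero (hu : IsSolution γ c u) : γ 0 + γ 1 + 2 * γ 2 = 0 := by
  have hR : Tendsto (fun t : ℝ => regularPart γ u 0 (t • basisVec 0)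
      + regularPart γ u 1 (t • basisVec 0) + 2 * regularPart γ u 2 (t • basisVec 0))
      (𝓝[>] 0) (𝓝 (regularPart γ u 0 0 + regularPart γ u 1 0 + 2 * regularPart γ u 2 0)) := by
    have h1 : Tendsto (fun t : ℝ => t • basisVec 0) (𝓝[>] 0) (𝓝 0) := by
      have : Continuous fun t : ℝ => t • basisVec 0 := by fun_prop
      simpa using (this.tendsto 0).mono_left (nhdsWithin_le_nhds (s := Set.Ioi 0))
    have h2 : ∀ i, Tendsto (fun t : ℝ => regularPart γ u i (t • basisVec 0)) (𝓝[>] 0)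
        (𝓝 (regularPart γ u i 0)) := fun i =>
      (((hu.continuous_regularPart i).continuousAt
        (closedBall_mem_nhds _ one_pos)).tendsto).comp h1
    exact ((h2 0).add (h2 1)).add ((h2 2).const_mul 2)
  have hne : ∀ᶠ t : ℝ in 𝓝[>] (0 : ℝ), t < 1 := nhdsWithin_le_nhds (gt_mem_nhds one_pos)
  by_contra hne0
  have h3 : Tendsto (fun t : ℝ => c - 2 * (γ 0 + γ 1 + 2 * γ 2) * Real.log t) (𝓝[>] 0)
      (𝓝 (regularPart γ u 0 0 + regularPart γ u 1 0 + 2 * regularPart γ u 2 0)) := by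
    refine hR.congr' ?_
    filter_upwards [hne, self_mem_nhdsWithin] with t ht ht0
    have ht0' : (0 : ℝ) < t := ht0
    have hn : ‖t • basisVec 0‖ = t := by
      simp [basisVec, norm_smul, abs_of_pos ht0']
    have := hu.constraint (t • basisVec 0) ⟨by simpa [hn] using ht, by
      intro h
      rw [Set.mem_singleton_iff] at h
      rw [h, norm_zero] at hn
      exact ht0'.ne hn⟩
    simp only [regularPart, hn]
    linarith
  -- With a non-zero coefficient one could solve for log t, which would then converge as t → 0.
  have h4 : Tendsto Real.log (𝓝[>] 0)
      (𝓝 ((c - (regularPart γ u 0 0 + regularPart γ u 1 0 + 2 * regularPart γ u 2 0))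
        / (2 * (γ 0 + γ 1 + 2 * γ 2)))) := by
    refine ((h3.const_sub c).div_const (2 * (γ 0 + γ 1 + 2 * γ 2))).congr fun t => ?_
    field_simp
    ring
  exact not_tendsto_nhds_of_tendsto_atBot Real.tendsto_log_nhdsGT_zero _ h4

end

end

/-! ### Oscillation at the scale of the distance to the blow-up set. -/

section

section kernel

variable {e : Plane → ℝ} {S : Set Plane} {K : ℝ}

/-- Near a point at distance `d` from `S`, a density bounded by `K / dist(·, S)²` has a Newtonian
field of size `O(1 / d)`. -/
theorem newton_near_le (hm : AEMeasurable e (volume.restrict (ball (0 : Plane) 1)))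
    (h0 : ∀ z, 0 ≤ e z) (hK : 0 ≤ K)
    (he : ∀ z ∈ ball (0 : Plane) 1, z ∉ S → e z ≤ K / infDist z S ^ 2) {x : Plane}
    (hd : 0 < infDist x S) :
    Integrable ((ball x (infDist x S / 2)).indicator fun z => ‖x - z‖⁻¹) (discMeasure e) ∧
      ∫ z, (ball x (infDist x S / 2)).indicator (fun z => ‖x - z‖⁻¹) z ∂(discMeasure e)
        ≤ 4 * Real.pi * K / infDist x S := by
  set d := infDist x S with hdd
  set B := ball x (d / 2) with hB
  have ib : Integrable (B.indicator fun z => ‖x - z‖⁻¹) := by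
    rw [integrable_indicator_iff measurableSet_ball]
    have := integrableOn_norm_sub_rpow_ball (s := 1) (by norm_num) x (d / 2)
    simpa [Real.rpow_neg_one] using this
  have hi : IntegrableOn (fun z => 4 * K / d ^ 2 * B.indicator (fun z => ‖x - z‖⁻¹) z)
      (ball (0 : Plane) 1) := ib.integrableOn.const_mul _
  have hind : ∀ z, 0 ≤ B.indicator (fun z => ‖x - z‖⁻¹) z := fun z =>
    Set.indicator_nonneg (fun _ _ => by positivity) z
  have hbd : ∀ᵐ z ∂(volume.restrict (ball (0 : Plane) 1)),
      e z * B.indicator (fun z => ‖x - z‖⁻¹) z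
        ≤ 4 * K / d ^ 2 * B.indicator (fun z => ‖x - z‖⁻¹) z := by
    filter_upwards [ae_restrict_mem measurableSet_ball] with z hz
    by_cases hzB : z ∈ B
    · refine mul_le_mul_of_nonneg_right ?_ (hind z)
      have h1 : d / 2 ≤ infDist z S := by
        have := infDist_le_infDist_add_dist (s := S) (x := x) (y := z)
        rw [hB, mem_ball, dist_comm] at hzB
        linarith
      have hzS : z ∉ S := fun h => by
        have := infDist_zero_of_mem h
        linarith
      refine (he z hz hzS).trans ?_
      rw [show 4 * K / d ^ 2 = K / (d / 2) ^ 2 by field_simp; ring]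
      gcongr
    · simp [Set.indicator_of_notMem hzB]
  have hI : IntegrableOn (fun z => e z * B.indicator (fun z => ‖x - z‖⁻¹) z)
      (ball (0 : Plane) 1) := by
    refine Integrable.mono' hi (hm.mul ib.aestronglyMeasurable.aemeasurable.restrict
      ).aestronglyMeasurable ?_
    filter_upwards [hbd] with z hz
    rwa [Real.norm_of_nonneg (mul_nonneg (h0 z) (hind z))]
  refine ⟨(integrable_discMeasure_iff hm h0).2 hI, ?_⟩
  rw [integral_discMeasure hm h0]
  refine (integral_mono_ae hI hi hbd).trans ?_
  rw [integral_const_mul]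
  have h2 : ∫ z in ball (0 : Plane) 1, B.indicator (fun z => ‖x - z‖⁻¹) z ≤ Real.pi * d := by
    refine (setIntegral_le_integral ib (Eventually.of_forall hind)).trans ?_
    rw [integral_indicator measurableSet_ball, setIntegral_norm_sub_ball (fun y => y⁻¹),
      setIntegral_norm_inv_ball (by positivity)]
    exact le_of_eq (by ring)
  refine (mul_le_mul_of_nonneg_left h2 (by positivity)).trans (le_of_eq ?_)
  field_simp

/-- Since log a ≤ a - 1, the difference is at most |x - y|/|x - z|. Outside the ball of radius d/2
this is at most 2D. Inside it is kept as a Newtonian kernel, whose integral is controlled by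
`newton_near_le`. -/
theorem log_norm_sub_le {x y z : Plane} {d D : ℝ} (hD : 0 ≤ D)
    (hxy : ‖x - y‖ ≤ D * d) (hx : x - z ≠ 0) (hy : y - z ≠ 0) :
    Real.log ‖y - z‖ - Real.log ‖x - z‖
      ≤ 2 * D + D * d * (ball x (d / 2)).indicator (fun z => ‖x - z‖⁻¹) z := by
  have hx0 : 0 < ‖x - z‖ := norm_pos_iff.2 hx
  have hy0 : 0 < ‖y - z‖ := norm_pos_iff.2 hy
  have h1 : Real.log ‖y - z‖ - Real.log ‖x - z‖ ≤ D * d / ‖x - z‖ := by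
    rw [← Real.log_div hy0.ne' hx0.ne']
    refine (Real.log_le_sub_one_of_pos (by positivity)).trans ?_
    rw [sub_le_iff_le_add, div_add_one hx0.ne']
    gcongr
    have := norm_sub_le_norm_sub_add_norm_sub y x z
    rw [norm_sub_rev y x] at this
    linarith
  by_cases hz : z ∈ ball x (d / 2)
  · rw [Set.indicator_of_mem hz, ← div_eq_mul_inv]
    linarith
  · rw [Set.indicator_of_notMem hz]
    rw [mem_ball, dist_comm, dist_eq_norm, not_lt] at hz
    have : D * d / ‖x - z‖ ≤ 2 * D := by
      rw [div_le_iff₀ hx0]; nlinarith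
    linarith

variable [IsFiniteMeasure (discMeasure e)]

theorem pot_sub_le (hm : AEMeasurable e (volume.restrict (ball (0 : Plane) 1)))
    (h0 : ∀ z, 0 ≤ e z) (hK : 0 ≤ K)
    (he : ∀ z ∈ ball (0 : Plane) 1, z ∉ S → e z ≤ K / infDist z S ^ 2) {q C : ℝ}
    (hT : Tame (discMeasure e) q C) {x y : Plane} (hx : x ∈ closedBall (0 : Plane) 1)
    (hy : y ∈ closedBall (0 : Plane) 1) (hd : 0 < infDist x S) {D : ℝ} (hD : 0 ≤ D)
    (hxy : ‖x - y‖ ≤ D * infDist x S) :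
    pot (discMeasure e) y - pot (discMeasure e) x
      ≤ 2 * D * (discMeasure e).real Set.univ + 4 * Real.pi * D * K := by
  obtain ⟨hi, hle⟩ := newton_near_le hm h0 hK he hd
  rw [pot, pot, ← integral_sub (hT.integrable_log hy) (hT.integrable_log hx)]
  have hi2 := (integrable_const (μ := discMeasure e) (2 * D)).add
    (hi.const_mul (D * infDist x S))
  refine (integral_mono_ae ((hT.integrable_log hy).sub (hT.integrable_log hx)) hi2 ?_).trans ?_
  · filter_upwards [hT.sub_ne_zero x, hT.sub_ne_zero y] with z hzx hzy
    exact log_norm_sub_le hD hxy hzx hzy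
  · simp only [Pi.add_apply]
    rw [integral_add (integrable_const _) (hi.const_mul _), integral_const, integral_const_mul,
      smul_eq_mul]
    have h1 := mul_le_mul_of_nonneg_left hle (by positivity : 0 ≤ D * infDist x S)
    have h2 : D * infDist x S * (4 * Real.pi * K / infDist x S) = 4 * Real.pi * D * K := by
      field_simp
    linarith

end kernel

/-- Points of a circle that are not too close to a finite set. -/
theorem exists_mem_sphere_far {x y₀ : Plane} {r d : ℝ} (hr : 0 < r) (hd : 0 < d) (hdr : d ≤ r)
    (hy₀ : y₀ ∈ sphere x r) {S : Set Plane} (hS : S.Finite) {n : ℕ} (hn : 0 < n)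
    (hcard : S.ncard ≤ n) :
    ∃ y ∈ sphere x r, dist y y₀ ≤ d ∧ ∀ q ∈ S, d / (2 * n) ≤ dist y q := by
  have hn' : (0 : ℝ) < n := by exact_mod_cast hn
  have hpre : IsPreconnected (sphere x r) := isPreconnected_sphere (by
    rw [← Module.finrank_eq_rank, finrank_plane]; norm_num) x r
  have hanti : (2 : ℝ) • x - y₀ ∈ sphere x r := by
    rw [mem_sphere, dist_eq_norm] at hy₀ ⊢
    rw [← hy₀, ← norm_neg, two_smul]
    congr 1
    abel
  have hdist : dist ((2 : ℝ) • x - y₀) y₀ = 2 * r := by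
    rw [mem_sphere, dist_comm, dist_eq_norm] at hy₀
    rw [dist_eq_norm, ← hy₀, show (2 : ℝ) • x - y₀ - y₀ = (2 : ℝ) • (x - y₀) by
      rw [smul_sub, two_smul ℝ y₀]; abel, norm_smul]
    norm_num
  have hivt : ∀ s, 0 ≤ s → s ≤ d → ∃ y ∈ sphere x r, dist y y₀ = s := by
    intro s h0 h1
    have := hpre.intermediate_value hy₀ hanti
      (f := fun y => dist y y₀) (continuous_id.dist continuous_const).continuousOn
    obtain ⟨y, hy, hys⟩ := this (show s ∈ Set.Icc (dist y₀ y₀) (dist ((2 : ℝ) • x - y₀) y₀) from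
      ⟨by simpa using h0, by rw [hdist]; linarith⟩)
    exact ⟨y, hy, hys⟩
  -- The n + 1 points have distances 0, d/n, …, d from y₀, hence are pairwise at least d/n apart. If
  -- each were within d/(2n) of S, two would share a point of S by the pigeonhole principle and be
  -- closer than d/n.
  have hj : ∀ j : Fin (n + 1), ∃ y ∈ sphere x r, dist y y₀ = (j : ℕ) * d / n := by
    intro j
    refine hivt _ (by positivity) ?_
    rw [div_le_iff₀ hn', mul_comm d]
    have : ((j : ℕ) : ℝ) ≤ n := by exact_mod_cast Nat.lt_succ_iff.1 j.2
    gcongr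
  choose Y hYs hYd using hj
  by_contra! hcon
  have hnear : ∀ j, ∃ q ∈ S, dist (Y j) q < d / (2 * n) := fun j => hcon _ (hYs j) (by
    rw [hYd, div_le_iff₀ hn', mul_comm d]
    have : ((j : ℕ) : ℝ) ≤ n := by exact_mod_cast Nat.lt_succ_iff.1 j.2
    gcongr)
  choose Q hQS hQd using hnear
  obtain ⟨i, -, j, -, hij, hQ⟩ := Finset.exists_ne_map_eq_of_card_lt_of_maps_to
    (s := Finset.univ) (t := hS.toFinset) (f := Q)
    (by rw [Finset.card_univ, Fintype.card_fin, ← Set.ncard_eq_toFinset_card S hS]; omega)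
    (fun j _ => by simpa using hQS j)
  have h1 : dist (Y i) (Y j) < d / n := by
    have := dist_triangle_right (Y i) (Y j) (Q i)
    have h2 := hQd i
    have h3 := hQd j
    rw [← hQ] at h3
    have h4 : d / (2 * n) + d / (2 * n) = d / n := by field_simp; ring
    linarith
  have h2 : d / n ≤ |dist (Y i) y₀ - dist (Y j) y₀| := by
    rw [hYd, hYd, ← sub_div, ← sub_mul, abs_div, abs_mul, abs_of_pos hn', abs_of_pos hd]
    gcongr
    have h3 : (1 : ℤ) ≤ |((i : ℕ) : ℤ) - ((j : ℕ) : ℤ)| := by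
      refine Int.one_le_abs (sub_ne_zero.2 fun h => hij ?_)
      exact Fin.ext (by exact_mod_cast h)
    have h4 : (1 : ℝ) ≤ |((i : ℕ) : ℝ) - ((j : ℕ) : ℝ)| := by exact_mod_cast h3
    nlinarith
  have h3 := abs_dist_sub_le (Y i) (Y j) y₀
  linarith

theorem sum_abs_A_le (i : Fin 3) : ∑ j, |A i j / (2 * Real.pi)| ≤ 1 := by
  have h := Real.pi_gt_three
  have h2 : |2 * Real.pi| = 2 * Real.pi := abs_of_pos (by positivity)
  have h3 : |(Real.pi)| = Real.pi := abs_of_pos (by positivity)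
  fin_cases i <;> simp [A, Fin.sum_univ_three, abs_div, h3] <;> field_simp <;> linarith

/-- The oscillation of a component over a set whose size is `D` times its distance to the blow-up
set. -/
def oscConst (g B M₀ K D : ℝ) : ℝ :=
  2 * B + 2 * g * D + (2 * D * M₀ + 4 * Real.pi * D * K)

/-- Bounds on a solution that are uniform along a blow-up sequence. -/
structure Controlled (γ : Fin 3 → ℝ) (u : Fin 3 → Plane → ℝ) (S : Set Plane) (n : ℕ)
    (M₀ B K : ℝ) : Prop where
  zero_mem : 0 ∈ S
  finite : S.Finite
  card : S.ncard ≤ n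
  nonneg : 0 ≤ K
  mass_le : ∀ i, (expMeasure u i).real Set.univ ≤ M₀
  osc : ∀ i, ∃ b, ∀ x ∈ closedBall (0 : Plane) 1, |harmonicPart γ u i x - b| ≤ B
  harnack : ∀ i, ∀ x ∈ ball (0 : Plane) 1, x ∉ S → Real.exp (u i x) ≤ K / infDist x S ^ 2

section

variable {γ : Fin 3 → ℝ} {c : ℝ} {u : Fin 3 → Plane → ℝ} {S : Set Plane} {n : ℕ} {M₀ B K : ℝ}

/-- The hypothesis on ‖x - y‖ is required from both endpoints because `pot_sub_le` is one-sided. The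
total weight ∑_j |a_ij|/2π is at most 1, so no extra factor appears. -/
theorem IsSolution.sum_pot_sub_le (hu : IsSolution γ c u) (hγ : ∀ i, -1 < γ i)
    (hK : 0 ≤ K) (hM : ∀ i, (expMeasure u i).real Set.univ ≤ M₀)
    (hh : ∀ i, ∀ x ∈ ball (0 : Plane) 1, x ∉ S → Real.exp (u i x) ≤ K / infDist x S ^ 2)
    (i : Fin 3) {x y : Plane} (hx : x ∈ closedBall (0 : Plane) 1)
    (hy : y ∈ closedBall (0 : Plane) 1) (hdx : 0 < infDist x S) (hdy : 0 < infDist y S) {D : ℝ}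
    (hD : 0 ≤ D) (hxy : ‖x - y‖ ≤ D * infDist x S) (hyx : ‖x - y‖ ≤ D * infDist y S) :
    |∑ j, A i j / (2 * Real.pi) * pot (expMeasure u j) x
      - ∑ j, A i j / (2 * Real.pi) * pot (expMeasure u j) y|
      ≤ 2 * D * M₀ + 4 * Real.pi * D * K := by
  have key : ∀ j, |pot (expMeasure u j) x - pot (expMeasure u j) y|
      ≤ 2 * D * M₀ + 4 * Real.pi * D * K := by
    intro j
    have : IsFiniteMeasure (discMeasure fun z => Real.exp (u j z)) := hu.isFiniteMeasure hγ j
    obtain ⟨q, C, hT⟩ := hu.exists_tame hγ j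
    have h1 := pot_sub_le (hu.aemeasurable_exp j) (fun _ => (Real.exp_pos _).le) hK (hh j) hT
      hx hy hdx hD hxy
    rw [norm_sub_rev] at hyx
    have h2 := pot_sub_le (hu.aemeasurable_exp j) (fun _ => (Real.exp_pos _).le) hK (hh j) hT
      hy hx hdy hD hyx
    have h3 := mul_le_mul_of_nonneg_left (hM j) (by positivity : 0 ≤ 2 * D)
    change pot (expMeasure u j) y - pot (expMeasure u j) x ≤ 2 * D * (expMeasure u j).real _ + _
      at h1
    change pot (expMeasure u j) x - pot (expMeasure u j) y ≤ 2 * D * (expMeasure u j).real _ + _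
      at h2
    rw [abs_le]
    constructor <;> linarith
  have hP : 0 ≤ 2 * D * M₀ + 4 * Real.pi * D * K := (abs_nonneg _).trans (key 0)
  rw [← Finset.sum_sub_distrib]
  simp_rw [← mul_sub]
  refine (Finset.abs_sum_le_sum_abs _ _).trans ?_
  calc _ ≤ ∑ j, |A i j / (2 * Real.pi)| * (2 * D * M₀ + 4 * Real.pi * D * K) := by
        refine Finset.sum_le_sum fun j _ => ?_
        rw [abs_mul]
        exact mul_le_mul_of_nonneg_left (key j) (abs_nonneg _)
    _ ≤ 1 * (2 * D * M₀ + 4 * Real.pi * D * K) := by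
        rw [← Finset.sum_mul]
        exact mul_le_mul_of_nonneg_right (sum_abs_A_le i) hP
    _ = _ := one_mul _

/-- The oscillation bound at the scale of the distance to the blow-up set. -/
theorem Controlled.abs_sub_le (hC : Controlled γ u S n M₀ B K) (hu : IsSolution γ c u)
    (hγ : ∀ i, -1 < γ i) (i : Fin 3) {x y : Plane} (hx : x ∈ closedBall (0 : Plane) 1)
    (hy : y ∈ closedBall (0 : Plane) 1) (hdx : 0 < infDist x S) (hdy : 0 < infDist y S) {D : ℝ}
    (hD : 0 ≤ D) (hxy : ‖x - y‖ ≤ D * infDist x S) (hyx : ‖x - y‖ ≤ D * infDist y S) :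
    |u i x - u i y| ≤ oscConst |γ i| B M₀ K D := by
  rw [oscConst]
  have h1 := hu.sum_pot_sub_le hγ hC.nonneg hC.mass_le hC.harnack i hx hy hdx hdy hD hxy hyx
  obtain ⟨b, hb⟩ := hC.osc i
  have h2 := abs_le.1 (hb x hx)
  have h3 := abs_le.1 (hb y hy)
  have hx0 : infDist x S ≤ ‖x‖ := by simpa using infDist_le_dist_of_mem (x := x) hC.zero_mem
  have hy0 : infDist y S ≤ ‖y‖ := by simpa using infDist_le_dist_of_mem (x := y) hC.zero_mem
  have hlog : ∀ s t : ℝ, 0 < s → 0 < t → t ≤ s + D * s → Real.log t - Real.log s ≤ D := by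
    intro s t hs ht hst
    rw [← Real.log_div ht.ne' hs.ne']
    refine (Real.log_le_sub_one_of_pos (by positivity)).trans ?_
    rw [sub_le_iff_le_add, div_le_iff₀ hs]
    linarith
  have h4 : |Real.log ‖x‖ - Real.log ‖y‖| ≤ D := by
    have e1 := norm_sub_norm_le x y
    have e2 := norm_sub_norm_le y x
    rw [norm_sub_rev] at e2
    have e3 := mul_le_mul_of_nonneg_left hx0 hD
    have e4 := mul_le_mul_of_nonneg_left hy0 hD
    rw [abs_le]
    constructor
    · have := hlog ‖x‖ ‖y‖ (hdx.trans_le hx0) (hdy.trans_le hy0) (by linarith)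
      linarith
    · exact hlog ‖y‖ ‖x‖ (hdy.trans_le hy0) (hdx.trans_le hx0) (by linarith)
  have h5 : |2 * γ i * Real.log ‖x‖ - 2 * γ i * Real.log ‖y‖| ≤ 2 * |γ i| * D := by
    rw [← mul_sub, abs_mul, abs_mul, abs_two]
    exact mul_le_mul_of_nonneg_left h4 (by positivity)
  rw [eq_harmonicPart γ u i x, eq_harmonicPart γ u i y]
  rw [abs_le] at h1 h5 ⊢
  constructor <;> linarith [h1.1, h1.2, h5.1, h5.2, h2.1, h2.2, h3.1, h3.2]

end

end

/-! ### Comparison with a circle and uniform control of the sequence. -/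

section

section

variable {γ : Fin 3 → ℝ} {c : ℝ} {u : Fin 3 → Plane → ℝ} {S S' : Set Plane} {n : ℕ} {M₀ B K : ℝ}

theorem IsSolution.expMeasure_real_le (hu : IsSolution γ c u) (hγ : ∀ i, -1 < γ i) (i : Fin 3)
    {E : Set Plane} (hE : MeasurableSet E) {ρ b : ℝ} (hρ : 0 ≤ ρ) (hEρ : E ⊆ ball 0 ρ)
    (hb : ∀ z ∈ ball (0 : Plane) 1, z ∈ E → u i z ≤ b) :
    (expMeasure u i).real E ≤ Real.exp b * (Real.pi * ρ ^ 2) := by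
  rw [hu.expMeasure_real i hE, ← volume_real_ball 0 hρ]
  have hm : MeasurableSet (ball (0 : Plane) 1 ∩ E) := measurableSet_ball.inter hE
  have hfin : volume (ball (0 : Plane) 1 ∩ E) < ⊤ :=
    (measure_mono Set.inter_subset_left).trans_lt measure_ball_lt_top
  calc ∫ z in ball (0 : Plane) 1 ∩ E, Real.exp (u i z)
      ≤ ∫ _z in ball (0 : Plane) 1 ∩ E, Real.exp b := by
        refine setIntegral_mono_on ((hu.integrableOn_exp hγ i).mono_set Set.inter_subset_left)
          (integrableOn_const hfin.ne) hm fun z hz => ?_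
        exact Real.exp_le_exp.2 (hb z hz.1 hz.2)
    _ = volume.real (ball (0 : Plane) 1 ∩ E) * Real.exp b := by
        rw [setIntegral_const, smul_eq_mul]
    _ ≤ _ := by
        rw [mul_comm]
        refine mul_le_mul_of_nonneg_left ?_ (Real.exp_pos _).le
        exact measureReal_mono (Set.inter_subset_right.trans hEρ) measure_ball_lt_top.ne

theorem sphere_subset_closedBall_of_ball {x : Plane} {r : ℝ} (hr : 0 < r)
    (h : ball x r ⊆ ball 0 1) : sphere x r ⊆ closedBall 0 1 := by
  have := closure_mono h
  rw [closure_ball x hr.ne', closure_ball 0 one_ne_zero] at this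
  exact sphere_subset_closedBall.trans this

theorem exists_mem_sphere_of_segment {x p z : Plane} {r : ℝ} (hp : p ∈ ball x r)
    (hz : z ∉ ball x r) : ∃ y ∈ sphere x r, dist y z ≤ dist p z := by
  have hpre := (convex_segment (𝕜 := ℝ) p z).isPreconnected
  have := hpre.intermediate_value (left_mem_segment ℝ p z) (right_mem_segment ℝ p z)
    (f := fun y => dist y x) (continuous_id.dist continuous_const).continuousOn
  obtain ⟨y, hy, hyr⟩ := this (show r ∈ Set.Icc (dist p x) (dist z x) from
    ⟨(mem_ball.1 hp).le, not_lt.1 hz⟩)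
  refine ⟨y, hyr, ?_⟩
  exact (convex_closedBall z (dist p z)).segment_subset (mem_closedBall.2 le_rfl)
    (mem_closedBall_self dist_nonneg) hy

theorem le_infDist_of_forall {s : Set Plane} {y : Plane} {d : ℝ} (hs : s.Nonempty)
    (h : ∀ q ∈ s, d ≤ dist y q) : d ≤ infDist y s :=
  (le_infDist hs).2 fun q hq => h q hq

/-- A component outside a disc around the blow-up points is comparable to its values on the
boundary of the disc. -/
theorem Controlled.exists_mem_sphere_abs_sub_le (hC : Controlled γ u S n M₀ B K)
    (hu : IsSolution γ c u) (hγ : ∀ i, -1 < γ i) (i : Fin 3) {x : Plane} {r R : ℝ} (hr : 0 < r)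
    (hR : 1 ≤ R) (hball : ball x r ⊆ ball 0 1) (h0 : 0 ∈ S')
    (hS' : S' ⊆ ball x r)
    (hsep : ∀ q ∈ S \ S', ∀ y ∈ sphere x r, (2 * R + 4) * r ≤ dist q y) {z : Plane}
    (hz : z ∈ ball (0 : Plane) 1) (hzx : z ∉ ball x r) (hzR : ‖z‖ ≤ R * r) :
    ∃ y ∈ sphere x r, |u i z - u i y| ≤ oscConst |γ i| B M₀ K (4 * n * R) := by
  have hne : S.Nonempty := ⟨0, hC.zero_mem⟩
  have hn1 : 1 ≤ n := le_trans ((Set.ncard_pos hC.finite).2 hne) hC.card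
  have hn1' : (1 : ℝ) ≤ n := by exact_mod_cast hn1
  obtain ⟨p, hpS, hpd⟩ := hC.finite.isCompact.exists_infDist_eq_dist hne z
  have hx2 : ‖x‖ < r := by simpa using hS' h0
  have hd0 : infDist z S ≤ R * r :=
    (infDist_le_dist_of_mem hC.zero_mem).trans (by simpa using hzR)
  obtain ⟨y₁, hy₁, -⟩ := exists_mem_sphere_of_segment (hS' h0) hzx
  -- A nearest point outside S' would be within R r + (2r + R r) of a point of the circle, which is
  -- less than the separation (2R + 4) r.
  have hpS' : p ∈ S' := by
    by_contra hp
    have h1 := hsep p ⟨hpS, hp⟩ y₁ hy₁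
    have h2 : dist y₁ z ≤ 2 * r + R * r := by
      rw [mem_sphere, dist_eq_norm] at hy₁
      rw [dist_eq_norm]
      have e1 := norm_sub_le y₁ z
      have e2 := norm_sub_norm_le y₁ x
      linarith
    have h3 := dist_triangle p z y₁
    rw [dist_comm p z, dist_comm z y₁] at h3
    nlinarith
  obtain ⟨y₀, hy₀, hy₀z⟩ := exists_mem_sphere_of_segment (hS' hpS') hzx
  rw [dist_comm p z, ← hpd] at hy₀z
  have hd : 0 < infDist z S := by
    rw [hpd]
    exact dist_pos.2 fun h => hzx (h ▸ hS' hpS')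
  set d := infDist z S with hdd
  have hmin : 0 < min d r := lt_min hd hr
  obtain ⟨y, hy, hyy, hyS⟩ := exists_mem_sphere_far hr hmin (min_le_right _ _) hy₀ hC.finite
    (by omega : 0 < n) hC.card
  have hyd : min d r / (2 * n) ≤ infDist y S := le_infDist_of_forall hne hyS
  -- Together with dist(y, S) ≥ min(d, r)/(2n) and ‖z - y‖ ≤ 2d, this is what makes D = 4nR
  -- sufficient at the endpoint y.
  have hdR : d ≤ R * min d r := by
    rcases min_cases d r with ⟨h, -⟩ | ⟨h, -⟩ <;> rw [h]
    · nlinarith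
    · exact hd0
  have hzy : ‖z - y‖ ≤ 2 * d := by
    rw [← dist_eq_norm, dist_comm]
    have := dist_triangle y y₀ z
    have := min_le_left d r
    linarith
  refine ⟨y, hy, hC.abs_sub_le hu hγ i (ball_subset_closedBall hz)
    (sphere_subset_closedBall_of_ball hr hball hy) hd (lt_of_lt_of_le (by positivity) hyd)
    (by positivity) ?_ ?_⟩
  · refine hzy.trans ?_
    have : (2 : ℝ) ≤ 4 * n * R := by nlinarith
    exact mul_le_mul_of_nonneg_right this hd.le
  · have h1 : 4 * n * R * (min d r / (2 * n)) ≤ 4 * n * R * infDist y S :=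
      mul_le_mul_of_nonneg_left hyd (by positivity)
    have h2 : 4 * n * R * (min d r / (2 * n)) = 2 * (R * min d r) := by
      field_simp; ring
    linarith

/-- A component away from the origin is comparable to its values on a circle of definite size. -/
theorem Controlled.exists_mem_sphere_abs_sub_le_of_le_norm (hC : Controlled γ u S n M₀ B K)
    (hu : IsSolution γ c u) (hγ : ∀ i, -1 < γ i) (i : Fin 3) {x : Plane} {r t : ℝ} (hr : 0 < r)
    (hball : ball x r ⊆ ball 0 1) (ht : 0 < t) (hSt : S ⊆ ball 0 (t / 2)) {z : Plane}
    (hz : z ∈ ball (0 : Plane) 1) (hzt : t ≤ ‖z‖) {r₀ : ℝ} (hr₀ : 0 < r₀) (hrr : r₀ ≤ r) :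
    ∃ y ∈ sphere x r, |u i z - u i y| ≤ oscConst |γ i| B M₀ K (4 / t + 4 * n / r₀) := by
  have hne : S.Nonempty := ⟨0, hC.zero_mem⟩
  have hn1 : 1 ≤ n := le_trans ((Set.ncard_pos hC.finite).2 hne) hC.card
  have hn1' : (1 : ℝ) ≤ n := by exact_mod_cast hn1
  obtain ⟨y₀, hy₀⟩ := (NormedSpace.sphere_nonempty (x := x)).2 hr.le
  obtain ⟨y, hy, -, hyS⟩ := exists_mem_sphere_far hr hr le_rfl hy₀ hC.finite
    (by omega : 0 < n) hC.card
  have hyd : r / (2 * n) ≤ infDist y S := le_infDist_of_forall hne hyS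
  have hyd' : r₀ / (2 * n) ≤ infDist y S := le_trans (by gcongr) hyd
  have hzd : t / 2 ≤ infDist z S := le_infDist_of_forall hne fun q hq => by
    have h1 := mem_ball_zero_iff.1 (hSt hq)
    have h2 := norm_sub_norm_le z q
    rw [dist_eq_norm]
    linarith
  have hy1 := sphere_subset_closedBall_of_ball hr hball hy
  have hzy : ‖z - y‖ ≤ 2 := by
    have h1 := mem_ball_zero_iff.1 hz
    have h2 := mem_closedBall_zero_iff.1 hy1
    linarith [norm_sub_le z y]
  refine ⟨y, hy, hC.abs_sub_le hu hγ i (ball_subset_closedBall hz) hy1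
    (lt_of_lt_of_le (by positivity) hzd) (lt_of_lt_of_le (by positivity) hyd)
    (by positivity) ?_ ?_⟩
  · have h1 : 4 / t * (t / 2) = 2 := by field_simp; norm_num
    have h2 := mul_le_mul_of_nonneg_left hzd (by positivity : 0 ≤ 4 / t + 4 * n / r₀)
    have h3 : 0 ≤ 4 * n / r₀ * (t / 2) := by positivity
    linarith
  · have h1 : 4 * n / r₀ * (r₀ / (2 * n)) = 2 := by field_simp; norm_num
    have h2 := mul_le_mul_of_nonneg_left hyd' (by positivity : 0 ≤ 4 / t + 4 * n / r₀)
    have h3 : 0 ≤ 4 / t * (r₀ / (2 * n)) := by positivity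
    linarith

end

section

variable {γ : Fin 3 → ℝ} {c : ℕ → ℝ} {u : ℕ → Fin 3 → Plane → ℝ} {m : ℕ}
  {p : ℕ → Fin m → Plane} {l : ℕ → Fin m → ℝ} {S : ℕ → Set Plane}

theorem IsBlowupSet.subset_insert (hS : IsBlowupSet γ u p l S) (k : ℕ) :
    S k ⊆ insert 0 (Set.range (p k)) := by
  rcases hS.set_eq with h | ⟨-, h⟩
  · exact (h k).1.subset
  · rw [h k]; exact Set.subset_insert _ _

theorem IsBlowupSet.finite (hS : IsBlowupSet γ u p l S) (k : ℕ) : (S k).Finite :=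
  ((Set.finite_range (p k)).insert 0).subset (hS.subset_insert k)

theorem IsBlowupSet.ncard_le (hS : IsBlowupSet γ u p l S) (k : ℕ) : (S k).ncard ≤ m + 1 := by
  refine (Set.ncard_le_ncard (hS.subset_insert k) ((Set.finite_range (p k)).insert 0)).trans
    ((Set.ncard_insert_le _ _).trans (Nat.succ_le_succ ?_))
  rw [← Set.image_univ]
  refine (Set.ncard_image_le Set.finite_univ).trans ?_
  rw [Set.ncard_univ, Nat.card_eq_fintype_card, Fintype.card_fin]

theorem IsBlowupSet.eventually_subset_ball (hS : IsBlowupSet γ u p l S) {s : ℝ} (hs : 0 < s) :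
    ∀ᶠ k in atTop, S k ⊆ ball 0 s := by
  have h1 : ∀ᶠ k in atTop, ∀ j, p k j ∈ ball (0 : Plane) s :=
    eventually_all.2 fun j => (hS.tendsto_point j).eventually (ball_mem_nhds _ hs)
  filter_upwards [h1] with k hk q hq
  rcases hS.subset_insert k hq with rfl | ⟨j, rfl⟩
  · exact mem_ball_self hs
  · exact hk j

/-- Only the oscillation of the harmonic part needs an argument. On the unit circle it differs from
u_i by potentials whose oscillation is bounded because Σ_k is far away, and the maximum principle
carries the bound inside. -/
theorem IsBlowupSet.exists_controlled (hS : IsBlowupSet γ u p l S) (hγ : ∀ i, -1 < γ i)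
    (hsol : ∀ k, IsSolution γ (c k) (u k)) (hu : IsBlowupSequence γ u)
    (h0 : ∀ k, (0 : Plane) ∈ S k) :
    ∃ M₀ B K, 0 ≤ M₀ ∧ 0 ≤ B ∧ ∀ᶠ k in atTop, Controlled γ (u k) (S k) (m + 1) M₀ B K := by
  obtain ⟨M₀, hM₀⟩ := hu.bounded_energy
  obtain ⟨b, hb⟩ := hu.bounded_osc
  obtain ⟨C, hC⟩ := hS.harnack
  have hM : ∀ k i, (expMeasure (u k) i).real Set.univ ≤ M₀ := by
    intro k i
    rw [(hsol k).expMeasure_real i MeasurableSet.univ, Set.inter_univ]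
    exact (hM₀ k i).2
  have hh : ∀ k i, ∀ x ∈ ball (0 : Plane) 1, x ∉ S k →
      Real.exp (u k i x) ≤ Real.exp C / infDist x (S k) ^ 2 := by
    intro k i x hx hxS
    have hd : 0 < infDist x (S k) :=
      ((hS.finite k).isClosed.notMem_iff_infDist_pos ⟨0, h0 k⟩).1 hxS
    have := hC k i x hx hxS
    rw [← Real.exp_log (pow_pos hd 2), ← Real.exp_sub, Real.log_pow]
    refine Real.exp_le_exp.2 ?_
    push_cast
    linarith
  have hM0 : 0 ≤ M₀ := measureReal_nonneg.trans (hM 0 0)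
  have hb0 : 0 ≤ b := by
    have he : basisVec 0 ∈ sphere (0 : Plane) 1 := by simp [basisVec]
    exact (abs_nonneg _).trans (hb 0 0 _ he _ he)
  -- The factor 4 is D: two points of the unit circle are at distance at most 2 and each is at
  -- distance at least 1/2 from Σ_k.
  refine ⟨M₀, b + (2 * 4 * M₀ + 4 * Real.pi * 4 * Real.exp C), Real.exp C, hM0, by positivity, ?_⟩
  filter_upwards [hS.eventually_subset_ball (s := 1 / 2) (by norm_num)] with k hk
  refine ⟨h0 k, hS.finite k, hS.ncard_le k, (Real.exp_pos _).le, hM k, fun i => ?_, hh k⟩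
  refine ((hsol k).weaklyHarmonic hγ i).osc_le ((hsol k).continuousOn_harmonicPart hγ i) ?_
  have hdist : ∀ x ∈ sphere (0 : Plane) 1, 1 / 2 ≤ infDist x (S k) := by
    intro x hx
    refine le_infDist_of_forall ⟨0, h0 k⟩ fun q hq => ?_
    have h1 := mem_ball_zero_iff.1 (hk hq)
    have h2 := norm_sub_norm_le x q
    rw [mem_sphere_zero_iff_norm] at hx
    rw [dist_eq_norm]
    linarith
  intro x hx y hy
  have hx' := hdist x hx
  have hy' := hdist y hy
  have hxy : ‖x - y‖ ≤ 2 := by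
    have h1 := mem_sphere_zero_iff_norm.1 hx
    have h2 := mem_sphere_zero_iff_norm.1 hy
    linarith [norm_sub_le x y]
  have h1 := (hsol k).sum_pot_sub_le hγ (Real.exp_pos C).le (hM k) (hh k) i
    (sphere_subset_closedBall hx) (sphere_subset_closedBall hy) (by linarith) (by linarith)
    (D := 4) (by norm_num) (by linarith) (by linarith)
  have h2 := hb k i x hx y hy
  have e1 : ∀ z ∈ sphere (0 : Plane) 1, harmonicPart γ (u k) i z
      = u k i z + ∑ j, A i j / (2 * Real.pi) * pot (expMeasure (u k) j) z := by
    intro z hz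
    simp [harmonicPart, regularPart, mem_sphere_zero_iff_norm.1 hz]
  rw [e1 x hx, e1 y hy]
  rw [abs_le] at h1 h2 ⊢
  constructor <;> linarith [h1.1, h1.2, h2.1, h2.2]

end

end

/-! ### The separated case: no mass in the neck. -/

section

/-- The quadratic form that vanishes on the limits of local masses. -/
def virialForm (γ a : Fin 3 → ℝ) : ℝ :=
  ∑ i, wt i * ((2 + 2 * γ i) * a i)
    - 1 / 2 * ∑ i, ∑ j, wt i * A i j / (2 * Real.pi) * (a i * a j)

theorem continuous_virialForm (γ : Fin 3 → ℝ) : Continuous (virialForm γ) := by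
  unfold virialForm
  fun_prop

/-- The masses of the components of `u` on the set `M`. -/
def massVector (u : Fin 3 → Plane → ℝ) (M : Set Plane) (i : Fin 3) : ℝ :=
  (expMeasure u i).real M

theorem massVector_mono {v : Fin 3 → Plane → ℝ} {b : ℝ} {γ : Fin 3 → ℝ}
    (hv : IsSolution γ b v) (hγ : ∀ i, -1 < γ i) {s t : Set Plane} (h : s ⊆ t) (i : Fin 3) :
    massVector v s i ≤ massVector v t i := by
  have := hv.isFiniteMeasure hγ i
  exact measureReal_mono h

theorem Controlled.massVector_mem_Icc {γ : Fin 3 → ℝ} {v : Fin 3 → Plane → ℝ} {S : Set Plane}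
    {n : ℕ} {M₀ B K b : ℝ} (hC : Controlled γ v S n M₀ B K) (hv : IsSolution γ b v)
    (hγ : ∀ i, -1 < γ i) (M : Set Plane) :
    massVector v M ∈ Set.Icc (0 : Fin 3 → ℝ) (fun _ => M₀) :=
  ⟨fun _ => measureReal_nonneg, fun i =>
    (massVector_mono hv hγ (Set.subset_univ M) i).trans (hC.mass_le i)⟩

theorem le_dist_of_littleO {r : ℕ → ℝ} {s t : ℕ → Set Plane}
    (h : LittleO (fun k => ENNReal.ofReal (r k)) fun k => setDist (s k) (t k)) {R : ℝ}
    (hR : 0 < R) : ∀ᶠ k in atTop, ∀ q ∈ s k, ∀ y ∈ t k, R * r k ≤ dist q y := by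
  filter_upwards [h (1 / R) (by positivity)] with k hk q hq y hy
  have h1 : setDist (s k) (t k) ≤ edist q y := (iInf₂_le q hq).trans (iInf₂_le y hy)
  have h2 := hk.trans (mul_le_mul_right h1 _)
  rw [edist_dist, ← ENNReal.ofReal_mul (by positivity),
    ENNReal.ofReal_le_ofReal_iff (by positivity)] at h2
  rw [one_div, inv_mul_eq_div, le_div_iff₀ hR] at h2
  linarith

section

variable {γ : Fin 3 → ℝ} {c : ℕ → ℝ} {u : ℕ → Fin 3 → Plane → ℝ} {m : ℕ}
  {p : ℕ → Fin m → Plane} {l : ℕ → Fin m → ℝ} {S S' : ℕ → Set Plane} {n : ℕ} {M₀ B K : ℝ}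
  {x : ℕ → Plane} {r : ℕ → ℝ}

theorem exists_virialForm_le (hγ : ∀ i, -1 < γ i) (hsol : ∀ k, IsSolution γ (c k) (u k))
    (hM₀ : 0 ≤ M₀) (hB : 0 ≤ B) (hC : ∀ᶠ k in atTop, Controlled γ (u k) (S k) n M₀ B K) :
    ∃ L, 0 ≤ L ∧ ∀ᶠ k in atTop, ∀ (M : Set Plane) (ρ t τ : ℝ), MeasurableSet M → 0 < ρ →
      ρ < 1 / 8 → 0 ≤ t → t < ρ → (∀ x ∈ M, ‖x‖ ≤ t) →
      (∀ i, massVector (u k) (ball (0 : Plane) (4 * ρ) \ M) i ≤ τ) →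
      |virialForm γ (massVector (u k) M)| ≤ L * (τ + ρ + t / ρ) := by
  obtain ⟨H, hH, hvir⟩ := exists_virialComponent γ hγ
  obtain ⟨L, hL, hbd⟩ := exists_virial_bound γ (mul_nonneg hH hB) hM₀
  refine ⟨L, hL, ?_⟩
  filter_upwards [hC] with k hk
  choose q C hT using fun i => (hsol k).exists_tame hγ i
  exact hbd _ (fun i => (hsol k).isFiniteMeasure hγ i) q C hT hk.mass_le
    (hvir _ _ _ (hsol k) hk.osc)

theorem exists_fastDecay (hfast : ∀ i, FastDecay (fun k => u k i) x r) :
    ∃ N : Fin 3 → ℕ → ℝ, (∀ i, Tendsto (N i) atTop atTop) ∧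
      ∀ i k, ∀ y ∈ sphere (x k) (r k), u k i y ≤ -N i k - 2 * Real.log (r k) := by
  choose N hN hle using hfast
  refine ⟨N, hN, fun i k y hy => ?_⟩
  have := hle i k y hy
  rw [mem_sphere_iff_norm.1 hy] at this
  linarith

theorem tendsto_exp_sub_mul {N : ℕ → ℝ} (hN : Tendsto N atTop atTop) (a b : ℝ) :
    Tendsto (fun k => Real.exp (a - N k) * b) atTop (𝓝 0) := by
  have h1 : Tendsto (fun k => a - N k) atTop atBot := tendsto_const_nhds.add_atBot
    (tendsto_neg_atTop_atBot.comp hN)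
  simpa using (Real.tendsto_exp_atBot.comp h1).mul_const b

/-- There is no mass in the neck around the disc. -/
theorem eventually_massVector_neck_le (hγ : ∀ i, -1 < γ i)
    (hsol : ∀ k, IsSolution γ (c k) (u k))
    (hC : ∀ᶠ k in atTop, Controlled γ (u k) (S k) n M₀ B K)
    (h0 : ∀ k, (0 : Plane) ∈ S' k) (hS'ball : ∀ k, S' k ⊆ ball (x k) (r k))
    (hball : ∀ k, ball (x k) (r k) ⊆ ball 0 1)
    (hsep : LittleO (fun k => ENNReal.ofReal (r k))
      fun k => setDist (S k \ S' k) (sphere (x k) (r k)))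
    (hfast : ∀ i, FastDecay (fun k => u k i) x r) {R τ : ℝ} (hR : 1 ≤ R) (hτ : 0 < τ) :
    ∀ᶠ k in atTop, ∀ i, massVector (u k) (ball 0 (R * r k) \ ball (x k) (r k)) i ≤ τ := by
  obtain ⟨N, hN, hdec⟩ := exists_fastDecay hfast
  -- Fast decay gives e^{u_i} ≤ e^{osc - N} r^{-2} on the neck, whose area is at most π R² r². The
  -- powers of r cancel.
  have hsmall : ∀ᶠ k in atTop, ∀ i,
      Real.exp (oscConst |γ i| B M₀ K (4 * n * R) - N i k) * (Real.pi * R ^ 2) < τ :=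
    eventually_all.2 fun i => (tendsto_exp_sub_mul (hN i) _ _).eventually (gt_mem_nhds hτ)
  filter_upwards [hC, hsmall, le_dist_of_littleO hsep (R := 2 * R + 4) (by linarith)]
    with k hk hsm hsepk i
  have hr : 0 < r k := dist_nonneg.trans_lt (mem_ball.1 (hS'ball k (h0 k)))
  refine ((hsol k).expMeasure_real_le hγ i (ρ := R * r k)
    (b := oscConst |γ i| B M₀ K (4 * n * R) - N i k - 2 * Real.log (r k))
    (measurableSet_ball.diff measurableSet_ball) (by positivity) Set.sdiff_subset ?_).trans ?_
  · intro z hz hzE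
    obtain ⟨y, hy, hzy⟩ := hk.exists_mem_sphere_abs_sub_le (hsol k) hγ i hr hR (hball k) (h0 k)
      (hS'ball k) hsepk hz hzE.2 (mem_ball_zero_iff.1 hzE.1).le
    have h1 := hdec i k y hy
    have h2 := (abs_le.1 hzy).2
    linarith
  · refine le_trans (le_of_eq ?_) (hsm i).le
    rw [Real.exp_sub, two_mul, Real.exp_add, Real.exp_log hr]
    field_simp

/-- There is no mass away from the origin if the circles do not shrink. -/
theorem eventually_massVector_away_le (hγ : ∀ i, -1 < γ i)
    (hsol : ∀ k, IsSolution γ (c k) (u k)) (hS : IsBlowupSet γ (fun k => u k) p l S)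
    (hC : ∀ᶠ k in atTop, Controlled γ (u k) (S k) n M₀ B K)
    (hball : ∀ k, ball (x k) (r k) ⊆ ball 0 1)
    (hfast : ∀ i, FastDecay (fun k => u k i) x r) {δ t τ : ℝ} (hδ : 0 < δ) (ht : 0 < t)
    (hτ : 0 < τ) :
    ∀ᶠ k in atTop, δ ≤ r k → ∀ i, massVector (u k) (ball 0 1 \ ball 0 t) i ≤ τ := by
  obtain ⟨N, hN, hdec⟩ := exists_fastDecay hfast
  have hsmall : ∀ᶠ k in atTop, ∀ i, Real.exp (oscConst |γ i| B M₀ K (4 / t + 4 * n / δ)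
      - 2 * Real.log δ - N i k) * (Real.pi * 1 ^ 2) < τ :=
    eventually_all.2 fun i => (tendsto_exp_sub_mul (hN i) _ _).eventually (gt_mem_nhds hτ)
  filter_upwards [hC, hsmall, hS.eventually_subset_ball (half_pos ht)] with k hk hsm hSt hδr i
  refine ((hsol k).expMeasure_real_le hγ i (measurableSet_ball.diff measurableSet_ball)
    zero_le_one Set.sdiff_subset ?_).trans (hsm i).le
  intro z hz hzE
  obtain ⟨y, hy, hzy⟩ := hk.exists_mem_sphere_abs_sub_le_of_le_norm (hsol k) hγ i
    (hδ.trans_le hδr) (hball k) ht hSt hz (not_lt.1 fun h => hzE.2 (mem_ball_zero_iff.2 h)) hδ hδr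
  have h1 := hdec i k y hy
  have h2 := (abs_le.1 hzy).2
  have h3 := Real.log_le_log hδ hδr
  linarith

/-- The virial identity for the masses of a separated group of blow-up points. -/
theorem tendsto_virialForm_of_separated (hγ : ∀ i, -1 < γ i)
    (hsol : ∀ k, IsSolution γ (c k) (u k)) (hS : IsBlowupSet γ (fun k => u k) p l S)
    (hM₀ : 0 ≤ M₀) (hB : 0 ≤ B) (hC : ∀ᶠ k in atTop, Controlled γ (u k) (S k) n M₀ B K)
    (h0 : ∀ k, (0 : Plane) ∈ S' k) (hS'ball : ∀ k, S' k ⊆ ball (x k) (r k))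
    (hball : ∀ k, ball (x k) (r k) ⊆ ball 0 1)
    (hsep : LittleO (fun k => ENNReal.ofReal (r k))
      fun k => setDist (S k \ S' k) (sphere (x k) (r k)))
    (hfast : ∀ i, FastDecay (fun k => u k i) x r) :
    Tendsto (fun k => virialForm γ (massVector (u k) (ball (x k) (r k)))) atTop (𝓝 0) := by
  obtain ⟨L, hL, hvir⟩ := exists_virialForm_le hγ hsol hM₀ hB hC
  have hr : ∀ k, 0 < r k := fun k => dist_nonneg.trans_lt (mem_ball.1 (hS'ball k (h0 k)))
  rw [Metric.tendsto_atTop']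
  intro ε hε
  suffices h : ∀ᶠ k in atTop, |virialForm γ (massVector (u k) (ball (x k) (r k)))| < ε by
    obtain ⟨k₀, hk₀⟩ := eventually_atTop.1 h
    exact ⟨k₀, fun k hk => by simpa using hk₀ k hk.le⟩
  -- The error τ + ρ + t/ρ will be at most 4e in both cases. The remaining ε/2 pays, for large
  -- circles, for replacing the disc by a smaller set.
  obtain ⟨e, he, heL⟩ : ∃ e : ℝ, 0 < e ∧ L * (4 * e) < ε / 2 := by
    refine ⟨ε / (16 * (L + 1)), by positivity, ?_⟩
    rw [show L * (4 * (ε / (16 * (L + 1)))) = ε / 4 * (L / (L + 1)) by field_simp; ring]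
    have : L / (L + 1) ≤ 1 := (div_le_one (by positivity)).2 (by linarith)
    nlinarith
  have hneck := fun (R : ℝ) (hR : 1 ≤ R) => eventually_massVector_neck_le hγ hsol hC h0 hS'ball
    hball hsep hfast hR he
  -- The disc lies in B(0, 2r) because it contains 0, so with t = 2r and ρ = R r/4 the ratio t/ρ is
  -- 8/R. The bound 16 ensures t < ρ.
  obtain ⟨R, hR16, hRe⟩ : ∃ R : ℝ, 16 ≤ R ∧ 8 / R ≤ e := by
    refine ⟨max 16 (8 / e), le_max_left _ _, ?_⟩
    rw [div_le_iff₀ (by positivity), mul_comm, ← div_le_iff₀ he]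
    exact le_max_right _ _
  have hR0 : 0 < R := by linarith
  -- For r < δ this choice of ρ is below both 1/16 and e.
  set δ : ℝ := min (1 / (4 * R)) (4 * e / R) with hδ
  have hδ0 : 0 < δ := lt_min (by positivity) (by positivity)
  have hshrink : ∀ᶠ k in atTop, r k < δ →
      |virialForm γ (massVector (u k) (ball (x k) (r k)))| < ε := by
    filter_upwards [hvir, hneck R (by linarith)] with k hk hn hrδ
    have hr1 : r k < 1 / (4 * R) := hrδ.trans_le (min_le_left _ _)
    have hr2 : r k < 4 * e / R := hrδ.trans_le (min_le_right _ _)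
    rw [lt_div_iff₀ (by positivity)] at hr1 hr2
    have hrk := hr k
    have hρt : 2 * r k / (R * r k / 4) = 8 / R := by field_simp; norm_num
    have := hk (ball (x k) (r k)) (R * r k / 4) (2 * r k) e measurableSet_ball (by positivity)
      (by linarith) (by positivity) (by nlinarith) (fun z hz => ?_) (fun i => ?_)
    · rw [hρt] at this
      have h1 : L * (e + R * r k / 4 + 8 / R) ≤ L * (4 * e) :=
        mul_le_mul_of_nonneg_left (by linarith) hL
      linarith
    · have h1 := mem_ball_iff_norm.1 hz
      have h2 := mem_ball_iff_norm.1 (hS'ball k (h0 k))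
      rw [zero_sub, norm_neg] at h2
      have h3 := norm_sub_norm_le z (x k)
      linarith
    · rw [show 4 * (R * r k / 4) = R * r k by ring]
      exact hn i
  obtain ⟨d, hd, hunif⟩ := Metric.uniformContinuousOn_iff.1
    ((isCompact_Icc (a := (0 : Fin 3 → ℝ)) (b := fun _ => M₀)).uniformContinuousOn_of_continuous
      (continuous_virialForm γ).continuousOn) (ε / 2) (by positivity)
  -- For circles with r ≥ δ, ρ is fixed and t = ρ², so t/ρ = ρ ≤ e. The disc is cut down to B(0,
  -- ρ²), which changes its masses by at most d/2. The neck with factor max(1, 1/δ) covers the rest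
  -- of the unit disc.
  set ρ : ℝ := min e (1 / 16) with hρ
  have hρ0 : 0 < ρ := lt_min he (by norm_num)
  have hρ1 : ρ ≤ 1 / 16 := min_le_right _ _
  have haway := eventually_massVector_away_le hγ hsol hS hC hball hfast hδ0 (sq_pos_of_pos hρ0)
    (lt_min he (half_pos hd))
  have hlarge : ∀ᶠ k in atTop, δ ≤ r k →
      |virialForm γ (massVector (u k) (ball (x k) (r k)))| < ε := by
    filter_upwards [hvir, hC, haway, hneck (max 1 (1 / δ)) (le_max_left _ _)]
      with k hk hCk haw hn hδr
    have haw' := haw hδr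
    have hfin := fun i => (hsol k).isFiniteMeasure hγ i
    have hsub1 : ball (0 : Plane) 1 ⊆ ball 0 (max 1 (1 / δ) * r k) := by
      refine ball_subset_ball ?_
      calc (1 : ℝ) = 1 / δ * δ := by field_simp
        _ ≤ max 1 (1 / δ) * r k := mul_le_mul (le_max_right _ _) hδr hδ0.le (by positivity)
    have hM := hk (ball (x k) (r k) ∩ ball 0 (ρ ^ 2)) ρ (ρ ^ 2) (e + e)
      (measurableSet_ball.inter measurableSet_ball) hρ0 (by linarith) (by positivity)
      (by nlinarith) (fun z hz => (mem_ball_zero_iff.1 hz.2).le) (fun i => ?_)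
    · have h1 : dist (massVector (u k) (ball (x k) (r k)))
          (massVector (u k) (ball (x k) (r k) ∩ ball 0 (ρ ^ 2))) < d := by
        refine lt_of_le_of_lt ((dist_pi_le_iff (half_pos hd).le).2 fun i => ?_) (half_lt_self hd)
        have h2 : massVector (u k) (ball (x k) (r k) \ ball 0 (ρ ^ 2)) i ≤ d / 2 := by
          have := hfin i
          refine (measureReal_mono ?_).trans ((haw' i).trans (min_le_right _ _))
          exact Set.sdiff_subset_sdiff_left (hball k)
        have h3 : massVector (u k) (ball (x k) (r k) ∩ ball 0 (ρ ^ 2)) i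
            + massVector (u k) (ball (x k) (r k) \ ball 0 (ρ ^ 2)) i
            = massVector (u k) (ball (x k) (r k)) i := by
          have := hfin i
          exact measureReal_inter_add_sdiff measurableSet_ball
        have h4 : 0 ≤ massVector (u k) (ball (x k) (r k) \ ball 0 (ρ ^ 2)) i :=
          measureReal_nonneg
        rw [Real.dist_eq, abs_le]
        constructor <;> linarith
      have hmem : ∀ M, massVector (u k) M ∈ Set.Icc (0 : Fin 3 → ℝ) (fun _ => M₀) := fun M =>
        hCk.massVector_mem_Icc (hsol k) hγ M
      have h5 := hunif _ (hmem _) _ (hmem _) h1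
      rw [Real.dist_eq] at h5
      have h6 : L * (e + e + ρ + ρ ^ 2 / ρ) ≤ L * (4 * e) := by
        refine mul_le_mul_of_nonneg_left ?_ hL
        have : ρ ^ 2 / ρ = ρ := by field_simp
        have : ρ ≤ e := min_le_left _ _
        linarith
      have h7 := abs_sub_abs_le_abs_sub (virialForm γ (massVector (u k) (ball (x k) (r k))))
        (virialForm γ (massVector (u k) (ball (x k) (r k) ∩ ball 0 (ρ ^ 2))))
      linarith
    · have := hfin i
      have hsub : ball (0 : Plane) (4 * ρ) \ (ball (x k) (r k) ∩ ball 0 (ρ ^ 2))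
          ⊆ (ball 0 (max 1 (1 / δ) * r k) \ ball (x k) (r k)) ∪ (ball 0 1 \ ball 0 (ρ ^ 2)) := by
        intro z hz
        have hz1 : z ∈ ball (0 : Plane) 1 := ball_subset_ball (by linarith) hz.1
        by_cases hzx : z ∈ ball (x k) (r k)
        · exact Or.inr ⟨hz1, fun h => hz.2 ⟨hzx, h⟩⟩
        · exact Or.inl ⟨hsub1 hz1, hzx⟩
      refine (measureReal_mono hsub).trans ((measureReal_union_le _ _).trans ?_)
      exact add_le_add (hn i) ((haw' i).trans (min_le_left _ _))
  filter_upwards [hshrink, hlarge] with k h1 h2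
  rcases lt_or_ge (r k) δ with h | h
  · exact h1 h
  · exact h2 h

end

end

/-! ### Lower bounds on small annuli and subcritical effective masses. -/

section

section kernel

variable {e : Plane → ℝ} {S : Set Plane} {K : ℝ} [IsFiniteMeasure (discMeasure e)] {q C : ℝ}

/-- For an upper bound only the mass in B(0, t) keeps its logarithm. Elsewhere log|x - z| ≤ |x - z|
- 1 ≤ 1. -/
theorem pot_le (hT : Tame (discMeasure e) q C) {x : Plane} (hx : x ∈ closedBall (0 : Plane) 1)
    {t : ℝ} (hxt : ‖x‖ ≤ 2 * t) :
    pot (discMeasure e) x ≤ (discMeasure e).real (ball 0 t) * Real.log (3 * t)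
      + (discMeasure e).real Set.univ := by
  have hi := (integrable_const (μ := discMeasure e) (Real.log (3 * t))).indicator
    (measurableSet_ball (x := (0 : Plane)) (ε := t))
  have h1 : pot (discMeasure e) x ≤ ∫ z, ((ball (0 : Plane) t).indicator
      (fun _ => Real.log (3 * t)) z + 1) ∂(discMeasure e) := by
    refine integral_mono_ae (hT.integrable_log hx) (hi.add (integrable_const 1)) ?_
    filter_upwards [hT.sub_ne_zero x, hT.norm_sub_le hx] with z hz hz2
    have h0 : 0 < ‖x - z‖ := norm_pos_iff.2 hz
    by_cases hzt : z ∈ ball (0 : Plane) t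
    · rw [Set.indicator_of_mem hzt]
      have := Real.log_le_log h0 (show ‖x - z‖ ≤ 3 * t by
        have := mem_ball_zero_iff.1 hzt
        linarith [norm_sub_le x z])
      linarith
    · rw [Set.indicator_of_notMem hzt]
      have := Real.log_le_sub_one_of_pos h0
      linarith
  refine h1.trans (le_of_eq ?_)
  rw [integral_add hi (integrable_const 1), integral_indicator measurableSet_ball]
  simp

/-- Points outside B(0, s) contribute at most -log(s/2), while those in B(0, s) contribute -log(t/4)
up to a correction. The correction is needed only within half the distance from x to S, and is
absorbed in the Newtonian kernel, costing 2πK. The larger radius s decouples the mass that is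
counted from the scale t. -/
theorem neg_pot_le (hm : AEMeasurable e (volume.restrict (ball (0 : Plane) 1)))
    (h0 : ∀ z, 0 ≤ e z) (hK : 0 ≤ K)
    (he : ∀ z ∈ ball (0 : Plane) 1, z ∉ S → e z ≤ K / infDist z S ^ 2)
    (hT : Tame (discMeasure e) q C) {x : Plane} (hx : x ∈ closedBall (0 : Plane) 1) {s t : ℝ}
    (ht : 0 < t) (hts : 4 * t ≤ s) (hs : s ≤ 1) (hxt : ‖x‖ ≤ 2 * t) (hd : t / 2 ≤ infDist x S) :
    -pot (discMeasure e) x ≤ (discMeasure e).real (ball 0 s) * -Real.log (t / 4)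
      + (-Real.log (s / 2) * (discMeasure e).real Set.univ + 2 * Real.pi * K) := by
  set d := infDist x S with hdd
  have hd0 : 0 < d := by linarith
  obtain ⟨hin, hle⟩ := newton_near_le hm h0 hK he hd0
  have hi := (integrable_const (μ := discMeasure e) (-Real.log (t / 4))).indicator
    (measurableSet_ball (x := (0 : Plane)) (ε := s))
  rw [← hdd] at hin hle
  have hi2 : Integrable (fun z => -Real.log (s / 2) + d / 2 *
      (ball x (d / 2)).indicator (fun z => ‖x - z‖⁻¹) z) (discMeasure e) :=
    (integrable_const _).add (hin.const_mul (d / 2))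
  have hind : ∀ z, 0 ≤ (ball x (d / 2)).indicator (fun z => ‖x - z‖⁻¹) z := fun z =>
    Set.indicator_nonneg (fun _ _ => by positivity) z
  have h1 : -pot (discMeasure e) x ≤ ∫ z, ((ball (0 : Plane) s).indicator
      (fun _ => -Real.log (t / 4)) z + (-Real.log (s / 2) + d / 2 *
        (ball x (d / 2)).indicator (fun z => ‖x - z‖⁻¹) z)) ∂(discMeasure e) := by
    rw [pot, ← integral_neg]
    refine integral_mono_ae (hT.integrable_log hx).neg (hi.add hi2) ?_
    filter_upwards [hT.sub_ne_zero x] with z hz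
    have hz0 : 0 < ‖x - z‖ := norm_pos_iff.2 hz
    have hs2 : Real.log (s / 2) ≤ 0 := Real.log_nonpos (by linarith) (by linarith)
    have hpos := mul_nonneg (half_pos hd0).le (hind z)
    by_cases hzs : z ∈ ball (0 : Plane) s
    · rw [Set.indicator_of_mem hzs]
      by_cases hzd : z ∈ ball x (d / 2)
      · rw [Set.indicator_of_mem hzd, ← div_eq_mul_inv]
        have e1 := Real.log_le_sub_one_of_pos (show 0 < t / 4 / ‖x - z‖ by positivity)
        rw [Real.log_div (by positivity) hz0.ne'] at e1
        have e2 : t / 4 / ‖x - z‖ ≤ d / 2 / ‖x - z‖ := by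
          exact div_le_div_of_nonneg_right (by linarith) hz0.le
        linarith
      · rw [mem_ball, dist_comm, dist_eq_norm, not_lt] at hzd
        have := Real.log_le_log (by positivity) (show t / 4 ≤ ‖x - z‖ by linarith)
        linarith
    · rw [Set.indicator_of_notMem hzs]
      have h2 : s / 2 ≤ ‖x - z‖ := by
        rw [mem_ball_zero_iff, not_lt] at hzs
        have := norm_sub_norm_le z x
        rw [norm_sub_rev] at this
        linarith
      have := Real.log_le_log (by linarith) h2
      linarith
  refine h1.trans ?_
  rw [integral_add hi hi2, integral_indicator measurableSet_ball, integral_add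
    (integrable_const _) (hin.const_mul _), integral_const_mul, setIntegral_const, integral_const,
    smul_eq_mul, smul_eq_mul]
  have h3 := mul_le_mul_of_nonneg_left hle (half_pos hd0).le
  have h4 : d / 2 * (4 * Real.pi * K / d) = 2 * Real.pi * K := by field_simp; ring
  linarith

end kernel

/-- The combination of masses that governs the behaviour of `u_i` on a small circle. -/
def effectiveMass (a b : Fin 3 → ℝ) (i : Fin 3) : ℝ :=
  (a i + ∑ j ∈ Finset.univ.erase i, A i j * b j) / (2 * Real.pi)

section

variable {γ : Fin 3 → ℝ} {c : ℝ} {u : Fin 3 → Plane → ℝ} {S : Set Plane} {n : ℕ} {M₀ B K : ℝ}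

theorem A_self (i : Fin 3) : A i i = 1 := by
  fin_cases i <;> simp [A]

theorem A_nonpos {i j : Fin 3} (h : j ≠ i) : A i j ≤ 0 := by
  fin_cases i <;> fin_cases j <;> simp [A] at h ⊢ <;> norm_num

theorem neg_one_le_A {i j : Fin 3} : -1 ≤ A i j := by
  fin_cases i <;> fin_cases j <;> norm_num [A]

/-- Lower bound for a component on an annulus. -/
theorem Controlled.le_of_mem_annulus (hC : Controlled γ u S n M₀ B K) (hu : IsSolution γ c u)
    (hγ : ∀ i, -1 < γ i) (i : Fin 3) {b : ℝ}
    (hb : ∀ x ∈ closedBall (0 : Plane) 1, -b ≤ harmonicPart γ u i x) {s t : ℝ} (ht : 0 < t)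
    (hts : 4 * t ≤ s) (hs : s ≤ 1) (hSt : S ⊆ ball 0 (t / 2)) {x : Plane} (hx1 : t ≤ ‖x‖)
    (hx2 : ‖x‖ ≤ 2 * t) :
    -(b + 2 * |γ i| + (9 * M₀ + 3 * (-Real.log (s / 2) * M₀ + 2 * Real.pi * K)))
      + (effectiveMass (massVector u (ball 0 t)) (massVector u (ball 0 s)) i - 2 * γ i)
        * -Real.log t ≤ u i x := by
  have hx : x ∈ closedBall (0 : Plane) 1 := by
    rw [mem_closedBall_zero_iff]; linarith
  have hx0 : 0 < ‖x‖ := by linarith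
  set Λ := -Real.log t with hΛ
  have hpi := Real.pi_gt_three
  have hM0 : 0 ≤ M₀ := measureReal_nonneg.trans (hC.mass_le 0)
  have hd : t / 2 ≤ infDist x S := le_infDist_of_forall ⟨0, hC.zero_mem⟩ fun q hq => by
    have h1 := mem_ball_zero_iff.1 (hSt hq)
    have h2 := norm_sub_norm_le x q
    rw [dist_eq_norm]
    linarith
  set P : ℝ := -Real.log (s / 2) * M₀ + 2 * Real.pi * K with hP
  have hs2 : 0 ≤ -Real.log (s / 2) := neg_nonneg.2 (Real.log_nonpos (by linarith) (by linarith))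
  have hP0 : 0 ≤ P := by
    have := hC.nonneg
    positivity
  have hmem := fun M => hC.massVector_mem_Icc hu hγ M
  have hl3 : Real.log (3 * t) ≤ 2 - Λ := by
    rw [Real.log_mul (by norm_num) ht.ne']
    have := Real.log_le_sub_one_of_pos (show (0 : ℝ) < 3 by norm_num)
    linarith
  have hl4 : -Real.log (t / 4) ≤ 3 + Λ := by
    rw [Real.log_div ht.ne' (by norm_num)]
    have := Real.log_le_sub_one_of_pos (show (0 : ℝ) < 4 by norm_num)
    linarith
  have hself : pot (expMeasure u i) x ≤ massVector u (ball 0 t) i * -Λ + 3 * M₀ := by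
    have : IsFiniteMeasure (discMeasure fun z => Real.exp (u i z)) := hu.isFiniteMeasure hγ i
    obtain ⟨q, C, hT⟩ := hu.exists_tame hγ i
    have h1 := pot_le hT hx hx2
    have h2 := hC.mass_le i
    have h3 := mul_le_mul_of_nonneg_left hl3 ((hmem (ball 0 t)).1 i)
    have h4 : massVector u (ball 0 t) i ≤ M₀ := (hmem (ball 0 t)).2 i
    change _ ≤ massVector u (ball 0 t) i * _ + (expMeasure u i).real _ at h1
    change pot (expMeasure u i) x ≤ _ at h1
    linarith
  -- The coefficient a_ii = 1 calls for an upper bound of the own potential, with the mass in B(0,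
  -- t). The off-diagonal a_ij ≤ 0 call for lower bounds of the others, with the masses in B(0, s).
  have hother : ∀ j, -pot (expMeasure u j) x ≤ massVector u (ball 0 s) j * Λ + (3 * M₀ + P) := by
    intro j
    have : IsFiniteMeasure (discMeasure fun z => Real.exp (u j z)) := hu.isFiniteMeasure hγ j
    obtain ⟨q, C, hT⟩ := hu.exists_tame hγ j
    have h1 := neg_pot_le (hu.aemeasurable_exp j) (fun _ => (Real.exp_pos _).le) hC.nonneg
      (hC.harnack j) hT hx ht hts hs hx2 hd
    have h2 := mul_le_mul_of_nonneg_left (hC.mass_le j) hs2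
    have h3 := mul_le_mul_of_nonneg_left hl4 ((hmem (ball 0 s)).1 j)
    have h4 : massVector u (ball 0 s) j ≤ M₀ := (hmem (ball 0 s)).2 j
    change _ ≤ massVector u (ball 0 s) j * _ + (_ * (expMeasure u j).real _ + _) at h1
    change -pot (expMeasure u j) x ≤ _ at h1
    linarith
  have hsum : ∑ j, A i j / (2 * Real.pi) * pot (expMeasure u j) x
      ≤ effectiveMass (massVector u (ball 0 t)) (massVector u (ball 0 s)) i * -Λ
        + (9 * M₀ + 3 * P) := by
    have h1 : ∑ j, A i j * pot (expMeasure u j) x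
        ≤ (massVector u (ball 0 t) i
          + ∑ j ∈ Finset.univ.erase i, A i j * massVector u (ball 0 s) j) * -Λ
          + (9 * M₀ + 3 * P) := by
      rw [← Finset.add_sum_erase _ _ (Finset.mem_univ i), A_self, one_mul, add_mul,
        Finset.sum_mul]
      have h2 : ∑ j ∈ Finset.univ.erase i, A i j * pot (expMeasure u j) x
          ≤ ∑ j ∈ Finset.univ.erase i, (A i j * massVector u (ball 0 s) j * -Λ
            + (3 * M₀ + P)) := by
        refine Finset.sum_le_sum fun j hj => ?_
        have hA := A_nonpos (Finset.ne_of_mem_erase hj)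
        have hA1 := neg_one_le_A (i := i) (j := j)
        have := mul_le_mul_of_nonneg_left (hother j) (neg_nonneg.2 hA)
        have h3 : 0 ≤ (1 + A i j) * (3 * M₀ + P) := mul_nonneg (by linarith) (by positivity)
        linarith
      have h3 : (Finset.univ.erase i).card = 2 := by
        rw [Finset.card_erase_of_mem (Finset.mem_univ i)]; rfl
      rw [Finset.sum_add_distrib, Finset.sum_const, h3, nsmul_eq_mul] at h2
      push_cast at h2
      linarith
    have h2 : ∑ j, A i j / (2 * Real.pi) * pot (expMeasure u j) x
        = (∑ j, A i j * pot (expMeasure u j) x) / (2 * Real.pi) := by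
      rw [Finset.sum_div]
      exact Finset.sum_congr rfl fun j _ => by ring
    rw [h2, effectiveMass, div_mul_eq_mul_div, div_le_iff₀ (by positivity), add_mul,
      div_mul_cancel₀ _ (by positivity)]
    have : 9 * M₀ + 3 * P ≤ (9 * M₀ + 3 * P) * (2 * Real.pi) :=
      le_mul_of_one_le_right (by positivity) (by linarith)
    linarith
  have hlogx : |Real.log ‖x‖ + Λ| ≤ 1 := by
    rw [hΛ, ← sub_eq_add_neg, ← Real.log_div hx0.ne' ht.ne', abs_le]
    have h1 : 1 ≤ ‖x‖ / t := (one_le_div ht).2 hx1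
    have h2 : ‖x‖ / t ≤ 2 := (div_le_iff₀ ht).2 hx2
    constructor
    · linarith [Real.log_nonneg h1]
    · linarith [Real.log_le_sub_one_of_pos (show 0 < ‖x‖ / t by positivity)]
  have hg : -(2 * |γ i|) - 2 * γ i * Λ ≤ 2 * γ i * Real.log ‖x‖ := by
    have h1 : |2 * γ i * (Real.log ‖x‖ + Λ)| ≤ 2 * |γ i| := by
      rw [abs_mul, abs_mul, abs_two]
      exact mul_le_of_le_one_right (by positivity) hlogx
    linarith [(abs_le.1 h1).1]
  rw [eq_harmonicPart γ u i x]
  linarith [hb x hx]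

/-- Finiteness of the mass of a small annulus bounds the effective mass inside it. -/
theorem Controlled.effectiveMass_mul_log_le (hC : Controlled γ u S n M₀ B K)
    (hu : IsSolution γ c u) (hγ : ∀ i, -1 < γ i) (i : Fin 3) {b : ℝ}
    (hb : ∀ x ∈ closedBall (0 : Plane) 1, -b ≤ harmonicPart γ u i x) {s t : ℝ} (ht : 0 < t)
    (hts : 4 * t ≤ s) (hs : s ≤ 1) (hSt : S ⊆ ball 0 (t / 2)) :
    (effectiveMass (massVector u (ball 0 t)) (massVector u (ball 0 s)) i - (2 + 2 * γ i))
      * -Real.log t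
      ≤ b + 2 * |γ i| + (9 * M₀ + 3 * (-Real.log (s / 2) * M₀ + 2 * Real.pi * K)) + M₀ := by
  set D := b + 2 * |γ i| + (9 * M₀ + 3 * (-Real.log (s / 2) * M₀ + 2 * Real.pi * K)) with hD
  set E := effectiveMass (massVector u (ball 0 t)) (massVector u (ball 0 s)) i with hE
  set w := -D + (E - 2 * γ i) * -Real.log t with hw
  have hpi := Real.pi_gt_three
  have hfin := hu.isFiniteMeasure hγ i
  have hms : MeasurableSet (ball (0 : Plane) (2 * t) \ ball 0 t) :=
    measurableSet_ball.diff measurableSet_ball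
  have hsub : ball (0 : Plane) (2 * t) \ ball 0 t ⊆ ball 0 1 :=
    Set.sdiff_subset.trans (ball_subset_ball (by linarith))
  have hvol : volume.real (ball (0 : Plane) (2 * t) \ ball 0 t) = 3 * Real.pi * t ^ 2 := by
    rw [measureReal_sdiff (ball_subset_ball (by linarith)) measurableSet_ball
      measure_ball_lt_top.ne, volume_real_ball 0 (by positivity), volume_real_ball 0 ht.le]
    ring
  have h1 : Real.exp w * (3 * Real.pi * t ^ 2) ≤ M₀ := by
    calc Real.exp w * (3 * Real.pi * t ^ 2)
        = ∫ _z in ball (0 : Plane) (2 * t) \ ball 0 t, Real.exp w := by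
          rw [setIntegral_const, hvol, smul_eq_mul, mul_comm]
      _ ≤ ∫ z in ball (0 : Plane) (2 * t) \ ball 0 t, Real.exp (u i z) := by
          refine setIntegral_mono_on (integrableOn_const
            ((measure_mono Set.sdiff_subset).trans_lt measure_ball_lt_top).ne)
            ((hu.integrableOn_exp hγ i).mono_set hsub) hms fun z hz => Real.exp_le_exp.2 ?_
          exact hC.le_of_mem_annulus hu hγ i hb ht hts hs hSt
            (not_lt.1 fun h => hz.2 (mem_ball_zero_iff.2 h)) (mem_ball_zero_iff.1 hz.1).le
      _ = (expMeasure u i).real (ball (0 : Plane) (2 * t) \ ball 0 t) := by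
          rw [hu.expMeasure_real i hms, Set.inter_eq_right.2 hsub]
      _ ≤ M₀ := (measureReal_mono (Set.subset_univ _)).trans (hC.mass_le i)
  -- The area 3πt² of the annulus exceeds t² = e^{2 log t}. Turning the integral bound into a bound
  -- on the exponent by y + 1 ≤ e^y produces the summand 2 in 2 + 2γ_i.
  have h2 : Real.exp (w + 2 * Real.log t) ≤ M₀ := by
    rw [Real.exp_add w, two_mul (Real.log t), Real.exp_add (Real.log t), Real.exp_log ht, ← sq]
    refine le_trans ?_ h1
    have : 0 ≤ Real.exp w * t ^ 2 := by positivity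
    nlinarith
  have h3 := Real.add_one_le_exp (w + 2 * Real.log t)
  linarith

end

end

/-! ### The homogeneous constraint: vanishing of the local masses. -/

section

/-- Non-negative limits of local masses around the origin vanish if they satisfy the virial identity
and if the effective masses are subcritical. -/
theorem eq_zero_of_virialForm_eq_zero {γ a : Fin 3 → ℝ} (hγ : ∀ i, -1 < γ i) (ha : ∀ i, 0 ≤ a i)
    (h : virialForm γ a = 0) (hE : ∀ i, effectiveMass a a i ≤ 2 + 2 * γ i) (i : Fin 3) :
    a i = 0 := by
  -- By a_ii = 1 the quadratic part is half the weighted sum of a_i times the effective mass.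
  -- Subcriticality makes each bracket at least 1 + γ_i > 0, so a sum of non-negative terms
  -- vanishes.
  have hform : virialForm γ a
      = ∑ i, wt i * a i * (2 + 2 * γ i - 1 / 2 * effectiveMass a a i) := by
    rw [virialForm, Finset.mul_sum, ← Finset.sum_sub_distrib]
    refine Finset.sum_congr rfl fun i _ => ?_
    have h1 : ∑ j, wt i * A i j / (2 * Real.pi) * (a i * a j)
        = wt i * a i * effectiveMass a a i := by
      rw [effectiveMass, show a i = A i i * a i by rw [A_self, one_mul],
        Finset.add_sum_erase _ (fun j => A i j * a j) (Finset.mem_univ i), A_self, one_mul,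
        Finset.sum_div, Finset.mul_sum]
      exact Finset.sum_congr rfl fun j _ => by ring
    rw [h1]; ring
  have hnn : ∀ i, 0 ≤ wt i * a i * (2 + 2 * γ i - 1 / 2 * effectiveMass a a i) := fun i =>
    mul_nonneg (mul_nonneg (wt_pos i).le (ha i)) (by linarith [hE i, hγ i])
  rw [h] at hform
  have h2 := (Finset.sum_eq_zero_iff_of_nonneg fun i _ => hnn i).1 hform.symm i (Finset.mem_univ i)
  rcases mul_eq_zero.1 h2 with h3 | h3
  · exact (mul_eq_zero.1 h3).resolve_left (wt_pos i).ne'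
  · linarith [hE i, hγ i]

theorem continuous_effectiveMass (i : Fin 3) :
    Continuous fun q : (Fin 3 → ℝ) × (Fin 3 → ℝ) => effectiveMass q.1 q.2 i := by
  unfold effectiveMass
  fun_prop

section

variable {γ : Fin 3 → ℝ} {u : ℕ → Fin 3 → Plane → ℝ} {m : ℕ}
  {p : ℕ → Fin m → Plane} {l : ℕ → Fin m → ℝ} {S S' : ℕ → Set Plane} {n : ℕ} {M₀ B K : ℝ}
  {x : ℕ → Plane} {r : ℕ → ℝ}

/-- If the constraint is homogeneous, the circles of fast decay shrink. -/
theorem eventually_radius_lt (hsol : ∀ k, IsSolution γ 0 (u k))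
    (h0 : ∀ k, (0 : Plane) ∈ ball (x k) (r k)) (hball : ∀ k, ball (x k) (r k) ⊆ ball 0 1)
    (hfast : ∀ i, FastDecay (fun k => u k i) x r) {δ : ℝ} (hδ : 0 < δ) :
    ∀ᶠ k in atTop, r k < δ := by
  obtain ⟨N, hN, hdec⟩ := exists_fastDecay hfast
  -- For such k, a circle with r ≥ δ would carry only negative values of all three components,
  -- against u_1 + u_2 + 2u_3 = 0.
  have hlarge : ∀ᶠ k in atTop, ∀ i, -2 * Real.log δ < N i k :=
    eventually_all.2 fun i => (hN i).eventually_gt_atTop _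
  filter_upwards [hlarge] with k hk
  by_contra! hr
  have hr0 : 0 < r k := hδ.trans_le hr
  obtain ⟨y, hy⟩ := (NormedSpace.sphere_nonempty (x := x k)).2 hr0.le
  have hy0 : y ≠ 0 := by
    rintro rfl
    exact (mem_ball.1 (h0 k)).ne (mem_sphere.1 hy)
  have hsum := (hsol k).constraint_closedBall
    (sphere_subset_closedBall_of_ball hr0 (hball k) hy) hy0
  have hneg : ∀ i, u k i y < 0 := fun i => by
    have h1 := hdec i k y hy
    have h2 := hk i
    have h3 := Real.log_le_log hδ hr
    linarith
  linarith [hneg 0, hneg 1, hneg 2]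

/-- If the constraint is homogeneous, the harmonic parts are bounded below. -/
theorem exists_neg_le_harmonicPart (hγ : ∀ i, -1 < γ i) (hsol : ∀ k, IsSolution γ 0 (u k))
    (hu : IsBlowupSequence γ u) (hS : IsBlowupSet γ u p l S)
    (hC : ∀ᶠ k in atTop, Controlled γ (u k) (S k) n M₀ B K) :
    ∃ b : ℝ, ∀ᶠ k in atTop, ∀ i, ∀ x ∈ closedBall (0 : Plane) 1,
      -b ≤ harmonicPart γ (u k) i x := by
  set w : Plane := (1 / 2 : ℝ) • basisVec 0 with hw
  have hwn : ‖w‖ = 1 / 2 := by simp [hw, basisVec, norm_smul]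
  have hw0 : w ≠ 0 := norm_ne_zero_iff.1 (by rw [hwn]; norm_num)
  have hwb : w ∈ ball (0 : Plane) 1 := by rw [mem_ball_zero_iff, hwn]; norm_num
  have hwc := ball_subset_closedBall hwb
  obtain ⟨C, hCw⟩ := hu.bounded_away {w} isCompact_singleton
    (Set.singleton_subset_iff.2 ⟨hwb, hw0⟩)
  set P : ℝ := Real.log (3 * 1) * M₀ + M₀ + (-Real.log ((1 / 4) / 4) * M₀
    + (-Real.log (1 / 2) * M₀ + 2 * Real.pi * K)) with hP
  set G : ℝ := |γ 0| + |γ 1| + |γ 2| with hG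
  refine ⟨3 * |C| + 2 * G + P + 2 * B, ?_⟩
  filter_upwards [hC, hS.eventually_subset_ball (s := 1 / 4) (by norm_num)] with k hk hSk i x hx
  have hM0 : 0 ≤ M₀ := measureReal_nonneg.trans (hk.mass_le 0)
  have hK := hk.nonneg
  have hl3 : 0 ≤ Real.log (3 * 1) := Real.log_nonneg (by norm_num)
  have hl16 : 0 ≤ -Real.log ((1 / 4) / 4) :=
    neg_nonneg.2 (Real.log_nonpos (by norm_num) (by norm_num))
  have hl2 : 0 ≤ -Real.log (1 / 2) :=
    neg_nonneg.2 (Real.log_nonpos (by norm_num) (by norm_num))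
  have hpi := Real.pi_pos
  -- Each component is at most |C| at w and the weighted sum with weights 1, 1, 2 is zero, so each
  -- component is at least -3|C|.
  have hlow : -(3 * |C|) ≤ u k i w := by
    have hsum := (hsol k).constraint_closedBall hwc hw0
    have hle : ∀ j, u k j w ≤ |C| := fun j => (hCw k j w rfl).trans (le_abs_self C)
    have := hle 0; have := hle 1; have := hle 2; have := abs_nonneg C
    fin_cases i <;> simp only [Fin.zero_eta, Fin.mk_one, Fin.reduceFinMk] <;> linarith
  have hd : 1 / 4 / 2 ≤ infDist w (S k) := le_infDist_of_forall ⟨0, hk.zero_mem⟩ fun q hq => by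
    have h1 := mem_ball_zero_iff.1 (hSk hq)
    have h2 := norm_sub_norm_le w q
    rw [dist_eq_norm]
    linarith
  have hpot : ∀ j, |pot (expMeasure (u k) j) w| ≤ P := by
    intro j
    have : IsFiniteMeasure (discMeasure fun z => Real.exp (u k j z)) :=
      (hsol k).isFiniteMeasure hγ j
    obtain ⟨q, C, hT⟩ := (hsol k).exists_tame hγ j
    have hm : ∀ s, (discMeasure fun z => Real.exp (u k j z)).real s ≤ M₀ := fun s =>
      (measureReal_mono (Set.subset_univ _)).trans (hk.mass_le j)
    have h1 := pot_le hT hwc (t := 1) (by rw [hwn]; norm_num)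
    have h2 := neg_pot_le ((hsol k).aemeasurable_exp j) (fun _ => (Real.exp_pos _).le) hK
      (hk.harnack j) hT hwc (s := 1) (t := 1 / 4) (by norm_num) (by norm_num) le_rfl
      (by rw [hwn]; norm_num) hd
    have h3 := mul_le_mul_of_nonneg_right (hm (ball 0 1)) hl3
    have h4 := hm Set.univ
    have h5 := mul_le_mul_of_nonneg_right (hm (ball 0 1)) hl16
    have h6 := mul_le_mul_of_nonneg_left (hm Set.univ) hl2
    have h7 : 0 ≤ Real.log (3 * 1) * M₀ := by positivity
    have h8 : 0 ≤ -Real.log ((1 / 4) / 4) * M₀ := by positivity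
    have h9 : 0 ≤ -Real.log (1 / 2) * M₀ := by positivity
    have h10 : 0 ≤ 2 * Real.pi * K := by positivity
    change pot (expMeasure (u k) j) w ≤ _ at h1
    change -pot (expMeasure (u k) j) w ≤ _ at h2
    rw [abs_le, hP]
    generalize Real.log (3 * 1) = y₁ at h1 h3 h7 ⊢
    generalize Real.log ((1 / 4) / 4) = y₂ at h2 h5 h8 ⊢
    generalize Real.log (1 / 2) = y₃ at h2 h6 h9 ⊢
    constructor <;> linarith
  have hsum : |∑ j, A i j / (2 * Real.pi) * pot (expMeasure (u k) j) w| ≤ P := by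
    refine (Finset.abs_sum_le_sum_abs _ _).trans ?_
    calc _ ≤ ∑ j, |A i j / (2 * Real.pi)| * P := Finset.sum_le_sum fun j _ => by
          rw [abs_mul]
          exact mul_le_mul_of_nonneg_left (hpot j) (abs_nonneg _)
      _ ≤ 1 * P := by
          rw [← Finset.sum_mul]
          exact mul_le_mul_of_nonneg_right (sum_abs_A_le i) ((abs_nonneg _).trans (hpot 0))
      _ = P := one_mul P
  have hlogw : |2 * γ i * Real.log ‖w‖| ≤ 2 * G := by
    have h1 : |Real.log ‖w‖| ≤ 1 := by
      rw [hwn, abs_le]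
      constructor
      · have := Real.log_le_sub_one_of_pos (show (0 : ℝ) < 2 by norm_num)
        rw [one_div, Real.log_inv]
        linarith
      · linarith
    have h2 : |γ i| ≤ G := by
      have := abs_nonneg (γ 0); have := abs_nonneg (γ 1); have := abs_nonneg (γ 2)
      fin_cases i <;> simp only [Fin.zero_eta, Fin.mk_one, Fin.reduceFinMk] <;> linarith
    rw [abs_mul, abs_mul, abs_two]
    calc 2 * |γ i| * |Real.log ‖w‖| ≤ 2 * |γ i| * 1 := by gcongr
      _ ≤ 2 * G := by linarith
  have heq := eq_harmonicPart γ (u k) i w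
  obtain ⟨b, hb⟩ := hk.osc i
  have h1 := (abs_le.1 (hb w hwc)).2
  have h2 := (abs_le.1 (hb x hx)).1
  have h3 := (abs_le.1 hsum).1
  have h4 := (abs_le.1 hlogw).2
  linarith

/-- If the constraint is homogeneous, no mass concentrates at the origin. -/
theorem tendsto_massVector_zero (hγ : ∀ i, -1 < γ i) (hsol : ∀ k, IsSolution γ 0 (u k))
    (hu : IsBlowupSequence γ u) (hS : IsBlowupSet γ u p l S) (hM₀ : 0 ≤ M₀) (hB : 0 ≤ B)
    (hC : ∀ᶠ k in atTop, Controlled γ (u k) (S k) n M₀ B K)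
    (h0 : ∀ k, (0 : Plane) ∈ ball (x k) (r k)) (hball : ∀ k, ball (x k) (r k) ⊆ ball 0 1)
    (hfast : ∀ i, FastDecay (fun k => u k i) x r) :
    Tendsto (fun k => massVector (u k) (ball (x k) (r k))) atTop (𝓝 0) := by
  -- Along an ultrafilter the bounded masses of B(0, s) converge for all radii s simultaneously, so
  -- no diagonal subsequence is needed.
  rw [tendsto_iff_ultrafilter]
  intro 𝒰 h𝒰
  obtain ⟨L, hL, hvir⟩ := exists_virialForm_le hγ hsol hM₀ hB hC
  obtain ⟨b, hb⟩ := exists_neg_le_harmonicPart hγ hsol hu hS hC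
  have hlim : ∀ s, ∃ a : Fin 3 → ℝ, Tendsto (fun k => massVector (u k) (ball 0 s)) 𝒰 (𝓝 a) := by
    intro s
    have hmem : ∀ᶠ k in 𝒰, massVector (u k) (ball 0 s) ∈ Set.Icc (0 : Fin 3 → ℝ) fun _ => M₀ :=
      h𝒰 (hC.mono fun k hk => hk.massVector_mem_Icc (hsol k) hγ _)
    obtain ⟨a, -, ha⟩ := isCompact_Icc.ultrafilter_le_nhds
      (𝒰.map fun k => massVector (u k) (ball 0 s)) (le_principal_iff.2 hmem)
    exact ⟨a, ha⟩
  choose F hF using hlim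
  have hFi : ∀ s i, Tendsto (fun k => massVector (u k) (ball 0 s) i) 𝒰 (𝓝 (F s i)) := fun s i =>
    (tendsto_pi_nhds.1 (hF s)) i
  have hmono : ∀ i, Monotone fun s => F s i := fun i s t hst =>
    le_of_tendsto_of_tendsto' (hFi s i) (hFi t i) fun k =>
      massVector_mono (hsol k) hγ (ball_subset_ball hst) i
  have hF0 : ∀ s i, 0 ≤ F s i := fun s i =>
    ge_of_tendsto' (hFi s i) fun k => measureReal_nonneg
  -- By monotonicity in s this is the limit as s → 0: the mass concentrated at the origin.
  set a : Fin 3 → ℝ := fun i => sInf ((fun s => F s i) '' Set.Ioi 0) with ha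
  have hFa : Tendsto F (𝓝[>] 0) (𝓝 a) :=
    tendsto_pi_nhds.2 fun i => (hmono i).tendsto_nhdsGT 0
  have hFai : ∀ i, Tendsto (fun s => F s i) (𝓝[>] 0) (𝓝 (a i)) := tendsto_pi_nhds.1 hFa
  have ha0 : ∀ i, 0 ≤ a i := fun i => ge_of_tendsto' (hFai i) fun s => hF0 s i
  have hid : Tendsto (fun t : ℝ => t) (𝓝[>] 0) (𝓝 0) := nhdsWithin_le_nhds
  have hvirF : ∀ ρ t, 0 < t → t < ρ → ρ < 1 / 8 →
      |virialForm γ (F t)| ≤ L * (∑ i, (F (4 * ρ) i - F t i) + ρ + t / ρ) := by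
    intro ρ t ht htρ hρ
    have h1 : Tendsto (fun k => |virialForm γ (massVector (u k) (ball 0 t))|) 𝒰
        (𝓝 |virialForm γ (F t)|) :=
      (((continuous_virialForm γ).tendsto _).comp (hF t)).abs
    have h2 : Tendsto (fun k => L * (∑ i, (massVector (u k) (ball 0 (4 * ρ)) i
        - massVector (u k) (ball 0 t) i) + ρ + t / ρ)) 𝒰
        (𝓝 (L * (∑ i, (F (4 * ρ) i - F t i) + ρ + t / ρ))) :=
      (((tendsto_finsetSum _ fun i _ => (hFi (4 * ρ) i).sub (hFi t i)).add_const ρ).add_const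
        (t / ρ)).const_mul L
    refine le_of_tendsto_of_tendsto h1 h2 ((hvir.filter_mono h𝒰).mono fun k hk => ?_)
    refine hk (ball 0 t) ρ t _ measurableSet_ball (ht.trans htρ) hρ ht.le htρ
      (fun z hz => (mem_ball_zero_iff.1 hz).le) fun i => ?_
    have hsub : ball (0 : Plane) t ⊆ ball 0 (4 * ρ) := ball_subset_ball (by linarith)
    have h3 : massVector (u k) (ball 0 (4 * ρ) \ ball 0 t) i
        = massVector (u k) (ball 0 (4 * ρ)) i - massVector (u k) (ball 0 t) i := by
      have := (hsol k).isFiniteMeasure hγ i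
      exact measureReal_sdiff hsub measurableSet_ball
    rw [h3]
    exact Finset.single_le_sum (f := fun i => massVector (u k) (ball 0 (4 * ρ)) i
      - massVector (u k) (ball 0 t) i)
      (fun j _ => sub_nonneg.2 (massVector_mono (hsol k) hγ hsub j)) (Finset.mem_univ i)
  -- The limits are taken in the order k → ∞, then t → 0 to remove t/ρ, then ρ → 0, when the mass of
  -- the annulus disappears because F(4ρ) tends to a.
  have hvira : virialForm γ a = 0 := by
    have h1 : ∀ ρ, 0 < ρ → ρ < 1 / 8 →
        |virialForm γ a| ≤ L * (∑ i, (F (4 * ρ) i - a i) + ρ + 0 / ρ) := by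
      intro ρ hρ0 hρ
      refine le_of_tendsto_of_tendsto (((continuous_virialForm γ).tendsto _).comp hFa).abs
        ((((tendsto_finsetSum _ fun i _ => (hFai i).const_sub (F (4 * ρ) i)).add_const
          ρ).add (hid.div_const ρ)).const_mul L) ?_
      filter_upwards [self_mem_nhdsWithin, hid.eventually (gt_mem_nhds hρ0)] with t ht htρ
      exact hvirF ρ t ht htρ hρ
    have h4 : Tendsto (fun ρ : ℝ => 4 * ρ) (𝓝[>] 0) (𝓝[>] 0) := by
      refine tendsto_nhdsWithin_iff.2 ⟨by simpa using hid.const_mul 4, ?_⟩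
      filter_upwards [self_mem_nhdsWithin] with ρ hρ
      exact mul_pos (four_pos : (0 : ℝ) < 4) (Set.mem_Ioi.1 hρ)
    have h2 : Tendsto (fun ρ => L * (∑ i, (F (4 * ρ) i - a i) + ρ + 0 / ρ)) (𝓝[>] 0)
        (𝓝 (L * (∑ i, (a i - a i) + 0 + 0))) :=
      (((tendsto_finsetSum _ fun i _ => ((hFai i).comp h4).sub_const (a i)).add hid).add
        (show Tendsto (fun ρ : ℝ => 0 / ρ) (𝓝[>] 0) (𝓝 0) by simp)).const_mul L
    have h3 : |virialForm γ a| ≤ L * (∑ i, (a i - a i) + 0 + 0) := by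
      refine ge_of_tendsto h2 ?_
      filter_upwards [self_mem_nhdsWithin,
        hid.eventually (gt_mem_nhds (show (0 : ℝ) < 1 / 8 by norm_num))] with ρ hρ0 hρ
      exact h1 ρ hρ0 hρ
    simpa using h3
  -- The bound Q does not depend on t while -log t → +∞, so the coefficient of -log t cannot have a
  -- positive limit. The radius s is kept fixed here, since Q depends on it, and is sent to 0
  -- afterwards.
  have hE1 : ∀ s, 0 < s → s ≤ 1 → ∀ i, effectiveMass a (F s) i ≤ 2 + 2 * γ i := by
    intro s hs0 hs i
    set Q : ℝ := b + 2 * |γ i| + (9 * M₀ + 3 * (-Real.log (s / 2) * M₀ + 2 * Real.pi * K)) + M₀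
      with hQ
    have h1 : ∀ t, 0 < t → 4 * t ≤ s →
        (effectiveMass (F t) (F s) i - (2 + 2 * γ i)) * -Real.log t ≤ Q := by
      intro t ht hts
      have hlim : Tendsto (fun k => (effectiveMass (massVector (u k) (ball 0 t))
          (massVector (u k) (ball 0 s)) i - (2 + 2 * γ i)) * -Real.log t) 𝒰
          (𝓝 ((effectiveMass (F t) (F s) i - (2 + 2 * γ i)) * -Real.log t)) :=
        (((((continuous_effectiveMass i).tendsto (F t, F s)).comp
          ((hF t).prodMk_nhds (hF s))).sub_const _).mul_const _)
      refine le_of_tendsto hlim (h𝒰 ?_)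
      filter_upwards [hC, hb, hS.eventually_subset_ball (half_pos ht)] with k hk hbk hSk
      exact hk.effectiveMass_mul_log_le (hsol k) hγ i (hbk i) ht hts hs hSk
    have h2 : Tendsto (fun t => effectiveMass (F t) (F s) i - (2 + 2 * γ i)) (𝓝[>] 0)
        (𝓝 (effectiveMass a (F s) i - (2 + 2 * γ i))) :=
      (((continuous_effectiveMass i).tendsto (a, F s)).comp
        (hFa.prodMk_nhds tendsto_const_nhds)).sub_const _
    by_contra! hlt
    have h3 : Tendsto (fun t => (effectiveMass (F t) (F s) i - (2 + 2 * γ i)) * -Real.log t)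
        (𝓝[>] 0) atTop :=
      h2.pos_mul_atTop (by linarith)
        (tendsto_neg_atBot_atTop.comp Real.tendsto_log_nhdsGT_zero)
    have h4 : ∀ᶠ t : ℝ in 𝓝[>] 0, t < s / 4 := hid.eventually (gt_mem_nhds (by positivity))
    obtain ⟨t, ht, ht4, ht0⟩ :=
      ((h3.eventually_gt_atTop Q).and (h4.and self_mem_nhdsWithin)).exists
    exact absurd (h1 t ht0 (by linarith)) (not_le.2 ht)
  have hE : ∀ i, effectiveMass a a i ≤ 2 + 2 * γ i := by
    intro i
    have h2 : Tendsto (fun s => effectiveMass a (F s) i) (𝓝[>] 0) (𝓝 (effectiveMass a a i)) :=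
      ((continuous_effectiveMass i).tendsto (a, a)).comp (tendsto_const_nhds.prodMk_nhds hFa)
    refine le_of_tendsto h2 ?_
    filter_upwards [self_mem_nhdsWithin, hid.eventually (gt_mem_nhds one_pos)] with s hs0 hs1
    exact hE1 s hs0 hs1.le i
  have haz := eq_zero_of_virialForm_eq_zero hγ ha0 hvira hE
  -- The disc B(x_k, r_k) contains 0 and its radius tends to 0, so it eventually lies in any fixed
  -- B(0, s), whose limiting mass is as small as desired.
  refine tendsto_pi_nhds.2 fun i => tendsto_order.2 ⟨fun e he => ?_, fun e he => ?_⟩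
  · exact Eventually.of_forall fun k => lt_of_lt_of_le he measureReal_nonneg
  · have h1 := hFai i
    rw [haz i] at h1
    obtain ⟨s, hse, hs0⟩ := ((h1.eventually (gt_mem_nhds he)).and self_mem_nhdsWithin).exists
    have hs0' : (0 : ℝ) < s := hs0
    filter_upwards [(hFi s i).eventually (gt_mem_nhds hse),
      (eventually_radius_lt hsol h0 hball hfast (half_pos hs0')).filter_mono h𝒰] with k hk hrk
    refine lt_of_le_of_lt (massVector_mono (hsol k) hγ (fun z hz => ?_) i) hk
    have h2 := mem_ball_iff_norm.1 hz
    have h3 := mem_ball_iff_norm.1 (h0 k)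
    rw [zero_sub, norm_neg] at h3
    have h4 := norm_sub_norm_le z (x k)
    rw [mem_ball_zero_iff]
    linarith

end

end

/-! ### From the virial form to the Pohozaev identity. -/

theorem massVector_ball_eq {γ : Fin 3 → ℝ} {c : ℝ} {u : Fin 3 → Plane → ℝ}
    (hu : IsSolution γ c u) {x : Plane} {r : ℝ} (h : ball x r ⊆ ball 0 1) (i : Fin 3) :
    massVector u (ball x r) i = 2 * Real.pi * mass (u i) x r := by
  rw [massVector, hu.expMeasure_real i measurableSet_ball, Set.inter_eq_right.2 h, mass]
  field_simp

/-- The symmetrised matrix w_i a_ij is the matrix of (s_1 - s_3)² + (s_2 - s_3)². Completing the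
squares by γ_1 and γ_2 gives the right linear term exactly because 2γ_3 = -(γ_1 + γ_2). -/
theorem pohozaev_eq_virialForm {γ a s : Fin 3 → ℝ} (hγ : γ 0 + γ 1 + 2 * γ 2 = 0)
    (ha : ∀ i, a i = 2 * Real.pi * s i) :
    ((s 0 - s 2 - 2 * γ 0) ^ 2 + (s 1 - s 2 - 2 * γ 1) ^ 2)
      - (4 * (s 0 + s 1 + 2 * s 2) + 4 * (γ 0 ^ 2 + γ 1 ^ 2))
      = -(1 / Real.pi) * virialForm γ a := by
  have h2 : γ 2 = -(γ 0 + γ 1) / 2 := by linarith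
  have hpi := Real.pi_pos
  simp only [virialForm, Fin.sum_univ_three, ha, wt, A, h2, Matrix.cons_val, Matrix.of_apply]
  field_simp
  ring

end AffineToda

end

theorem proposition2p5
    (γ : Fin 3 → ℝ) (hγ : ∀ i, -1 < γ i)
    (c : ℕ → ℝ) (hc : BddAbove (Set.range c))
    (u : ℕ → Fin 3 → AffineToda.Plane → ℝ)
    (hsol : ∀ k, AffineToda.IsSolution γ (c k) (u k))
    (hu : AffineToda.IsBlowupSequence γ u)
    (m : ℕ) (p : ℕ → Fin m → AffineToda.Plane) (l : ℕ → Fin m → ℝ)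
    (S : ℕ → Set AffineToda.Plane) (hS : AffineToda.IsBlowupSet γ u p l S)
    (S' : ℕ → Set AffineToda.Plane) (x : ℕ → AffineToda.Plane) (r : ℕ → ℝ)
    (hS'S : ∀ k, S' k ⊆ S k) (h0 : ∀ k, (0 : AffineToda.Plane) ∈ S' k)
    (hS'ball : ∀ k, S' k ⊆ Metric.ball (x k) (r k))
    (hball : ∀ k, Metric.ball (x k) (r k) ⊆ Metric.ball 0 1)
    (hsep : AffineToda.LittleO
      (fun k => AffineToda.setDist (S' k) (Metric.sphere (x k) (r k)))
      (fun k => AffineToda.setDist (S k \ S' k) (Metric.sphere (x k) (r k))))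
    (hsep' : (∀ k, c k = 0) ∨ AffineToda.LittleO
      (fun k => ENNReal.ofReal (r k))
      (fun k => AffineToda.setDist (S k \ S' k) (Metric.sphere (x k) (r k))))
    (hfast : ∀ i, AffineToda.FastDecay (fun k => u k i) x r)
    (σ : ℕ → Fin 3 → ℝ) (hσ : ∀ k i, σ k i = AffineToda.mass (u k i) (x k) (r k))
    (μ : Fin 3 → ℝ) (hμ : ∀ i, μ i = 1 + γ i) :
    Filter.Tendsto
      (fun k => ((σ k 0 - σ k 2 - 2 * γ 0) ^ 2 + (σ k 1 - σ k 2 - 2 * γ 1) ^ 2)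
        - (4 * (σ k 0 + σ k 1 + 2 * σ k 2) + 4 * (γ 0 ^ 2 + γ 1 ^ 2)))
      Filter.atTop (nhds 0) ∧
    μ 0 + μ 1 + 2 * μ 2 = 4 ∧
    ∀ (φ : ℕ → ℕ) (s : Fin 3 → ℝ), StrictMono φ →
      (∀ i, Filter.Tendsto (fun k => σ (φ k) i) Filter.atTop (nhds (s i))) →
      (s 0 - s 2) ^ 2 + (s 1 - s 2) ^ 2 = 4 * (μ 0 * s 0 + μ 1 * s 1 + 2 * μ 2 * s 2) := by
  have hγ0 := (hsol 0).weights_eq_zero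
  obtain ⟨M₀, B, K, hM₀, hB, hC⟩ :=
    hS.exists_controlled hγ hsol hu fun k => hS'S k (h0 k)
  have hvir : Filter.Tendsto (fun k => AffineToda.virialForm γ
      (AffineToda.massVector (u k) (Metric.ball (x k) (r k)))) Filter.atTop (nhds 0) := by
    -- For the homogeneous constraint the masses tend to 0, where the form vanishes. Otherwise the
    -- strong separation of the circle from the remaining blow-up points is available.
    rcases hsep' with hc0 | hsep'
    · have hlim := AffineToda.tendsto_massVector_zero hγ (fun k => hc0 k ▸ hsol k) hu hS hM₀ hB hC
        (fun k => hS'ball k (h0 k)) hball hfast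
      have h := ((AffineToda.continuous_virialForm γ).tendsto 0).comp hlim
      rwa [show AffineToda.virialForm γ 0 = 0 by simp [AffineToda.virialForm]] at h
    · exact AffineToda.tendsto_virialForm_of_separated hγ hsol hS hM₀ hB hC h0 hS'ball hball
        hsep' hfast
  have hmain : Filter.Tendsto
      (fun k => ((σ k 0 - σ k 2 - 2 * γ 0) ^ 2 + (σ k 1 - σ k 2 - 2 * γ 1) ^ 2)
        - (4 * (σ k 0 + σ k 1 + 2 * σ k 2) + 4 * (γ 0 ^ 2 + γ 1 ^ 2)))
      Filter.atTop (nhds 0) := by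
    have h := hvir.const_mul (-(1 / Real.pi))
    rw [mul_zero] at h
    refine h.congr fun k => (AffineToda.pohozaev_eq_virialForm hγ0 fun i => ?_).symm
    rw [hσ, AffineToda.massVector_ball_eq (hsol k) (hball k)]
  refine ⟨hmain, by rw [hμ, hμ, hμ]; linarith, fun φ s hφ hs => ?_⟩
  have h1 := hmain.comp hφ.tendsto_atTop
  have h2 : Filter.Tendsto (fun k => ((σ (φ k) 0 - σ (φ k) 2 - 2 * γ 0) ^ 2
      + (σ (φ k) 1 - σ (φ k) 2 - 2 * γ 1) ^ 2)
        - (4 * (σ (φ k) 0 + σ (φ k) 1 + 2 * σ (φ k) 2) + 4 * (γ 0 ^ 2 + γ 1 ^ 2)))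
      Filter.atTop (nhds (((s 0 - s 2 - 2 * γ 0) ^ 2 + (s 1 - s 2 - 2 * γ 1) ^ 2)
        - (4 * (s 0 + s 1 + 2 * s 2) + 4 * (γ 0 ^ 2 + γ 1 ^ 2)))) :=
    (((((hs 0).sub (hs 2)).sub_const _).pow 2).add ((((hs 1).sub (hs 2)).sub_const _).pow 2)).sub
      (((((hs 0).add (hs 1)).add ((hs 2).const_mul 2)).const_mul 4).add_const _)
  have h3 := tendsto_nhds_unique h2 h1
  have h4 : γ 2 = -(γ 0 + γ 1) / 2 := by linarith
  rw [hμ, hμ, hμ, h4]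
  linear_combination h3
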